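/- Let $\beta\in\mathbb C$ with $|\beta|>1$, let $\mathbb T$ be the unit circle, and put $$\alpha(t)=\frac{t-\beta}{\overline\beta t-1},\qquad \lambda=i\sqrt{|\beta|^2-1},\qquad \alpha_-(t)=\frac{\lambda t}{\overline\beta t-1},\qquad \chi(t)=\frac{t}{\alpha_-(t)}=\frac{\overline\beta t-1}{\lambda}\qquad(t\in\mathbb T).$$ For a function $f$ on $\mathbb T$ write $f_\alpha=f\circ\alpha$. Let $1<p<\infty$ and $1/p+1/q=1$. For $1\le r\le\infty$ let $H^r$ (resp. $\overline{H^r}$) be the space of $f\in L^r(\mathbb T)$ with $\widehat f_k=0$ for all $k<0$ (resp. for all $k>0$). Functions in $H^r$ are extended to the open unit disk by $f(z)=\sum_{k\ge0}\widehat f_kz^k$, and for $f\in\overline{H^r}$ we put $f(\infty)=\widehat f_0$. Let $P:\sum_{k\in\mathbb Z}\widehat f_kt^k\mapsto\sum_{k\ge0}\widehat f_kt^k$ be the Riesz projection of $L^p(\mathbb T)$ onto $H^p$. For $g\in L^\infty(\mathbb T)$ let $T(g):H^p\to H^p$, $\varphi\mapsto P(g\varphi)$, be the Toeplitz operator, and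 for a Fredholm operator $A$ let $\operatorname{ind}A=\dim\ker A-\dim\operatorname{coker}A$. A Wiener–Hopf factorization of $g$ in $H^p$ with index $m\in\mathbb Z$ is a representation $g=g_-t^mg_+$ a.e. on $\mathbb T$ such that $g_-(\infty)=1$, $g_+\in H^q$, $g_+^{-1}\in H^p$, $g_-\in\overline{H^p}$, $g_-^{-1}\in\overline{H^q}$, and such that the operator $g_+^{-1}Pg_-^{-1}I$, defined on $\operatorname{span}\{t^k:k\ge0\}$, extends to a bounded operator on $H^p$. **Theorem.** Let $g\in L^\infty(\mathbb T)$ satisfy $g\,g_\alpha=1$ a.e. on $\mathbb T$, and let $T(g):H^p\to H^p$ be Fredholm with $\operatorname{ind}T(g)=n$, $n\in\mathbb Z$. Then $g$ has a Wiener–Hopf factorization $g=g_-t^{-n}g_+$ in $H^p$, and for every such factorization the number $$\xi=\left(\frac{\lambda}{\overline\beta}\right)^{n}g_+^{-1}\!\left(\frac1{\overline\beta}\right)$$ (called the $\alpha$-signature of $g$) lies in $\{-1,1\}$ and $$g=\xi\,g_+\,\chi^{-n}\,(g_+^{-1})_\alpha\quad\text{a.e. on }\mathbb T.$$ -/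

import Mathlib

open MeasureTheory
open scoped ENNReal ComplexConjugate

noncomputable section

namespace GenTH

/-! ### The unit circle, Fourier coefficients and Hardy spaces -/

instance : MeasurableSpace Circle := borel Circle

instance : BorelSpace Circle := ⟨rfl⟩

/-- Normalized arc length `|dt| / (2π)` on the unit circle: the image of the uniform probability
measure on `ℝ / ℤ` under `x ↦ exp (2 π i x)`. -/
def arc : Measure Circle :=
  (AddCircle.haarAddCircle (T := 1)).map AddCircle.toCircle

instance : IsProbabilityMeasure arc :=
  Measure.isProbabilityMeasure_map AddCircle.continuous_toCircle.aemeasurable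

/-- The Fourier coefficient `(1 / 2π) ∫ f(e^{iθ}) e^{-inθ} dθ`. -/
def coeff (f : Circle → ℂ) (n : ℤ) : ℂ :=
  ∫ t, (t : ℂ) ^ (-n) * f t ∂arc

/-- `f ∈ H^p`: `f` is in `L^p` and its Fourier coefficients of negative order vanish. -/
def MemHardy (f : Circle → ℂ) (p : ℝ≥0∞) : Prop :=
  MemLp f p arc ∧ ∀ n : ℤ, n < 0 → coeff f n = 0

/-- `f` is in the conjugate Hardy space: `f` is in `L^p` and its Fourier coefficients of positive
order vanish. -/
def MemConjHardy (f : Circle → ℂ) (p : ℝ≥0∞) : Prop :=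
  MemLp f p arc ∧ ∀ n : ℤ, 0 < n → coeff f n = 0

/-- The value at `z`, `|z| < 1`, of the holomorphic extension `∑ f̂_k z^k` of a function `f` of
a Hardy space to the unit disk. -/
def valueInDisk (f : Circle → ℂ) (z : ℂ) : ℂ :=
  ∑' k : ℕ, coeff f k * z ^ k

/-- The value at `∞` of the holomorphic extension `∑_{k ≤ 0} f̂_k z^k` of a function `f` of
a conjugate Hardy space to the exterior of the unit disk. -/
def valueAtInfinity (f : Circle → ℂ) : ℂ :=
  coeff f 0

lemma continuous_monomial (n : ℤ) : Continuous fun t : Circle => (t : ℂ) ^ n :=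
  continuous_induced_dom.zpow₀ n fun t => Or.inl t.coe_ne_zero

lemma integrable_monomial_mul {f : Circle → ℂ} (hf : Integrable f arc) (n : ℤ) :
    Integrable (fun t : Circle => (t : ℂ) ^ n * f t) arc :=
  hf.bdd_mul (c := 1) (continuous_monomial n).aestronglyMeasurable
    (Filter.Eventually.of_forall fun t => by rw [norm_zpow, Circle.norm_coe, one_zpow])

lemma coeff_congr {f g : Circle → ℂ} (h : f =ᵐ[arc] g) (n : ℤ) : coeff f n = coeff g n :=
  integral_congr_ae (h.mono fun t ht => by simp [ht])

lemma coeff_add {f g : Circle → ℂ} (hf : Integrable f arc) (hg : Integrable g arc) (n : ℤ) :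
    coeff (f + g) n = coeff f n + coeff g n := by
  simp only [coeff, Pi.add_apply, mul_add]
  exact integral_add (integrable_monomial_mul hf _) (integrable_monomial_mul hg _)

lemma coeff_smul (c : ℂ) (f : Circle → ℂ) (n : ℤ) : coeff (c • f) n = c * coeff f n := by
  simp only [coeff, Pi.smul_apply, smul_eq_mul]
  rw [← integral_const_mul]
  exact integral_congr_ae (Filter.Eventually.of_forall fun t => by ring)

/-- The Hardy space `H^p`, as a subspace of `L^p`. -/
def Hardy (p : ℝ≥0∞) [hp : Fact (1 ≤ p)] : Submodule ℂ (Lp ℂ p arc) where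
  carrier := {f | ∀ n : ℤ, n < 0 → coeff f n = 0}
  zero_mem' n _ := by
    rw [coeff_congr (Lp.coeFn_zero ℂ p arc)]
    simp [coeff]
  add_mem' {f g} hf hg n hn := by
    rw [coeff_congr (Lp.coeFn_add f g),
      coeff_add ((Lp.memLp f).integrable hp.out) ((Lp.memLp g).integrable hp.out),
      hf n hn, hg n hn, add_zero]
  smul_mem' c f hf n hn := by
    rw [coeff_congr (Lp.coeFn_smul c f), coeff_smul, hf n hn, mul_zero]

/-! ### Toeplitz operators -/

open Classical in
/-- The Riesz projection `P : ∑_{n ∈ ℤ} f̂_n t^n ↦ ∑_{n ≥ 0} f̂_n t^n`, as a bounded operator from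
`L^p` to `H^p`. The two families of coefficients determine this operator uniquely, and it exists
for all `1 < p < ∞` (the value `0` is only a default for `p = 1` and `p = ∞`, where there is no such
operator). -/
def rieszProjection (p : ℝ≥0∞) [Fact (1 ≤ p)] : Lp ℂ p arc →L[ℂ] Hardy p :=
  if h : ∃ P : Lp ℂ p arc →L[ℂ] Hardy p, ∀ f : Lp ℂ p arc, ∀ n : ℤ, 0 ≤ n →
      coeff (P f : Lp ℂ p arc) n = coeff f n
  then h.choose else 0

/-- The operator of multiplication by `g ∈ L^∞` on `L^p`. -/
def mulOperator (p : ℝ≥0∞) [Fact (1 ≤ p)] (g : Lp ℂ ∞ arc) : Lp ℂ p arc →L[ℂ] Lp ℂ p arc :=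
  (ContinuousLinearMap.mul ℂ ℂ).holderL arc ∞ p p g

/-- The Toeplitz operator `T(g) : H^p → H^p`, `φ ↦ P (g φ)`. -/
def toeplitz (p : ℝ≥0∞) [Fact (1 ≤ p)] (g : Lp ℂ ∞ arc) : Hardy p →L[ℂ] Hardy p :=
  rieszProjection p ∘L mulOperator p g ∘L (Hardy p).subtypeL

/-- The index `dim ker A - dim coker A` of a Fredholm operator. -/
def fredholmIndex {E : Type*} [NormedAddCommGroup E] [NormedSpace ℂ E] (A : E →L[ℂ] E) : ℤ :=
  (Module.finrank ℂ A.ker : ℤ) - (Module.finrank ℂ (E ⧸ A.range) : ℤ)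

/-! ### Wiener–Hopf factorization -/

/-- `g = g₋ t^m g₊` is a weak Wiener–Hopf factorization of `g` in `H^p`, where `1/p + 1/q = 1`,
normalized by `g₋(∞) = 1`. -/
structure IsWeakWienerHopf (p q : ℝ≥0∞) (g gm : Circle → ℂ) (m : ℤ) (gp : Circle → ℂ) : Prop where
  eq : ∀ᵐ t ∂arc, g t = gm t * (t : ℂ) ^ m * gp t
  normalized : valueAtInfinity gm = 1
  ne_zero_plus : ∀ᵐ t ∂arc, gp t ≠ 0
  ne_zero_minus : ∀ᵐ t ∂arc, gm t ≠ 0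
  plus : MemHardy gp q
  plus_inv : MemHardy gp⁻¹ p
  minus : MemConjHardy gm p
  minus_inv : MemConjHardy gm⁻¹ q

/-- `u = P f`, for integrable `f` and `u`: the Fourier coefficients of `u` of non-negative order
are those of `f`, and those of negative order vanish. -/
def IsRieszProjection (f u : Circle → ℂ) : Prop :=
  MemHardy u 1 ∧ ∀ n : ℤ, 0 ≤ n → coeff u n = coeff f n

/-- `g = g₋ t^m g₊` is a Wiener–Hopf factorization of `g` in `H^p`: a weak one for which the
operator `g₊⁻¹ P g₋⁻¹ I`, defined on the linear span of the monomials `t^k`, `k ≥ 0`, extends to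
a bounded operator `S` on `H^p`. -/
structure IsWienerHopf (p q : ℝ≥0∞) [Fact (1 ≤ p)] (g gm : Circle → ℂ) (m : ℤ)
    (gp : Circle → ℂ) : Prop extends IsWeakWienerHopf p q g gm m gp where
  bounded : ∃ S : Hardy p →L[ℂ] Hardy p, ∀ (k : ℕ) (e : Hardy p),
    ((e : Lp ℂ p arc) =ᵐ[arc] fun t => (t : ℂ) ^ k) →
      ∃ u : Circle → ℂ, IsRieszProjection (fun t => (gm t)⁻¹ * (t : ℂ) ^ k) u ∧
        (S e : Lp ℂ p arc) =ᵐ[arc] fun t => (gp t)⁻¹ * u t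

/-! ### The shift `α` -/

lemma norm_sub_eq (β : ℂ) (t : Circle) : ‖(t : ℂ) - β‖ = ‖conj β * t - 1‖ := by
  have h : conj ((t : ℂ) - β) * t = -(conj β * t - 1) := by
    have h1 : conj (t : ℂ) * t = 1 := by
      rw [← Complex.normSq_eq_conj_mul_self, Circle.normSq_coe]; simp
    rw [map_sub, sub_mul, h1]; ring
  have h2 := congrArg norm h
  rwa [norm_mul, Circle.norm_coe, mul_one, norm_neg, RCLike.norm_conj] at h2

lemma denom_ne_zero {β : ℂ} (hβ : 1 < ‖β‖) (t : Circle) : conj β * (t : ℂ) - 1 ≠ 0 := by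
  intro h
  have h1 := congrArg norm (sub_eq_zero.mp h)
  rw [norm_mul, Circle.norm_coe, mul_one, RCLike.norm_conj, norm_one] at h1
  exact hβ.ne' h1

/-- The shift `α(t) = (t - β) / (β̄ t - 1)`, `|β| > 1`, as a map of the unit circle to itself. -/
def shift (β : ℂ) (hβ : 1 < ‖β‖) (t : Circle) : Circle :=
  ⟨((t : ℂ) - β) / (conj β * t - 1), mem_sphere_zero_iff_norm.2 <| by
    rw [norm_div, norm_sub_eq]
    exact div_self (norm_ne_zero_iff.mpr (denom_ne_zero hβ t))⟩

/-- `λ = i √(|β|² - 1)`. -/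
def lam (β : ℂ) : ℂ := Complex.I * (Real.sqrt (‖β‖ ^ 2 - 1) : ℝ)

/-- `α₋(t) = λ t / (β̄ t - 1)`. -/
def alphaMinus (β : ℂ) (t : Circle) : ℂ := lam β * t / (conj β * t - 1)

/-- `χ(t) = t / α₋(t)`, that is `χ(t) = (β̄ t - 1) / λ`. -/
def chi (β : ℂ) (t : Circle) : ℂ := t / alphaMinus β t

/-- The number `(λ / β̄)^n g₊⁻¹(1 / β̄)`, where `g₊⁻¹` is evaluated in the unit disk. -/
def signature (β : ℂ) (n : ℤ) (gp : Circle → ℂ) : ℂ :=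
  (lam β / conj β) ^ n * valueInDisk gp⁻¹ (1 / conj β)

end GenTH

end

open MeasureTheory
open scoped ENNReal ComplexConjugate

noncomputable section

namespace GenTH

/-! The formula for `g` is a Liouville argument. The shift `α` is an involution of the circle which
exchanges the disk with its exterior, so composition with `α` exchanges Hardy and conjugate Hardy
functions, and `α(∞) = 1/β̄`. Inserting `g = g₋ t⁻ⁿ g₊` into `g g_α = 1` and sorting factors gives
`(g₋)_α g₊ = tⁿ αⁿ (g₊⁻¹)_α g₋⁻¹`. With `G = (1 - 1/(β̄ t))⁻¹` one has `conj G · t α = -(β/β̄) G` on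
the circle. Multiplying by `(conj G)ⁿ` therefore makes the left side analytic and the right side
anti-analytic, so both are constant. Comparing values at `∞` identifies the constant through
`g₊⁻¹(1/β̄)`. Solving for `g₋` gives `g = ξ⁻¹ g₊ χ⁻ⁿ (g₊⁻¹)_α`, and `g g_α = χ χ_α = 1` then forces
`ξ² = 1`. This is `IsWeakWienerHopf.signature`; its analytic core is `MemHardy.comp_shift`.

For existence put `h = tⁿ g`. Coburn's lemma and a dimension count make `T(h)` bijective
(`toeplitz_bijective`). Let `φ = T(h)⁻¹ 1`, and let `η` in the conjugate `H^q` represent the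
functional sending `f` to the value of `T(h)⁻¹ P f` at the origin. Then `φ · (hη) = (hφ) · η` is
analytic and anti-analytic, hence a constant `c`, nonzero because there are no zero divisors. The
factors are `g₋ = hφ` and `g₊ = hη/c`, and the operator required to be bounded is `T(h)⁻¹` itself
(`exists_isWienerHopf_of_bijective`).

All of this is done with Fourier coefficients rather than boundary values. The basic tool is the
product rule `MemHardy.coeff_mul`, which needs density of analytic polynomials in `H^p` and hence a
bounded Riesz projection. `HasRieszProjection p` is carried as a hypothesis and discharged at the
end by M. Riesz' theorem `hasRieszProjection`. The `L^p`–`L^q` duality used for Coburn's lemma, for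
`η` and for M. Riesz' theorem above `2` is `exists_memLp_eq_integral`. -/

/-! ### Fourier coefficients on the circle: uniqueness and approximation. -/

lemma toCircle_measurableEmbedding :
    MeasurableEmbedding (AddCircle.toCircle : AddCircle (1 : ℝ) → Circle) := by
  have : (AddCircle.toCircle : AddCircle (1 : ℝ) → Circle) =
      AddCircle.homeomorphCircle (one_ne_zero : (1 : ℝ) ≠ 0) := by
    ext x; rw [AddCircle.homeomorphCircle_apply]
  rw [this]
  exact (AddCircle.homeomorphCircle one_ne_zero).measurableEmbedding

lemma integral_arc (f : Circle → ℂ) :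
    ∫ t, f t ∂arc = ∫ x, f (AddCircle.toCircle x) ∂(AddCircle.haarAddCircle (T := 1)) :=
  toCircle_measurableEmbedding.integral_map f

lemma coe_toCircle_zpow (n : ℤ) (x : AddCircle (1 : ℝ)) :
    ((AddCircle.toCircle x : Circle) : ℂ) ^ n = fourier n x := by
  rw [fourier_apply, AddCircle.toCircle_zsmul, Circle.coe_zpow]

/-- Bridge to Fourier theory on `AddCircle 1`, from which orthogonality of the monomials is taken.
-/
lemma coeff_eq_fourierCoeff (f : Circle → ℂ) (n : ℤ) :
    coeff f n = fourierCoeff (fun x : AddCircle (1 : ℝ) => f (AddCircle.toCircle x)) n := by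
  simp only [coeff, fourierCoeff, integral_arc, coe_toCircle_zpow, smul_eq_mul]

lemma integral_monomial (n : ℤ) : ∫ t : Circle, (t : ℂ) ^ n ∂arc = if n = 0 then 1 else 0 := by
  have h := coeff_eq_fourierCoeff (fun t : Circle => (t : ℂ) ^ n) 0
  simp only [coe_toCircle_zpow] at h
  have h2 := congrFun (fourierCoeff_fourier (T := 1) n) 0
  rw [show (fun x : AddCircle (1:ℝ) => fourier n x) = ⇑(fourier (T := 1) n) from rfl, h2] at h
  simp only [coeff, neg_zero, zpow_zero, one_mul] at h
  rw [h, Pi.single_apply]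
  simp [eq_comm]

lemma coeff_monomial (n m : ℤ) :
    coeff (fun t : Circle => (t : ℂ) ^ n) m = if n = m then 1 else 0 := by
  simp only [coeff, ← zpow_add₀ (Circle.coe_ne_zero _), integral_monomial]
  congr 1
  rw [eq_iff_iff]; omega

/-- The trigonometric polynomial with coefficients `c`. -/
def trig (c : ℤ →₀ ℂ) (t : Circle) : ℂ := c.sum fun k a => a * (t : ℂ) ^ k

lemma continuous_trig (c : ℤ →₀ ℂ) : Continuous (trig c) := by
  unfold trig Finsupp.sum
  exact continuous_finsetSum _ fun k _ => continuous_const.mul (continuous_monomial k)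

/-- Weierstrass approximation, transported from `span_fourier_closure_eq_top`. -/
lemma exists_trig_near (φ : C(Circle, ℂ)) {ε : ℝ} (hε : 0 < ε) :
    ∃ c : ℤ →₀ ℂ, ∀ t, ‖φ t - trig c t‖ < ε := by
  let ψ : C(AddCircle (1 : ℝ), ℂ) := φ.comp ⟨_, AddCircle.continuous_toCircle⟩
  have hψ : ψ ∈ (Submodule.span ℂ (Set.range <| @fourier 1)).topologicalClosure := by
    rw [span_fourier_closure_eq_top]; trivial
  obtain ⟨y, hy, hd⟩ := Metric.mem_closure_iff.1 hψ ε hε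
  obtain ⟨c, rfl⟩ := (Finsupp.mem_span_range_iff_exists_finsupp).1 hy
  refine ⟨c, fun t => ?_⟩
  obtain ⟨x, rfl⟩ := (AddCircle.homeomorphCircle (one_ne_zero : (1 : ℝ) ≠ 0)).surjective t
  rw [AddCircle.homeomorphCircle_apply]
  have := (ContinuousMap.norm_coe_le_norm (ψ - c.sum fun i a => a • fourier i) x)
  rw [dist_eq_norm] at hd
  refine lt_of_le_of_lt ?_ hd
  refine le_of_eq_of_le ?_ this
  rw [ContinuousMap.sub_apply, Finsupp.sum, ContinuousMap.sum_apply]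
  simp only [ψ, trig, Finsupp.sum, coe_toCircle_zpow, ContinuousMap.smul_apply, smul_eq_mul]
  rfl

lemma coeff_eq_integral_mul (f : Circle → ℂ) (n : ℤ) :
    ∫ t, (t : ℂ) ^ n * f t ∂arc = coeff f (-n) := by
  simp [coeff]

lemma integral_trig_mul (c : ℤ →₀ ℂ) {f : Circle → ℂ} (hf : Integrable f arc) :
    ∫ t, trig c t * f t ∂arc = c.sum fun k a => a * coeff f (-k) := by
  simp only [trig, Finsupp.sum, Finset.sum_mul]
  rw [integral_finsetSum]
  · refine Finset.sum_congr rfl fun k _ => ?_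
    rw [← coeff_eq_integral_mul, ← integral_const_mul]
    simp only [mul_assoc]
  · intro k _
    simp only [mul_assoc]
    exact (integrable_monomial_mul hf k).const_mul _

lemma integrable_continuous_mul {f φ : Circle → ℂ} (hφ : Continuous φ) (hf : Integrable f arc) :
    Integrable (fun t => φ t * f t) arc := by
  obtain ⟨C, hC⟩ := isCompact_univ.exists_bound_of_continuousOn hφ.continuousOn
  exact hf.bdd_mul (c := C) hφ.aestronglyMeasurable
    (Filter.Eventually.of_forall fun t => hC t trivial)

/-- An integrable function all of whose Fourier coefficients vanish annihilates the continuous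
functions. -/
lemma integral_continuous_mul_eq_zero {f : Circle → ℂ} (hf : Integrable f arc)
    (h : ∀ n, coeff f n = 0) {φ : Circle → ℂ} (hφ : Continuous φ) :
    ∫ t, φ t * f t ∂arc = 0 := by
  have key : ∀ ε > 0, ‖∫ t, φ t * f t ∂arc‖ ≤ ε * ∫ t, ‖f t‖ ∂arc := by
    intro ε hε
    obtain ⟨c, hc⟩ := exists_trig_near ⟨φ, hφ⟩ hε
    have h0 : ∫ t, trig c t * f t ∂arc = 0 := by
      rw [integral_trig_mul c hf]; simp [Finsupp.sum, h]
    have h1 : ∫ t, φ t * f t ∂arc = ∫ t, (φ t - trig c t) * f t ∂arc := by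
      simp only [sub_mul]
      rw [integral_sub (integrable_continuous_mul hφ hf)
        (integrable_continuous_mul (continuous_trig c) hf), h0, sub_zero]
    rw [h1, ← integral_const_mul]
    refine norm_integral_le_of_norm_le (hf.norm.const_mul ε) (Filter.Eventually.of_forall fun t => ?_)
    rw [norm_mul]
    exact mul_le_mul_of_nonneg_right (hc t).le (norm_nonneg _)
  by_contra hne
  have hpos : 0 < ‖∫ t, φ t * f t ∂arc‖ := norm_pos_iff.2 hne
  set I := ∫ t, ‖f t‖ ∂arc
  have hI : 0 ≤ I := integral_nonneg fun t => norm_nonneg _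
  -- With this `ε` the bound is less than half of the norm it bounds; the `+ 1` covers `I = 0`.
  have := key (‖∫ t, φ t * f t ∂arc‖ / (2 * (I + 1))) (by positivity)
  rw [div_mul_eq_mul_div, le_div_iff₀ (by positivity)] at this
  nlinarith

/-- Uniqueness of Fourier coefficients in `L^1`. -/
lemma ae_eq_zero_of_coeff_eq_zero {f : Circle → ℂ} (hf : Integrable f arc)
    (h : ∀ n, coeff f n = 0) : f =ᵐ[arc] 0 := by
  refine ae_eq_zero_of_integral_contMDiff_smul_eq_zero
    (modelWithCornersSelf ℝ (EuclideanSpace ℝ (Fin 1))) hf.locallyIntegrable fun g hg _ => ?_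
  have := integral_continuous_mul_eq_zero hf h (φ := fun t => (g t : ℂ))
    (Complex.continuous_ofReal.comp hg.continuous)
  simpa [Complex.real_smul] using this

lemma coeff_sub {f g : Circle → ℂ} (hf : Integrable f arc) (hg : Integrable g arc) (n : ℤ) :
    coeff (f - g) n = coeff f n - coeff g n := by
  simp only [coeff, Pi.sub_apply, mul_sub]
  exact integral_sub (integrable_monomial_mul hf _) (integrable_monomial_mul hg _)

lemma ae_eq_of_coeff_eq {f g : Circle → ℂ} (hf : Integrable f arc) (hg : Integrable g arc)
    (h : ∀ n, coeff f n = coeff g n) : f =ᵐ[arc] g := by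
  have := ae_eq_zero_of_coeff_eq_zero (hf.sub hg) fun n => by
    rw [coeff_sub hf hg, h, sub_self]
  filter_upwards [this] with t ht
  exact sub_eq_zero.1 ht

lemma coeff_const (c : ℂ) (n : ℤ) : coeff (fun _ => c) n = if n = 0 then c else 0 := by
  have : (fun _ : Circle => c) = c • fun t : Circle => (t : ℂ) ^ (0 : ℤ) := by ext; simp
  rw [this, coeff_smul, coeff_monomial]
  simp [eq_comm]

/-- A function in both Hardy spaces is constant. -/
lemma ae_eq_const {f : Circle → ℂ} (hf : Integrable f arc) (h₁ : ∀ n < 0, coeff f n = 0)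
    (h₂ : ∀ n, 0 < n → coeff f n = 0) : f =ᵐ[arc] fun _ => coeff f 0 := by
  refine ae_eq_of_coeff_eq hf (integrable_const _) fun n => ?_
  rw [coeff_const]
  rcases lt_trichotomy n 0 with h | h | h
  · rw [h₁ n h, if_neg h.ne]
  · simp [h]
  · rw [h₂ n h, if_neg h.ne']

/-- Conjugation is `t ↦ t⁻¹` on monomials, so it exchanges the two kinds of Hardy functions; the
facts about one kind are deduced from the other in this way. -/
lemma coeff_conj (f : Circle → ℂ) (n : ℤ) :
    coeff (fun t => conj (f t)) n = conj (coeff f (-n)) := by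
  rw [coeff, coeff, ← integral_conj]
  refine integral_congr_ae (Filter.Eventually.of_forall fun t => ?_)
  simp only [map_mul, map_zpow₀, ← Circle.coe_inv_eq_conj, inv_zpow', Circle.coe_inv, neg_neg]

lemma memLp_conj {f : Circle → ℂ} {p : ℝ≥0∞} (hf : MemLp f p arc) :
    MemLp (fun t => conj (f t)) p arc :=
  hf.of_le (Complex.continuous_conj.comp_aestronglyMeasurable hf.1)
    (Filter.Eventually.of_forall fun t => by simp)

lemma MemConjHardy.conj {f : Circle → ℂ} {p : ℝ≥0∞} (hf : MemConjHardy f p) :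
    MemHardy (fun t => conj (f t)) p :=
  ⟨memLp_conj hf.1, fun n hn => by rw [coeff_conj, hf.2 _ (by omega), map_zero]⟩

lemma MemHardy.congr {f g : Circle → ℂ} {p : ℝ≥0∞} (hf : MemHardy f p) (h : f =ᵐ[arc] g) :
    MemHardy g p :=
  ⟨hf.1.ae_eq h, fun n hn => by rw [← coeff_congr h, hf.2 n hn]⟩

lemma MemConjHardy.congr {f g : Circle → ℂ} {p : ℝ≥0∞} (hf : MemConjHardy f p)
    (h : f =ᵐ[arc] g) : MemConjHardy g p :=
  ⟨hf.1.ae_eq h, fun n hn => by rw [← coeff_congr h, hf.2 n hn]⟩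

lemma coeff_monomial_mul (f : Circle → ℂ) (m n : ℤ) :
    coeff (fun t => (t : ℂ) ^ m * f t) n = coeff f (n - m) := by
  simp only [coeff, ← mul_assoc, ← zpow_add₀ (Circle.coe_ne_zero _)]
  rw [show -n + m = -(n - m) by ring]

lemma memLp_continuous_mul {f φ : Circle → ℂ} {p : ℝ≥0∞} (hφ : Continuous φ)
    (hf : MemLp f p arc) : MemLp (fun t => φ t * f t) p arc := by
  obtain ⟨C, hC⟩ := isCompact_univ.exists_bound_of_continuousOn hφ.continuousOn
  refine hf.of_le_mul (c := C) (hφ.aestronglyMeasurable.mul hf.1)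
    (Filter.Eventually.of_forall fun t => ?_)
  rw [norm_mul]
  exact mul_le_mul_of_nonneg_right (hC t trivial) (norm_nonneg _)

lemma memLp_continuous {φ : Circle → ℂ} (hφ : Continuous φ) (p : ℝ≥0∞) : MemLp φ p arc := by
  obtain ⟨C, hC⟩ := isCompact_univ.exists_bound_of_continuousOn hφ.continuousOn
  exact MemLp.of_bound hφ.aestronglyMeasurable C (Filter.Eventually.of_forall fun t => hC t trivial)

/-- Trigonometric polynomials are dense in `L^p`, `p < ∞`. -/
lemma exists_trig_eLpNorm_sub_le {p : ℝ≥0∞} (hp : 1 ≤ p) (hp' : p ≠ ∞) {f : Circle → ℂ}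
    (hf : MemLp f p arc) {ε : ℝ≥0∞} (hε : ε ≠ 0) :
    ∃ c : ℤ →₀ ℂ, eLpNorm (f - trig c) p arc ≤ ε := by
  obtain ⟨δ, hδ, hδε⟩ := ENNReal.lt_iff_exists_real_btwn.1 (ENNReal.half_pos hε)
  have hδ0 : 0 < δ := by
    by_contra hcon
    rw [ENNReal.ofReal_of_nonpos (not_lt.1 hcon)] at hδε
    simp at hδε
  obtain ⟨φ, hφ, -⟩ := hf.exists_boundedContinuous_eLpNorm_sub_le hp' (ENNReal.half_pos hε).ne'
  obtain ⟨c, hc⟩ := exists_trig_near φ.toContinuousMap hδ0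
  refine ⟨c, ?_⟩
  have h2 : eLpNorm ((φ : Circle → ℂ) - trig c) p arc ≤ ε / 2 := by
    refine (eLpNorm_le_of_ae_bound (C := δ) (Filter.Eventually.of_forall fun t => (hc t).le)).trans
      ?_
    simpa using hδε.2.le
  have : f - trig c = (f - φ) + ((φ : Circle → ℂ) - trig c) := by ext; simp
  rw [this]
  refine (eLpNorm_add_le ?_ ?_ hp).trans ?_
  · exact hf.1.sub φ.continuous.aestronglyMeasurable
  · exact φ.continuous.aestronglyMeasurable.sub (continuous_trig c).aestronglyMeasurable
  · exact (add_le_add hφ h2).trans (ENNReal.add_halves ε).le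

/-! ### Consequences of a bounded Riesz projection: density and products. -/

/-- There is a bounded Riesz projection of `L^p` onto `H^p`. -/
def HasRieszProjection (p : ℝ≥0∞) [Fact (1 ≤ p)] : Prop :=
  ∃ P : Lp ℂ p arc →L[ℂ] Hardy p, ∀ f : Lp ℂ p arc, ∀ n : ℤ, 0 ≤ n →
      coeff (P f : Lp ℂ p arc) n = coeff f n

lemma coeff_rieszProjection {p : ℝ≥0∞} [Fact (1 ≤ p)] (h : HasRieszProjection p)
    (f : Lp ℂ p arc) {n : ℤ} (hn : 0 ≤ n) :
    coeff (rieszProjection p f : Lp ℂ p arc) n = coeff f n := by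
  rw [rieszProjection, dif_pos (show ∃ P : Lp ℂ p arc →L[ℂ] Hardy p, _ from h)]
  exact h.choose_spec f n hn

lemma integrable_Lp {p : ℝ≥0∞} [hp : Fact (1 ≤ p)] (f : Lp ℂ p arc) : Integrable f arc :=
  (Lp.memLp f).integrable hp.out

lemma Lp_eq_of_coeff_eq {p : ℝ≥0∞} [Fact (1 ≤ p)] {f g : Lp ℂ p arc}
    (h : ∀ n, coeff f n = coeff g n) : f = g :=
  Lp.ext (ae_eq_of_coeff_eq (integrable_Lp f) (integrable_Lp g) h)

lemma Hardy_eq_of_coeff_eq {p : ℝ≥0∞} [Fact (1 ≤ p)] {f g : Hardy p}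
    (h : ∀ n, 0 ≤ n → coeff (f : Lp ℂ p arc) n = coeff (g : Lp ℂ p arc) n) : f = g := by
  refine Subtype.ext (Lp_eq_of_coeff_eq fun n => ?_)
  rcases lt_or_ge n 0 with hn | hn
  · rw [f.2 n hn, g.2 n hn]
  · exact h n hn

lemma memHardy_coe {p : ℝ≥0∞} [Fact (1 ≤ p)] (f : Hardy p) : MemHardy (f : Lp ℂ p arc) p :=
  ⟨Lp.memLp _, f.2⟩

/-- The element of the Hardy space determined by a function. -/
def MemHardy.toHardy {p : ℝ≥0∞} [Fact (1 ≤ p)] {f : Circle → ℂ} (hf : MemHardy f p) : Hardy p :=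
  ⟨hf.1.toLp f, fun n hn => by rw [coeff_congr hf.1.coeFn_toLp, hf.2 n hn]⟩

lemma MemHardy.coe_toHardy {p : ℝ≥0∞} [Fact (1 ≤ p)] {f : Circle → ℂ} (hf : MemHardy f p) :
    ((hf.toHardy : Hardy p) : Lp ℂ p arc) =ᵐ[arc] f :=
  hf.1.coeFn_toLp

lemma coeff_trig (c : ℤ →₀ ℂ) (n : ℤ) : coeff (trig c) n = c n := by
  have h := integral_trig_mul c (f := fun t : Circle => (t : ℂ) ^ (-n))
    (memLp_continuous (continuous_monomial _) 1 |>.integrable le_rfl)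
  simp only [coeff_monomial, neg_inj] at h
  rw [coeff]
  simp only [mul_comm]
  rw [h, Finsupp.sum]
  simp only [mul_ite, mul_one, mul_zero, Finset.sum_ite_eq, Finsupp.mem_support_iff]
  split_ifs with h0
  · rfl
  · simpa using (not_not.1 h0).symm

lemma eLpNorm_toLp_le {p : ℝ≥0∞} [Fact (1 ≤ p)] (f : Lp ℂ p arc) {δ : ℝ}
    (hδ : ‖f‖ ≤ δ) : eLpNorm f p arc ≤ ENNReal.ofReal δ := by
  rw [Lp.norm_def] at hδ
  exact (ENNReal.ofReal_toReal (Lp.eLpNorm_ne_top f)).symm.le.trans (ENNReal.ofReal_le_ofReal hδ)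

/-- Analytic polynomials are dense in `H^p`. -/
lemma MemHardy.exists_trig_eLpNorm_sub_le {p : ℝ≥0∞} [hp : Fact (1 ≤ p)] (hp' : p ≠ ∞)
    (hP : HasRieszProjection p) {f : Circle → ℂ} (hf : MemHardy f p) {ε : ℝ} (hε : 0 < ε) :
    ∃ c : ℤ →₀ ℂ, (∀ k < 0, c k = 0) ∧ eLpNorm (f - trig c) p arc ≤ ENNReal.ofReal ε := by
  obtain ⟨P, hP⟩ := hP
  -- Since `P` fixes `f` and truncates `trig c` to `trig d`, it maps `f - trig c` to `f - trig d`
  -- and enlarges the error by at most the factor `‖P‖`.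
  set δ := ε / (‖P‖ + 1) with hδ
  have hδ0 : 0 < δ := by positivity
  obtain ⟨c, hc⟩ := GenTH.exists_trig_eLpNorm_sub_le hp.out hp' hf.1
    (ENNReal.ofReal_pos.2 hδ0).ne'
  set d := c.filter (fun k => 0 ≤ k) with hd
  have hd0 : ∀ k < 0, d k = 0 := fun k hk => by
    rw [hd, Finsupp.filter_apply_neg]; omega
  refine ⟨d, hd0, ?_⟩
  have hcm := memLp_continuous (continuous_trig c) p
  have hdm := memLp_continuous (continuous_trig d) p
  set F := (hf.1.sub hcm).toLp _ with hF
  have hFe : F =ᵐ[arc] f - trig c := (hf.1.sub hcm).coeFn_toLp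
  have hFn : ‖F‖ ≤ δ := by
    rw [Lp.norm_toLp]
    exact ENNReal.toReal_le_of_le_ofReal hδ0.le hc
  have hfi := hf.1.integrable hp.out
  have hPF : ((P F : Hardy p) : Lp ℂ p arc) =ᵐ[arc] f - trig d := by
    refine ae_eq_of_coeff_eq (integrable_Lp _) ((hf.1.sub hdm).integrable hp.out) fun n => ?_
    rw [coeff_sub hfi (hdm.integrable hp.out), coeff_trig]
    rcases lt_or_ge n 0 with hn | hn
    · rw [(P F).2 n hn, hf.2 n hn, hd0 n hn, sub_zero]
    · rw [hP F n hn, coeff_congr hFe, coeff_sub hfi (hcm.integrable hp.out), coeff_trig, hd,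
        Finsupp.filter_apply_pos _ _ hn]
  rw [← eLpNorm_congr_ae hPF]
  refine eLpNorm_toLp_le _ ?_
  have h1 : ‖P F‖ ≤ ‖P‖ * δ :=
    (P.le_opNorm F).trans (mul_le_mul_of_nonneg_left hFn (norm_nonneg P))
  refine le_trans (show ‖((P F : Hardy p) : Lp ℂ p arc)‖ ≤ ‖P‖ * δ from h1) ?_
  rw [hδ, mul_div_assoc', div_le_iff₀ (by positivity)]
  nlinarith [norm_nonneg P]

lemma norm_integral_mul_le {p q : ℝ≥0∞} [p.HolderConjugate q] {f g : Circle → ℂ}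
    (hf : MemLp f p arc) (hg : MemLp g q arc) :
    ‖∫ t, f t * g t ∂arc‖ₑ ≤ eLpNorm f p arc * eLpNorm g q arc := by
  refine (enorm_integral_le_lintegral_enorm _).trans ?_
  rw [← eLpNorm_one_eq_lintegral_enorm]
  have h := eLpNorm_smul_le_mul_eLpNorm (p := p) (q := q) (r := 1) hg.1 hf.1
  rw [smul_eq_mul] at h
  exact h

lemma integrable_mul {p q : ℝ≥0∞} [p.HolderConjugate q] {f g : Circle → ℂ}
    (hf : MemLp f p arc) (hg : MemLp g q arc) : Integrable (fun t => f t * g t) arc :=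
  memLp_one_iff_integrable.1 (hg.mul' (p := p) (q := q) (r := 1) hf)

/-- Hölder's inequality: convergence in `L^p` suffices when pairing with a fixed function of `L^q`.
-/
lemma tendsto_integral_mul {p q : ℝ≥0∞} [p.HolderConjugate q] {f g : Circle → ℂ}
    {F : ℕ → Circle → ℂ} (hf : MemLp f p arc) (hF : ∀ j, MemLp (F j) p arc)
    (hg : MemLp g q arc)
    (h : Filter.Tendsto (fun j => eLpNorm (f - F j) p arc) Filter.atTop (nhds 0)) :
    Filter.Tendsto (fun j => ∫ t, F j t * g t ∂arc) Filter.atTop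
      (nhds (∫ t, f t * g t ∂arc)) := by
  rw [tendsto_iff_edist_tendsto_0]
  have h2 : Filter.Tendsto (fun j => eLpNorm (f - F j) p arc * eLpNorm g q arc) Filter.atTop
      (nhds 0) := by
    simpa using ENNReal.Tendsto.mul_const h (Or.inr hg.2.ne)
  refine tendsto_of_tendsto_of_tendsto_of_le_of_le tendsto_const_nhds h2 (fun _ => zero_le)
    fun j => ?_
  rw [edist_comm, edist_eq_enorm_sub, ← integral_sub (integrable_mul hf hg) (integrable_mul (hF j) hg)]
  simp only [← sub_mul]
  exact norm_integral_mul_le (hf.sub (hF j)) hg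

lemma coeff_trig_mul (c : ℤ →₀ ℂ) {f : Circle → ℂ} (hf : Integrable f arc) (n : ℤ) :
    coeff (fun t => trig c t * f t) n = c.sum fun k a => a * coeff f (n - k) := by
  have h := integral_trig_mul c (integrable_monomial_mul hf (-n))
  simp only [coeff_monomial_mul] at h
  rw [coeff]
  convert h using 3
  · ring
  · ext k; congr 2; ring

/-- Fourier coefficients of non-positive order of a product of Hardy functions. -/
lemma MemHardy.coeff_mul {p q : ℝ≥0∞} [hp : Fact (1 ≤ p)] [p.HolderConjugate q] (hp' : p ≠ ∞)
    (hP : HasRieszProjection p) {f g : Circle → ℂ} (hf : MemHardy f p) (hg : MemHardy g q)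
    {n : ℤ} (hn : n ≤ 0) :
    coeff (fun t => f t * g t) n = coeff f 0 * coeff g n := by
  have hgi : Integrable g arc := by
    have : q.HolderConjugate p := ENNReal.HolderConjugate.symm
    exact hg.1.integrable (ENNReal.HolderConjugate.one_le q p)
  have hj : ∀ j : ℕ, (0 : ℝ) < 1 / (j + 1) := fun j => by positivity
  choose c hc0 hc using fun j : ℕ => hf.exists_trig_eLpNorm_sub_le hp' hP (hj j)
  have hcm := fun j => memLp_continuous (continuous_trig (c j)) p
  have ht : Filter.Tendsto (fun j => eLpNorm (f - trig (c j)) p arc) Filter.atTop (nhds 0) := by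
    refine tendsto_of_tendsto_of_tendsto_of_le_of_le tendsto_const_nhds ?_ (fun _ => zero_le) hc
    simpa using ENNReal.tendsto_ofReal tendsto_one_div_add_atTop_nhds_zero_nat
  have hm : MemLp (fun t : Circle => (t : ℂ) ^ (-n) * g t) q arc :=
    memLp_continuous_mul (continuous_monomial _) hg.1
  have h1 := tendsto_integral_mul hf.1 hcm hm ht
  have h2 := tendsto_integral_mul hf.1 hcm (memLp_continuous (continuous_monomial 0) q) ht
  have e1 : ∀ j, ∫ t, trig (c j) t * ((t : ℂ) ^ (-n) * g t) ∂arc = c j 0 * coeff g n := by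
    intro j
    have := coeff_trig_mul (c j) hgi n
    rw [coeff] at this
    calc _ = ∫ t : Circle, (t : ℂ) ^ (-n) * (trig (c j) t * g t) ∂arc := by
            congr 1; ext t; ring
      _ = _ := by
        -- For `n ≤ 0` and `k > 0` the index `n - k` is negative, so only the constant term of the
        -- polynomial contributes.
        rw [this, Finsupp.sum_eq_single 0]
        · simp
        · intro k hk hk0
          have : 0 ≤ k := not_lt.1 fun h => hk (hc0 j k h)
          rw [hg.2 _ (by omega), mul_zero]
        · simp
  have e2 : ∀ j, ∫ t, trig (c j) t * (t : ℂ) ^ (0 : ℤ) ∂arc = c j 0 := by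
    intro j
    rw [← coeff_trig (c j) 0, coeff]
    simp
  simp only [e1] at h1
  simp only [e2] at h2
  have h3 : coeff f 0 = ∫ t, f t * (t : ℂ) ^ (0 : ℤ) ∂arc := by simp [coeff]
  have h4 : coeff (fun t => f t * g t) n = ∫ t, f t * ((t : ℂ) ^ (-n) * g t) ∂arc := by
    rw [coeff]; congr 1; ext t; ring
  rw [h3, h4]
  exact tendsto_nhds_unique h1 (h2.mul_const _)

lemma MemHardy.mul {p q : ℝ≥0∞} [hp : Fact (1 ≤ p)] [p.HolderConjugate q] (hp' : p ≠ ∞)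
    (hP : HasRieszProjection p) {f g : Circle → ℂ} (hf : MemHardy f p) (hg : MemHardy g q) :
    MemHardy (fun t => f t * g t) 1 :=
  ⟨memLp_one_iff_integrable.2 (integrable_mul hf.1 hg.1), fun n hn => by
    rw [hf.coeff_mul hp' hP hg hn.le, hg.2 n hn, mul_zero]⟩

lemma MemConjHardy.coeff_mul {p q : ℝ≥0∞} [hp : Fact (1 ≤ p)] [p.HolderConjugate q]
    (hp' : p ≠ ∞) (hP : HasRieszProjection p) {f g : Circle → ℂ} (hf : MemConjHardy f p)
    (hg : MemConjHardy g q) {n : ℤ} (hn : 0 ≤ n) :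
    coeff (fun t => f t * g t) n = coeff f 0 * coeff g n := by
  have h := hf.conj.coeff_mul hp' hP hg.conj (n := -n) (by omega)
  simp only [← map_mul] at h
  simp only [coeff_conj, ← map_mul, neg_neg, neg_zero] at h
  exact (starRingEnd ℂ).injective h

lemma MemConjHardy.mul {p q : ℝ≥0∞} [hp : Fact (1 ≤ p)] [p.HolderConjugate q] (hp' : p ≠ ∞)
    (hP : HasRieszProjection p) {f g : Circle → ℂ} (hf : MemConjHardy f p)
    (hg : MemConjHardy g q) : MemConjHardy (fun t => f t * g t) 1 :=
  ⟨memLp_one_iff_integrable.2 (integrable_mul hf.1 hg.1), fun n hn => by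
    rw [hf.coeff_mul hp' hP hg hn.le, hg.2 n hn, mul_zero]⟩

/-- Division of a nonzero Hardy function by a power of `t` to make it nonzero at the origin. -/
lemma MemHardy.exists_shift {p : ℝ≥0∞} (hp : 1 ≤ p) {f : Circle → ℂ} (hf : MemHardy f p)
    (h : ¬ f =ᵐ[arc] 0) :
    ∃ a : ℤ, MemHardy (fun t => (t : ℂ) ^ a * f t) p ∧
      coeff (fun t => (t : ℂ) ^ a * f t) 0 ≠ 0 := by
  have hex : ∃ k : ℕ, coeff f k ≠ 0 := by
    by_contra hcon
    push Not at hcon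
    refine h (ae_eq_zero_of_coeff_eq_zero (hf.1.integrable hp) fun n => ?_)
    rcases lt_or_ge n 0 with hn | hn
    · exact hf.2 n hn
    · lift n to ℕ using hn
      exact hcon n
  classical
  refine ⟨-(Nat.find hex : ℤ), ⟨memLp_continuous_mul (continuous_monomial _) hf.1,
    fun n hn => ?_⟩, ?_⟩
  · rw [coeff_monomial_mul]
    rcases lt_or_ge (n - -(Nat.find hex : ℤ)) 0 with h0 | h0
    · exact hf.2 _ h0
    · obtain ⟨m, hm⟩ := Int.eq_ofNat_of_zero_le h0
      rw [hm]
      by_contra hcon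
      exact Nat.find_min hex (m := m) (by omega) hcon
  · rw [coeff_monomial_mul]
    simpa using Nat.find_spec hex

/-- There are no zero divisors among Hardy functions. -/
lemma MemHardy.eq_zero_or_eq_zero_of_mul {p q : ℝ≥0∞} [hp : Fact (1 ≤ p)] [p.HolderConjugate q]
    (hp' : p ≠ ∞) (hP : HasRieszProjection p) {f g : Circle → ℂ} (hf : MemHardy f p)
    (hg : MemHardy g q) (h : ∀ᵐ t ∂arc, f t * g t = 0) : f =ᵐ[arc] 0 ∨ g =ᵐ[arc] 0 := by
  have : q.HolderConjugate p := ENNReal.HolderConjugate.symm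
  have hq := ENNReal.HolderConjugate.one_le q p
  by_contra! hcon
  obtain ⟨a, ha, ha0⟩ := hf.exists_shift hp.out hcon.1
  obtain ⟨b, hb, hb0⟩ := hg.exists_shift hq hcon.2
  have h1 := ha.coeff_mul hp' hP hb le_rfl
  refine mul_ne_zero ha0 hb0 (h1 ▸ ?_)
  rw [coeff_congr (g := fun _ => 0), coeff_const]
  · simp
  · filter_upwards [h] with t ht
    linear_combination (t : ℂ) ^ a * (t : ℂ) ^ b * ht

lemma continuous_circle_coe : Continuous fun t : Circle => (t : ℂ) := continuous_induced_dom

/-- The product rule alone lands in `L^1`; a continuous multiplier keeps the product in `L^p`, so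
that it can be multiplied by a function of `H^q` once more. -/
lemma MemHardy.continuous_mul {p q : ℝ≥0∞} [hp : Fact (1 ≤ p)] [p.HolderConjugate q]
    (hp' : p ≠ ∞) (hP : HasRieszProjection p) {f φ : Circle → ℂ} (hf : MemHardy f p)
    (hφ : Continuous φ) (hφ' : MemHardy φ q) : MemHardy (fun t => φ t * f t) p :=
  ⟨memLp_continuous_mul hφ hf.1, fun n hn => by
    simpa only [mul_comm] using (hf.mul hp' hP hφ').2 n hn⟩

lemma MemConjHardy.continuous_mul {p q : ℝ≥0∞} [hp : Fact (1 ≤ p)] [p.HolderConjugate q]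
    (hp' : p ≠ ∞) (hP : HasRieszProjection p) {f φ : Circle → ℂ} (hf : MemConjHardy f p)
    (hφ : Continuous φ) (hφ' : MemConjHardy φ q) : MemConjHardy (fun t => φ t * f t) p :=
  ⟨memLp_continuous_mul hφ hf.1, fun n hn => by
    simpa only [mul_comm] using (hf.mul hp' hP hφ').2 n hn⟩

/-- Powers of continuous conjugate Hardy functions. -/
lemma MemConjHardy.pow {p : ℝ≥0∞} [hp : Fact (1 ≤ p)] (hp' : p ≠ ∞)
    (hP : HasRieszProjection p) {φ : Circle → ℂ} (hφ : Continuous φ)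
    (h : ∀ r, MemConjHardy φ r) (r : ℝ≥0∞) (n : ℕ) :
    MemConjHardy (fun t => φ t ^ n) r ∧ coeff (fun t => φ t ^ n) 0 = coeff φ 0 ^ n := by
  -- Continuous functions lie in every `L^r` and their coefficients do not depend on `r`, so the
  -- induction can run at the single exponent `p`.
  suffices h : MemConjHardy (fun t => φ t ^ n) p ∧
      coeff (fun t => φ t ^ n) 0 = coeff φ 0 ^ n from
    ⟨⟨memLp_continuous (hφ.pow n) r, h.1.2⟩, h.2⟩
  have hc := ENNReal.HolderConjugate.conjExponent hp.out
  induction n with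
  | zero =>
    simp only [pow_zero, coeff_const, if_true, and_true]
    exact ⟨memLp_const _, fun n hn => by rw [coeff_const, if_neg hn.ne']⟩
  | succ n ih =>
    have h1 := h p.conjExponent
    simp only [pow_succ]
    refine ⟨?_, ?_⟩
    · simpa only [mul_comm] using ih.1.continuous_mul hp' hP hφ h1
    · rw [ih.1.coeff_mul hp' hP h1 le_rfl, ih.2]

/-- Integer powers of invertible continuous conjugate Hardy functions. -/
lemma MemConjHardy.zpow {p : ℝ≥0∞} [hp : Fact (1 ≤ p)] (hp' : p ≠ ∞)
    (hP : HasRieszProjection p) {φ : Circle → ℂ} (hφ : Continuous φ)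
    (h : ∀ r, MemConjHardy φ r) (h0 : ∀ t, φ t ≠ 0)
    (h' : ∀ r, MemConjHardy (fun t => (φ t)⁻¹) r) (r : ℝ≥0∞) (n : ℤ) :
    MemConjHardy (fun t => φ t ^ n) r ∧ coeff (fun t => φ t ^ n) 0 = coeff φ 0 ^ n := by
  have hc := ENNReal.HolderConjugate.conjExponent hp.out
  rcases Int.eq_nat_or_neg n with ⟨m, rfl | rfl⟩
  · simpa only [zpow_natCast] using MemConjHardy.pow hp' hP hφ h r m
  · have h1 := MemConjHardy.pow hp' hP (hφ.inv₀ h0) h' r m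
    have h2 := (h p).coeff_mul hp' hP (h' p.conjExponent) le_rfl
    simp only [mul_inv_cancel₀ (h0 _), coeff_const, if_true] at h2
    simp only [zpow_neg, zpow_natCast, ← inv_pow]
    rwa [show coeff φ⁻¹ 0 = (coeff φ 0)⁻¹ from eq_inv_of_mul_eq_one_right h2.symm] at h1

/-! ### Geometric kernels and moments of measures. -/

lemma one_sub_mul_zpow_ne_zero {z : ℂ} (hz : ‖z‖ < 1) (m : ℤ) (t : Circle) :
    1 - z * (t : ℂ) ^ m ≠ 0 := by
  intro h
  have h1 := congrArg norm (sub_eq_zero.mp h)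
  rw [norm_mul, norm_zpow, Circle.norm_coe, one_zpow, mul_one, norm_one] at h1
  exact hz.ne' h1

lemma continuous_geom {z : ℂ} (hz : ‖z‖ < 1) (m : ℤ) :
    Continuous fun t : Circle => (1 - z * (t : ℂ) ^ m)⁻¹ :=
  (continuous_const.sub (continuous_const.mul (continuous_monomial m))).inv₀
    (one_sub_mul_zpow_ne_zero hz m)

/-- Termwise integration of the geometric series is justified because its `k`-th term has `L^1` norm
`|z|^k ‖f‖₁`. -/
lemma hasSum_integral_geom {z : ℂ} (hz : ‖z‖ < 1) (m : ℤ) {f : Circle → ℂ}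
    (hf : Integrable f arc) :
    HasSum (fun k : ℕ => z ^ k * coeff f (-(m * k)))
      (∫ t : Circle, (1 - z * (t : ℂ) ^ m)⁻¹ * f t ∂arc) := by
  have h := hasSum_integral_of_summable_integral_norm
    (F := fun (k : ℕ) (t : Circle) => z ^ k * ((t : ℂ) ^ (m * k) * f t)) (μ := arc)
    (fun k => (integrable_monomial_mul hf _).const_mul _) (by
      simp only [norm_mul, norm_zpow, Circle.norm_coe, one_zpow, one_mul, norm_pow,
        integral_const_mul]
      exact (summable_geometric_of_lt_one (norm_nonneg _) hz).mul_right _)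
  simp only [integral_const_mul, coeff_eq_integral_mul] at h
  suffices e : ∀ t : Circle, (1 - z * (t : ℂ) ^ m)⁻¹ * f t =
      ∑' k : ℕ, z ^ k * ((t : ℂ) ^ (m * k) * f t) by simpa only [e] using h
  intro t
  have hn : ‖z * (t : ℂ) ^ m‖ < 1 := by
    rwa [norm_mul, norm_zpow, Circle.norm_coe, one_zpow, mul_one]
  rw [← tsum_geometric_of_norm_lt_one hn, ← tsum_mul_right]
  congr 1; ext k
  rw [mul_pow, ← zpow_natCast ((t : ℂ) ^ m) k, ← zpow_mul]; ring

lemma coeff_geom {z : ℂ} (hz : ‖z‖ < 1) (m n : ℤ) :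
    coeff (fun t : Circle => (1 - z * (t : ℂ) ^ m)⁻¹) n
      = ∑' k : ℕ, z ^ k * if n = m * k then 1 else 0 := by
  have h := hasSum_integral_geom hz m
    ((memLp_continuous (continuous_monomial (-n)) 1).integrable le_rfl)
  simp only [coeff_monomial, neg_inj] at h
  rw [h.tsum_eq, coeff]
  simp only [mul_comm]

lemma coeff_geom_of_lt {z : ℂ} (hz : ‖z‖ < 1) {m n : ℤ} (h : n * m < 0) :
    coeff (fun t : Circle => (1 - z * (t : ℂ) ^ m)⁻¹) n = 0 := by
  rw [coeff_geom hz]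
  have : ∀ k : ℕ, (z ^ k * if n = m * k then 1 else 0) = 0 := fun k => by
    rw [if_neg, mul_zero]
    rintro rfl
    nlinarith [mul_nonneg (mul_self_nonneg m) (Int.natCast_nonneg k)]
  simp [this]

lemma coeff_geom_zero {z : ℂ} (hz : ‖z‖ < 1) {m : ℤ} (hm : m ≠ 0) :
    coeff (fun t : Circle => (1 - z * (t : ℂ) ^ m)⁻¹) 0 = 1 := by
  rw [coeff_geom hz, tsum_eq_single 0]
  · simp
  · intro k hk
    rw [if_neg, mul_zero]
    simp [hm, hk]

lemma memHardy_geom {z : ℂ} (hz : ‖z‖ < 1) (r : ℝ≥0∞) :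
    MemHardy (fun t : Circle => (1 - z * (t : ℂ) ^ (1 : ℤ))⁻¹) r :=
  ⟨memLp_continuous (continuous_geom hz 1) r, fun n hn => coeff_geom_of_lt hz (by omega)⟩

lemma memConjHardy_geom {z : ℂ} (hz : ‖z‖ < 1) (r : ℝ≥0∞) :
    MemConjHardy (fun t : Circle => (1 - z * (t : ℂ) ^ (-1 : ℤ))⁻¹) r :=
  ⟨memLp_continuous (continuous_geom hz _) r, fun n hn => coeff_geom_of_lt hz (by omega)⟩

/-- Finite measures on the circle are determined by their moments. -/
lemma measure_ext_of_integral_monomial {μ ν : Measure Circle} [IsFiniteMeasure μ]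
    [IsFiniteMeasure ν] (h : ∀ n : ℕ, ∫ t : Circle, (t : ℂ) ^ n ∂μ = ∫ t : Circle, (t : ℂ) ^ n ∂ν) :
    μ = ν := by
  -- On the circle `t⁻ⁿ` is the conjugate of `tⁿ` and the measures are positive, so the negative
  -- moments come for free.
  have hz : ∀ n : ℤ, ∫ t : Circle, (t : ℂ) ^ n ∂μ = ∫ t : Circle, (t : ℂ) ^ n ∂ν := by
    intro n
    rcases Int.eq_nat_or_neg n with ⟨m, rfl | rfl⟩
    · simpa using h m
    · have := congrArg conj (h m)
      rw [← integral_conj, ← integral_conj] at this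
      simpa only [map_pow, ← Circle.coe_inv_eq_conj, zpow_neg, zpow_natCast, Circle.coe_inv,
        inv_pow] using this
  have hint : ∀ (κ : Measure Circle) [IsFiniteMeasure κ] {φ : Circle → ℂ}, Continuous φ →
      Integrable φ κ := fun κ _ φ hφ => hφ.integrable_of_hasCompactSupport
        (HasCompactSupport.of_compactSpace φ)
  have htrig : ∀ c, ∫ t, trig c t ∂μ = ∫ t, trig c t ∂ν := by
    intro c
    simp only [trig, Finsupp.sum]
    rw [integral_finsetSum, integral_finsetSum]
    · simp only [integral_const_mul, hz]
    · exact fun k _ => (hint ν (continuous_monomial k)).const_mul _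
    · exact fun k _ => (hint μ (continuous_monomial k)).const_mul _
  refine ext_of_forall_integral_eq_of_IsFiniteMeasure fun f => ?_
  let φ : C(Circle, ℂ) := ⟨fun t => (f t : ℂ), Complex.continuous_ofReal.comp f.continuous⟩
  suffices ∫ t, φ t ∂μ = ∫ t, φ t ∂ν by
    simp only [φ, ContinuousMap.coe_mk, integral_complex_ofReal] at this
    exact_mod_cast this
  by_contra hne
  have hpos : 0 < ‖∫ t, φ t ∂μ - ∫ t, φ t ∂ν‖ := norm_pos_iff.2 (sub_ne_zero.2 hne)
  set d := ‖∫ t, φ t ∂μ - ∫ t, φ t ∂ν‖ with hd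
  set M := μ.real Set.univ + ν.real Set.univ with hM
  have hM0 : 0 ≤ M := by positivity
  obtain ⟨c, hc⟩ := exists_trig_near φ (ε := d / (2 * (M + 1))) (by positivity)
  have e : ∀ (κ : Measure Circle) [IsFiniteMeasure κ],
      ‖∫ t, φ t ∂κ - ∫ t, trig c t ∂κ‖ ≤ d / (2 * (M + 1)) * κ.real Set.univ := by
    intro κ _
    rw [← integral_sub (hint κ φ.continuous) (hint κ (continuous_trig c))]
    exact norm_integral_le_of_norm_le_const (Filter.Eventually.of_forall fun t => (hc t).le)
  have h1 : d ≤ d / (2 * (M + 1)) * μ.real Set.univ + d / (2 * (M + 1)) * ν.real Set.univ := by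
    calc d = ‖(∫ t, φ t ∂μ - ∫ t, trig c t ∂μ) - (∫ t, φ t ∂ν - ∫ t, trig c t ∂ν)‖ := by
            rw [htrig, hd]; congr 1; ring
      _ ≤ _ := (norm_sub_le _ _).trans (add_le_add (e μ) (e ν))
  rw [← mul_add, ← hM, div_mul_eq_mul_div, le_div_iff₀ (by positivity)] at h1
  nlinarith

/-! ### The shift as a conjugate Hardy function. -/

section Shift

variable {β : ℂ} (hβ : 1 < ‖β‖)

include hβ

lemma ne_zero_of_one_lt_norm : β ≠ 0 := by
  rintro rfl; simp at hβ; linarith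

lemma conj_ne_zero_of_one_lt_norm : conj β ≠ 0 := by
  simpa using ne_zero_of_one_lt_norm hβ

lemma norm_inv_lt_one : ‖β⁻¹‖ < 1 := by
  rw [norm_inv]; exact inv_lt_one_of_one_lt₀ hβ

lemma norm_conj_inv_lt_one : ‖(conj β)⁻¹‖ < 1 := by
  rw [norm_inv, RCLike.norm_conj]; exact inv_lt_one_of_one_lt₀ hβ

lemma coe_sub_ne_zero (t : Circle) : (t : ℂ) - β ≠ 0 := by
  rw [← norm_ne_zero_iff, norm_sub_eq, norm_ne_zero_iff]
  exact denom_ne_zero hβ t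

lemma coe_shift (t : Circle) : (shift β hβ t : ℂ) = ((t : ℂ) - β) / (conj β * t - 1) := rfl

lemma conj_mul_self_sub_one_ne_zero : conj β * β - 1 ≠ 0 := by
  rw [← Complex.normSq_eq_conj_mul_self, Complex.normSq_eq_norm_sq]
  norm_cast
  nlinarith

lemma shift_shift (t : Circle) : shift β hβ (shift β hβ t) = t := by
  apply Circle.ext
  have h1 := denom_ne_zero hβ t
  have h2 := conj_mul_self_sub_one_ne_zero hβ
  rw [coe_shift, coe_shift]
  have h3 : conj β * (((t : ℂ) - β) / (conj β * t - 1)) - 1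
      = -(conj β * β - 1) / (conj β * t - 1) := by field_simp; ring
  have h4 : ((t : ℂ) - β) / (conj β * t - 1) - β
      = -(conj β * β - 1) * t / (conj β * t - 1) := by rw [div_sub' h1]; congr 1; ring
  rw [h3, h4]
  field_simp

lemma continuous_shift : Continuous (shift β hβ) := by
  refine Continuous.subtype_mk ?_ _
  exact (continuous_circle_coe.sub continuous_const).div
    ((continuous_const.mul continuous_circle_coe).sub continuous_const) (denom_ne_zero hβ)

/-- In powers of `t⁻¹` the shift is anti-analytic with constant term `1/β̄`, which is its value at
`∞`. -/
lemma coe_shift_eq (t : Circle) : (shift β hβ t : ℂ) =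
    (conj β)⁻¹ * ((1 - (conj β)⁻¹ * (t : ℂ) ^ (-1 : ℤ))⁻¹
      - β * ((t : ℂ) ^ (-1 : ℤ) * (1 - (conj β)⁻¹ * (t : ℂ) ^ (-1 : ℤ))⁻¹)) := by
  have h1 := denom_ne_zero hβ t
  have h2 := conj_ne_zero_of_one_lt_norm hβ
  have h3 : (1 - (conj β)⁻¹ * (t : ℂ) ^ (-1 : ℤ)) = (conj β * t - 1) / (conj β * t) := by
    rw [zpow_neg_one]; field_simp [t.coe_ne_zero]
  rw [coe_shift, h3, zpow_neg_one]
  field_simp [t.coe_ne_zero]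

lemma memConjHardy_shift (r : ℝ≥0∞) :
    MemConjHardy (fun t => (shift β hβ t : ℂ)) r ∧
      coeff (fun t => (shift β hβ t : ℂ)) 0 = (conj β)⁻¹ := by
  have hz := norm_conj_inv_lt_one hβ
  set G : Circle → ℂ := fun t => (1 - (conj β)⁻¹ * (t : ℂ) ^ (-1 : ℤ))⁻¹ with hG
  have hGc : Continuous G := continuous_geom hz _
  have hGi : Integrable G arc := (memLp_continuous hGc 1).integrable le_rfl
  have hcoeff : ∀ n, coeff (fun t => (shift β hβ t : ℂ)) n
      = (conj β)⁻¹ * (coeff G n - β * coeff G (n + 1)) := by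
    intro n
    have : (fun t => (shift β hβ t : ℂ)) =
        (conj β)⁻¹ • (G - β • fun t : Circle => (t : ℂ) ^ (-1 : ℤ) * G t) := by
      ext t; rw [coe_shift_eq hβ t]; rfl
    rw [this, coeff_smul, coeff_sub hGi ((integrable_monomial_mul hGi _).smul β), coeff_smul,
      coeff_monomial_mul]
    norm_num
  refine ⟨⟨memLp_continuous (continuous_circle_coe.comp (continuous_shift hβ)) r,
    fun n hn => ?_⟩, ?_⟩
  · rw [hcoeff, coeff_geom_of_lt hz (by omega), coeff_geom_of_lt hz (by omega)]; simp
  · rw [hcoeff, coeff_geom_zero hz (by omega), coeff_geom_of_lt hz (by omega)]; simp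

lemma continuous_shift_pow (n : ℕ) : Continuous fun t => (shift β hβ t : ℂ) ^ n :=
  (continuous_circle_coe.comp (continuous_shift hβ)).pow n

lemma memConjHardy_shift_pow {p : ℝ≥0∞} [hp : Fact (1 ≤ p)] (hp' : p ≠ ∞)
    (hP : HasRieszProjection p) (r : ℝ≥0∞) (n : ℕ) :
    MemConjHardy (fun t => (shift β hβ t : ℂ) ^ n) r ∧
      coeff (fun t => (shift β hβ t : ℂ) ^ n) 0 = (conj β)⁻¹ ^ n := by
  rw [← (memConjHardy_shift hβ p).2]
  exact MemConjHardy.pow hp' hP (continuous_circle_coe.comp (continuous_shift hβ))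
    (fun r => (memConjHardy_shift hβ r).1) r n

end Shift

/-! ### The Poisson kernel and composition with the shift. -/

/-- The Poisson kernel at the point `1 / β̄`. -/
def poisson (β : ℂ) (t : Circle) : ℝ := (‖β‖ ^ 2 - 1) / ‖conj β * (t : ℂ) - 1‖ ^ 2

section Shift

variable {β : ℂ} (hβ : 1 < ‖β‖)

include hβ

lemma poisson_nonneg (t : Circle) : 0 ≤ poisson β t :=
  div_nonneg (by nlinarith) (by positivity)

lemma continuous_poisson : Continuous (poisson β) :=
  continuous_const.div (((continuous_const.mul continuous_circle_coe).sub
    continuous_const).norm.pow 2) fun t => pow_ne_zero 2 (norm_ne_zero_iff.2 (denom_ne_zero hβ t))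

/-- Replacing `conj t` by `t⁻¹` makes the kernel a rational function, which can be multiplied with
powers of `α`. -/
lemma coe_poisson (t : Circle) : (poisson β t : ℂ) =
    (conj β * β - 1) * t / ((conj β * t - 1) * (β - t)) := by
  have h : ((‖conj β * (t : ℂ) - 1‖ ^ 2 : ℝ) : ℂ) = (conj β * t - 1) * (β - t) / t := by
    rw [Complex.sq_norm, Complex.normSq_eq_conj_mul_self]
    simp only [map_sub, map_mul, Complex.conj_conj, map_one, ← Circle.coe_inv_eq_conj,
      Circle.coe_inv]
    field_simp [t.coe_ne_zero]
  rw [poisson, Complex.ofReal_div, h]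
  have h2 : ((‖β‖ ^ 2 - 1 : ℝ) : ℂ) = conj β * β - 1 := by
    rw [← Complex.normSq_eq_conj_mul_self, Complex.normSq_eq_norm_sq]; norm_cast
  rw [h2]
  have h1 := denom_ne_zero hβ t
  have h3 : β - (t : ℂ) ≠ 0 := by
    rw [← neg_sub]; exact neg_ne_zero.2 (coe_sub_ne_zero hβ t)
  field_simp [t.coe_ne_zero]

/-- Splitting into an analytic and an anti-analytic geometric kernel. Against a function of `H^1`
the first sees only the mean, the second sums the power series at `1/β̄`, and `-1` removes the mean
counted twice. -/
lemma coe_poisson_eq (t : Circle) : (poisson β t : ℂ) =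
    (1 - β⁻¹ * (t : ℂ) ^ (1 : ℤ))⁻¹ + (1 - (conj β)⁻¹ * (t : ℂ) ^ (-1 : ℤ))⁻¹ - 1 := by
  rw [coe_poisson hβ]
  have h1 := denom_ne_zero hβ t
  have h3 : β - (t : ℂ) ≠ 0 := by
    rw [← neg_sub]; exact neg_ne_zero.2 (coe_sub_ne_zero hβ t)
  have h2 := conj_ne_zero_of_one_lt_norm hβ
  have h4 := ne_zero_of_one_lt_norm hβ
  have h5 : (1 - (conj β)⁻¹ * (t : ℂ) ^ (-1 : ℤ)) = (conj β * t - 1) / (conj β * t) := by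
    rw [zpow_neg_one]; field_simp [t.coe_ne_zero]
  have h6 : (1 - β⁻¹ * (t : ℂ) ^ (1 : ℤ)) = (β - t) / β := by
    rw [zpow_one]; field_simp
  rw [h5, h6]
  field_simp [t.coe_ne_zero]
  ring

/-- The Poisson integral formula for `H^1`. -/
lemma integral_poisson_mul {f : Circle → ℂ} (hf : MemHardy f 1) :
    ∫ t, (poisson β t : ℂ) * f t ∂arc = valueInDisk f (conj β)⁻¹ := by
  have hi := memLp_one_iff_integrable.1 hf.1
  have hz := norm_inv_lt_one hβ
  have hz' := norm_conj_inv_lt_one hβ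
  simp only [coe_poisson_eq hβ, sub_mul, add_mul, one_mul]
  have i1 := integrable_continuous_mul (continuous_geom hz 1) hi
  have i2 := integrable_continuous_mul (continuous_geom hz' (-1)) hi
  refine (integral_sub (i1.add i2) hi).trans ?_
  rw [integral_add' i1 i2,
    ← (hasSum_integral_geom hz 1 hi).tsum_eq, ← (hasSum_integral_geom hz' (-1) hi).tsum_eq,
    tsum_eq_single 0]
  · have : ∫ t, f t ∂arc = coeff f 0 := by simp [coeff]
    rw [this]
    simp [valueInDisk, mul_comm]
  · intro k hk
    rw [hf.2 _ (by omega), mul_zero]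

lemma integral_poisson_mul_monomial (n : ℕ) :
    ∫ t : Circle, (poisson β t : ℂ) * (t : ℂ) ^ n ∂arc = (conj β)⁻¹ ^ n := by
  have h : MemHardy (fun t : Circle => (t : ℂ) ^ (n : ℤ)) 1 :=
    ⟨memLp_continuous (continuous_monomial n) 1, fun m hm => by
      rw [coeff_monomial, if_neg (by omega)]⟩
  have := integral_poisson_mul hβ h
  simp only [zpow_natCast] at this
  rw [this, valueInDisk, tsum_eq_single n]
  · have := coeff_monomial n n
    simp only [zpow_natCast] at this
    simp [this]
  · intro k hk
    have := coeff_monomial n k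
    simp only [zpow_natCast] at this
    rw [this, if_neg (by omega), zero_mul]

variable {p : ℝ≥0∞} [hp : Fact (1 ≤ p)] (hp' : p ≠ ∞) (hP : HasRieszProjection p)

include hp' hP

/-- The shift maps the normalized arc length to harmonic measure. -/
lemma map_shift_arc :
    arc.map (shift β hβ) = arc.withDensity fun t => (poisson β t).toNNReal := by
  have hm : Measurable fun t => (poisson β t).toNNReal :=
    (continuous_real_toNNReal.comp (continuous_poisson hβ)).measurable
  have hfin : IsFiniteMeasure (arc.withDensity fun t => ((poisson β t).toNNReal : ℝ≥0∞)) := by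
    refine isFiniteMeasure_withDensity ?_
    have : Integrable (poisson β) arc :=
      (continuous_poisson hβ).integrable_of_hasCompactSupport
        (HasCompactSupport.of_compactSpace _)
    exact this.lintegral_lt_top.ne
  have : IsFiniteMeasure (arc.map (shift β hβ)) :=
    Measure.isFiniteMeasure_map _ _
  refine measure_ext_of_integral_monomial fun n => ?_
  rw [integral_map (continuous_shift hβ).aemeasurable
    (f := fun t : Circle => (t : ℂ) ^ n) (continuous_circle_coe.pow n).aestronglyMeasurable,
    integral_withDensity_eq_integral_smul hm]
  -- The moments of the image measure are the means of `αⁿ`, that is `α(∞)ⁿ`, because `αⁿ` is a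
  -- conjugate Hardy function.
  have h1 := (memConjHardy_shift_pow hβ hp' hP 1 n).2
  simp only [coeff, neg_zero, zpow_zero, one_mul] at h1
  rw [h1, ← integral_poisson_mul_monomial hβ]
  congr 1; ext t
  rw [NNReal.smul_def, Complex.real_smul, Real.coe_toNNReal _ (poisson_nonneg hβ t)]

/-- This permits substituting `α(t)` for `t` in statements that hold almost everywhere. -/
lemma quasiMeasurePreserving_shift : Measure.QuasiMeasurePreserving (shift β hβ) arc arc :=
  ⟨(continuous_shift hβ).measurable, by
    rw [map_shift_arc hβ hp' hP]; exact withDensity_absolutelyContinuous _ _⟩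

lemma integral_comp_shift {f : Circle → ℂ} (hf : AEStronglyMeasurable f arc) :
    ∫ t, f (shift β hβ t) ∂arc = ∫ t, (poisson β t : ℂ) * f t ∂arc := by
  have hm : Measurable fun t => (poisson β t).toNNReal :=
    (continuous_real_toNNReal.comp (continuous_poisson hβ)).measurable
  have hq := quasiMeasurePreserving_shift hβ hp' hP
  rw [← integral_map (f := f) (continuous_shift hβ).aemeasurable (hf.mono_ac hq.2),
    map_shift_arc hβ hp' hP, integral_withDensity_eq_integral_smul hm]
  congr 1; ext t
  rw [NNReal.smul_def, Complex.real_smul, Real.coe_toNNReal _ (poisson_nonneg hβ t)]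

/-- The Poisson kernel is continuous, hence bounded, so the image measure is at most a multiple of
arc length. -/
lemma memLp_comp_shift {f : Circle → ℂ} {r : ℝ≥0∞} (hf : MemLp f r arc) :
    MemLp (fun t => f (shift β hβ t)) r arc := by
  have hq := quasiMeasurePreserving_shift hβ hp' hP
  obtain ⟨C, hC⟩ := isCompact_univ.exists_bound_of_continuousOn
    (continuous_poisson hβ).continuousOn
  refine (memLp_map_measure_iff (hf.1.mono_ac hq.2) (continuous_shift hβ).aemeasurable).1 ?_
  refine hf.of_measure_le_smul (c := (C.toNNReal : ℝ≥0∞)) ENNReal.coe_ne_top ?_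
  rw [map_shift_arc hβ hp' hP, ← withDensity_const]
  refine withDensity_mono (Filter.Eventually.of_forall fun t => ?_)
  exact ENNReal.coe_le_coe.2 (Real.toNNReal_le_toNNReal
    ((le_abs_self _).trans (hC t trivial)))

/-- Composition with the shift maps Hardy functions to conjugate Hardy functions. -/
lemma MemHardy.comp_shift {f : Circle → ℂ} (hf : MemHardy f p) :
    MemConjHardy (fun t => f (shift β hβ t)) p ∧
      coeff (fun t => f (shift β hβ t)) 0 = valueInDisk f (conj β)⁻¹ := by
  have hc := ENNReal.HolderConjugate.conjExponent hp.out
  have hz := norm_inv_lt_one hβ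
  refine ⟨⟨memLp_comp_shift hβ hp' hP hf.1, fun n hn => ?_⟩, ?_⟩
  · obtain ⟨m, rfl⟩ : ∃ m : ℕ, n = m + 1 := ⟨(n - 1).toNat, by omega⟩
    -- As `α` is an involution, `t = α(α(t))`, so the integrand is a function of `α(t)` and the
    -- change of variables applies.
    have e1 : coeff (fun t => f (shift β hβ t)) (m + 1) =
        ∫ t, (fun s : Circle => (shift β hβ s : ℂ) ^ (-(m + 1 : ℤ)) * f s) (shift β hβ t) ∂arc := by
      simp only [coeff, shift_shift]
    have hcs : Continuous fun s : Circle => (shift β hβ s : ℂ) ^ (-(m + 1 : ℤ)) :=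
      (continuous_monomial _).comp (continuous_shift hβ)
    refine e1.trans ((integral_comp_shift hβ hp' hP (hcs.aestronglyMeasurable.mul hf.1.1)).trans ?_)
    simp only [Pi.mul_apply]
    -- The kernel times `α⁻¹` equals `-(|β|² - 1) β⁻² t (1 - t/β)⁻²`, and `α⁻ᵐ = conj (αᵐ)` is
    -- analytic. The integral is thus the mean of `t` times a function of `H^p`, that is a
    -- coefficient of order `-1`.
    have hA := (hf.continuous_mul hp' hP (continuous_geom hz 1) (memHardy_geom hz p.conjExponent)).continuous_mul
      hp' hP (continuous_geom hz 1) (memHardy_geom hz p.conjExponent)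
    have hB := hA.continuous_mul hp' hP
      (φ := fun t => conj ((shift β hβ t : ℂ) ^ m))
      (Complex.continuous_conj.comp (continuous_shift_pow hβ m))
      (memConjHardy_shift_pow hβ hp' hP p.conjExponent m).1.conj
    have h0 := hB.2 (-1) (by norm_num)
    have h1 := coeff_smul ((conj β * β - 1) * (β⁻¹ * β⁻¹ * (-1))) (fun t =>
      conj ((shift β hβ t : ℂ) ^ m) * ((1 - β⁻¹ * (t : ℂ) ^ (1 : ℤ))⁻¹ *
        ((1 - β⁻¹ * (t : ℂ) ^ (1 : ℤ))⁻¹ * f t))) (-1)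
    rw [h0, mul_zero, coeff] at h1
    rw [← h1]
    congr 1; ext t
    have h1 := denom_ne_zero hβ t
    have h2 := coe_sub_ne_zero hβ t
    have h3 : β - (t : ℂ) ≠ 0 := by rw [← neg_sub]; exact neg_ne_zero.2 h2
    have h4 := ne_zero_of_one_lt_norm hβ
    have h6 : (1 - β⁻¹ * (t : ℂ) ^ (1 : ℤ)) = -((t - β) / β) := by
      rw [zpow_one]; field_simp; ring
    have h7 : conj ((shift β hβ t : ℂ) ^ m) = ((shift β hβ t : ℂ) ^ m)⁻¹ := by
      rw [map_pow, ← Circle.coe_inv_eq_conj, Circle.coe_inv, inv_pow]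
    have h8 : (shift β hβ t : ℂ) ^ (-(m + 1 : ℤ)) =
        ((shift β hβ t : ℂ) ^ m)⁻¹ * ((conj β * t - 1) / (t - β)) := by
      rw [zpow_neg, zpow_add₀ (Circle.coe_ne_zero _), zpow_natCast, zpow_one, mul_inv,
        coe_shift hβ t, inv_div]
    rw [Pi.smul_apply, smul_eq_mul, h7, h8, h6, coe_poisson hβ]
    norm_num
    generalize ((shift β hβ t : ℂ) ^ m)⁻¹ = s
    rw [← neg_sub (t : ℂ) β]
    field_simp
  · have := integral_comp_shift hβ hp' hP hf.1.1
    rw [integral_poisson_mul hβ ⟨hf.1.mono_exponent hp.out, hf.2⟩] at this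
    simpa [coeff] using this

lemma MemConjHardy.comp_shift {f : Circle → ℂ} (hf : MemConjHardy f p) :
    MemHardy (fun t => f (shift β hβ t)) p := by
  simpa using (hf.conj.comp_shift hβ hp' hP).1.conj

end Shift

/-! ### The constants `λ` and `χ`, and the signature formula. -/

lemma memConjHardy_one_sub (z : ℂ) (r : ℝ≥0∞) :
    MemConjHardy (fun t : Circle => 1 - z * (t : ℂ) ^ (-1 : ℤ)) r := by
  have hc : Continuous fun t : Circle => z * (t : ℂ) ^ (-1 : ℤ) :=
    continuous_const.mul (continuous_monomial _)
  refine ⟨memLp_continuous (continuous_const.sub hc) r, fun n hn => ?_⟩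
  have h := coeff_sub (f := fun _ => 1) (g := z • fun t : Circle => (t : ℂ) ^ (-1 : ℤ))
    (integrable_const _) ((memLp_continuous hc 1).integrable le_rfl) n
  rw [coeff_const, if_neg hn.ne', coeff_smul, coeff_monomial, if_neg (by omega), mul_zero,
    sub_zero] at h
  exact h

section Shift

variable {β : ℂ} (hβ : 1 < ‖β‖)

include hβ

lemma lam_mul_self : lam β * lam β = 1 - conj β * β := by
  have h : (0 : ℝ) ≤ ‖β‖ ^ 2 - 1 := by nlinarith
  rw [← Complex.normSq_eq_conj_mul_self, Complex.normSq_eq_norm_sq, lam]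
  calc _ = Complex.I * Complex.I *
        ((Real.sqrt (‖β‖ ^ 2 - 1) * Real.sqrt (‖β‖ ^ 2 - 1) : ℝ) : ℂ) := by push_cast; ring
    _ = _ := by rw [Real.mul_self_sqrt h, Complex.I_mul_I]; push_cast; ring

lemma lam_ne_zero : lam β ≠ 0 := by
  intro h
  have h1 := lam_mul_self hβ
  rw [h, mul_zero] at h1
  exact conj_mul_self_sub_one_ne_zero hβ (by linear_combination h1)

lemma chi_eq (t : Circle) : chi β t = (conj β * t - 1) / lam β := by
  have := lam_ne_zero hβ
  have := denom_ne_zero hβ t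
  rw [chi, alphaMinus]
  field_simp [t.coe_ne_zero]

lemma chi_mul_chi_shift (t : Circle) : chi β t * chi β (shift β hβ t) = 1 := by
  have h0 := lam_ne_zero hβ
  have h1 := denom_ne_zero hβ t
  have h2 := conj_mul_self_sub_one_ne_zero hβ
  rw [chi_eq hβ, chi_eq hβ, coe_shift]
  have h3 : conj β * (((t : ℂ) - β) / (conj β * t - 1)) - 1
      = lam β * lam β / (conj β * t - 1) := by
    rw [lam_mul_self hβ, ← mul_div_assoc, div_sub_one h1]; congr 1; ring
  rw [h3]
  field_simp

lemma one_sub_conj_inv_mul (t : Circle) :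
    1 - (conj β)⁻¹ * (t : ℂ) ^ (-1 : ℤ) = (conj β * t - 1) / (conj β * t) := by
  have h2 := conj_ne_zero_of_one_lt_norm hβ
  rw [zpow_neg_one]; field_simp [t.coe_ne_zero]

lemma conj_one_sub_conj_inv_mul (t : Circle) :
    conj (1 - (conj β)⁻¹ * (t : ℂ) ^ (-1 : ℤ)) = (β - t) / β := by
  have h2 := ne_zero_of_one_lt_norm hβ
  simp only [map_sub, map_one, map_mul, map_inv₀, Complex.conj_conj, zpow_neg_one,
    ← Circle.coe_inv_eq_conj, Circle.coe_inv, inv_inv]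
  field_simp

/-- Every weak Wiener–Hopf factorization of a matching function `g`, `g g_α = 1`, is determined by
its plus factor and the `α`-signature. -/
theorem IsWeakWienerHopf.signature {p q : ℝ≥0∞} [hp : Fact (1 ≤ p)] [p.HolderConjugate q]
    (hp' : p ≠ ∞) (hP : HasRieszProjection p) {g gm gp : Circle → ℂ}
    (hmatch : ∀ᵐ t ∂arc, g t * g (shift β hβ t) = 1) {n : ℤ}
    (h : IsWeakWienerHopf p q g gm (-n) gp) :
    (signature β n gp = 1 ∨ signature β n gp = -1) ∧
      ∀ᵐ t ∂arc, g t =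
        signature β n gp * gp t * chi β t ^ (-n) * (gp (shift β hβ t))⁻¹ := by
  have hz := norm_conj_inv_lt_one hβ
  have hqm := quasiMeasurePreserving_shift hβ hp' hP
  have hb := ne_zero_of_one_lt_norm hβ
  have hb' := conj_ne_zero_of_one_lt_norm hβ
  have hlam := lam_ne_zero hβ
  -- `G = β̄ t / (β̄ t - 1)` is invertible and anti-analytic with `G(∞) = 1`, so all its integer
  -- powers are anti-analytic too; it absorbs the factor `tⁿ αⁿ`, which is of neither type.
  set G : Circle → ℂ := fun t => (1 - (conj β)⁻¹ * (t : ℂ) ^ (-1 : ℤ))⁻¹ with hG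
  have hGc : Continuous G := continuous_geom hz _
  have hG0 : ∀ t, G t ≠ 0 := fun t => inv_ne_zero (one_sub_mul_zpow_ne_zero hz _ t)
  have hGn := fun r => MemConjHardy.zpow hp' hP hGc (memConjHardy_geom hz) hG0
    (fun r => by simpa only [hG, inv_inv] using memConjHardy_one_sub (conj β)⁻¹ r) r n
  rw [show coeff G 0 = 1 from coeff_geom_zero hz (by norm_num), one_zpow] at hGn
  have hGnc : Continuous fun t => G t ^ n := hGc.zpow₀ n fun t => Or.inl (hG0 t)
  set L : Circle → ℂ := fun t => conj (G t ^ n) * gm (shift β hβ t) * gp t with hL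
  set R : Circle → ℂ := fun t => G t ^ n * gp⁻¹ (shift β hβ t) * gm⁻¹ t with hR
  set d : ℂ := (-β / conj β) ^ n with hd
  have hd0 : d ≠ 0 := zpow_ne_zero _ (div_ne_zero (neg_ne_zero.2 hb) hb')
  have hLH : MemHardy L 1 :=
    ((h.minus.comp_shift hβ hp' hP).continuous_mul hp' hP
      (Complex.continuous_conj.comp hGnc) (hGn q).1.conj).mul hp' hP h.plus
  have hpi := h.plus_inv.comp_shift hβ hp' hP
  have hRH : MemConjHardy R 1 :=
    (hpi.1.continuous_mul hp' hP hGnc (hGn q).1).mul hp' hP h.minus_inv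
  have hgm : coeff gm⁻¹ 0 = 1 := by
    have h1 := h.minus.coeff_mul hp' hP h.minus_inv le_rfl
    rw [show coeff gm 0 = 1 from h.normalized, one_mul] at h1
    rw [← h1, coeff_congr (g := fun _ => 1), coeff_const, if_pos rfl]
    filter_upwards [h.ne_zero_minus] with t ht
    simp [ht]
  -- The mean of a product of conjugate Hardy functions is the product of the means; `Gⁿ` and `g₋⁻¹`
  -- contribute `1`.
  have hR0 : coeff R 0 = valueInDisk gp⁻¹ (conj β)⁻¹ := by
    rw [(hpi.1.continuous_mul hp' hP hGnc (hGn q).1).coeff_mul hp' hP h.minus_inv le_rfl, hgm,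
      mul_one, ← hpi.2]
    have := hpi.1.coeff_mul hp' hP (hGn q).1 le_rfl
    rw [(hGn q).2, mul_one] at this
    simpa only [mul_comm] using this
  set V := valueInDisk gp⁻¹ (conj β)⁻¹ with hV
  -- The relation `g g_α = 1` together with `conj G · t α = -(β/β̄) G`.
  have hLR : L =ᵐ[arc] fun t => d * R t := by
    filter_upwards [hmatch, h.eq, hqm.ae h.eq, h.ne_zero_plus, hqm.ae h.ne_zero_plus,
      h.ne_zero_minus, hqm.ae h.ne_zero_minus] with t ht he hea h1 h2 h3 h4
    have e1 : conj (G t ^ n) * (t : ℂ) ^ n * (shift β hβ t : ℂ) ^ n = d * G t ^ n := by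
      rw [map_zpow₀, hd, ← mul_zpow, ← mul_zpow, ← mul_zpow]
      congr 1
      have h5 := denom_ne_zero hβ t
      have h6 := coe_sub_ne_zero hβ t
      simp only [hG, map_inv₀]
      rw [conj_one_sub_conj_inv_mul hβ, one_sub_conj_inv_mul hβ, coe_shift, ← neg_sub (t : ℂ) β]
      field_simp [t.coe_ne_zero]
    rw [he, hea, zpow_neg, zpow_neg] at ht
    simp only [hL, hR, Pi.inv_apply]
    generalize conj (G t ^ n) = a at e1 ⊢
    generalize G t ^ n = b at e1 ⊢
    have h8 : (t : ℂ) ^ n ≠ 0 := zpow_ne_zero _ t.coe_ne_zero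
    have h9 : (shift β hβ t : ℂ) ^ n ≠ 0 := zpow_ne_zero _ (Circle.coe_ne_zero _)
    field_simp at ht ⊢
    linear_combination a * ht + e1
  -- Liouville: `R` is anti-analytic and, being proportional to `L`, also analytic.
  have hRc : R =ᵐ[arc] fun _ => V := by
    rw [← hR0]
    refine ae_eq_const (memLp_one_iff_integrable.1 hRH.1) (fun m hm => ?_) hRH.2
    have h1 := hLH.2 m hm
    rw [coeff_congr hLR, show (fun t => d * R t) = d • R from rfl, coeff_smul] at h1
    exact (mul_eq_zero.1 h1).resolve_left hd0
  have hV0 : V ≠ 0 := by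
    intro h0
    have hex := (hRc.and (h.ne_zero_minus.and (hqm.ae h.ne_zero_plus))).exists
    obtain ⟨t, h1, h2, h3⟩ := hex
    rw [h0] at h1
    exact mul_ne_zero (mul_ne_zero (zpow_ne_zero n (hG0 t)) (inv_ne_zero h3)) (inv_ne_zero h2) h1
  have hsig : GenTH.signature β n gp = (lam β / conj β) ^ n * V := by
    rw [GenTH.signature, one_div]
  have hl0 : (lam β / conj β) ^ n ≠ 0 := zpow_ne_zero _ (div_ne_zero hlam hb')
  set ξ := GenTH.signature β n gp with hξ
  have hξ0 : ξ ≠ 0 := by rw [hsig]; exact mul_ne_zero hl0 hV0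
  have hg : ∀ᵐ t ∂arc, g t = ξ⁻¹ * gp t * chi β t ^ (-n) * (gp (shift β hβ t))⁻¹ := by
    filter_upwards [hRc, h.eq, h.ne_zero_minus, hqm.ae h.ne_zero_plus] with t h1 h2 h3 h4
    have h5 : chi β t ^ (-n) = (lam β / conj β) ^ n * (t : ℂ) ^ (-n) * G t ^ n := by
      rw [zpow_neg, zpow_neg, ← inv_zpow, ← inv_zpow, ← mul_zpow, ← mul_zpow]
      congr 1
      have h5 := denom_ne_zero hβ t
      simp only [hG]
      rw [chi_eq hβ, one_sub_conj_inv_mul hβ]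
      field_simp [t.coe_ne_zero]
    have h6 : gm t = V⁻¹ * G t ^ n * (gp (shift β hβ t))⁻¹ := by
      simp only [hR, Pi.inv_apply] at h1
      rw [← h1]
      have := zpow_ne_zero n (hG0 t)
      field_simp
    rw [h2, h5, h6, hsig]
    field_simp
  -- At one generic point, multiplying the formula at `t` and at `α(t)` cancels the factors `g₊`
  -- and, by `chi_mul_chi_shift`, the powers of `χ`.
  have hsq : ξ * ξ = 1 := by
    obtain ⟨t, h1, h2, h3, h4, h5⟩ :=
      (hmatch.and (hg.and ((hqm.ae hg).and (h.ne_zero_plus.and (hqm.ae h.ne_zero_plus))))).exists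
    rw [h2, h3, shift_shift] at h1
    have h6 : chi β t ^ (-n) * chi β (shift β hβ t) ^ (-n) = 1 := by
      rw [← mul_zpow, chi_mul_chi_shift, one_zpow]
    field_simp at h1
    linear_combination h6 - h1
  refine ⟨mul_self_eq_one_iff.1 hsq, ?_⟩
  have : ξ⁻¹ = ξ := inv_eq_of_mul_eq_one_left hsq
  rwa [this] at hg

end Shift

/-! ### Duality of `L^p` and `L^q` on a finite measure space. -/

section Duality

open Filter Topology

variable {X : Type*} [MeasurableSpace X] {μ : Measure X} [IsFiniteMeasure μ]

lemma tendsto_eLpNorm_sub_of_bounded {p : ℝ≥0∞} (hp0 : p ≠ 0) (hp' : p ≠ ∞) {f : X → ℂ}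
    {F : ℕ → X → ℂ} {C : ℝ} (hf : AEStronglyMeasurable f μ)
    (hF : ∀ n, AEStronglyMeasurable (F n) μ) (hfC : ∀ x, ‖f x‖ ≤ C) (hFC : ∀ n x, ‖F n x‖ ≤ C)
    (h : ∀ᵐ x ∂μ, Tendsto (fun n => F n x) atTop (𝓝 (f x))) :
    Tendsto (fun n => eLpNorm (F n - f) p μ) atTop (𝓝 0) := by
  have hpos : 0 < p.toReal := ENNReal.toReal_pos hp0 hp'
  simp only [eLpNorm_eq_lintegral_rpow_enorm_toReal hp0 hp']
  have key : Tendsto (fun n => ∫⁻ x, ‖(F n - f) x‖ₑ ^ p.toReal ∂μ) atTop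
      (𝓝 (∫⁻ _, 0 ∂μ)) := by
    refine tendsto_lintegral_of_dominated_convergence'
      (fun _ => (ENNReal.ofReal (C + C)) ^ p.toReal)
      (fun n => ((hF n).sub hf).enorm.pow_const _) (fun n => Eventually.of_forall fun x => ?_)
      ?_ ?_
    · refine ENNReal.rpow_le_rpow ?_ hpos.le
      rw [← ofReal_norm]
      exact ENNReal.ofReal_le_ofReal
        ((norm_sub_le _ _).trans (add_le_add (hFC n x) (hfC x)))
    · rw [lintegral_const]
      exact ENNReal.mul_ne_top (ENNReal.rpow_ne_top_of_nonneg hpos.le ENNReal.ofReal_ne_top)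
        (measure_ne_top _ _)
    · filter_upwards [h] with x hx
      have h1 : Tendsto (fun n => ‖(F n - f) x‖ₑ) atTop (𝓝 0) := by
        have := (tendsto_iff_edist_tendsto_0.1 hx)
        simpa only [edist_eq_enorm_sub, Pi.sub_apply] using this
      simpa [hpos, Function.comp_def] using
        (ENNReal.continuous_rpow_const (y := p.toReal)).tendsto _ |>.comp h1
  rw [lintegral_zero] at key
  have := (ENNReal.continuous_rpow_const (y := 1 / p.toReal)).tendsto _ |>.comp key
  simpa [hpos, Function.comp_def] using this

lemma indicatorConstLp_biUnion_finset {p : ℝ≥0∞} (E : ℕ → Set X) (hE : ∀ i, MeasurableSet (E i))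
    (hd : Pairwise (Function.onFun Disjoint E)) (s : Finset ℕ) :
    indicatorConstLp p (s.measurableSet_biUnion fun i _ => hE i) (measure_ne_top μ _) (1 : ℂ) =
      ∑ i ∈ s, indicatorConstLp p (hE i) (measure_ne_top μ _) (1 : ℂ) := by
  classical
  induction s using Finset.induction_on with
  | empty => simp
  | insert a s ha ih =>
    rw [Finset.sum_insert ha, ← ih, ← indicatorConstLp_disjoint_union]
    · congr 1
      simp
    · rw [Set.disjoint_iUnion₂_right]
      exact fun i hi => hd fun h => ha (h ▸ hi)

variable {p : ℝ≥0∞} [hp : Fact (1 ≤ p)]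

/-- The complex measure `E ↦ Λ 1_E` of a functional `Λ` on `L^p`. -/
def functionalMeasure (hp' : p ≠ ∞) (Λ : Lp ℂ p μ →L[ℂ] ℂ) : ComplexMeasure X where
  measureOf' E := open Classical in
    if h : MeasurableSet E then Λ (indicatorConstLp p h (measure_ne_top μ _) 1) else 0
  empty' := by simp
  not_measurable' E hE := dif_neg hE
  m_iUnion' E hE hd := by
    simp only [hE, MeasurableSet.iUnion hE, dif_pos]
    -- Countable additivity: the missing sets form a tail of measure tending to zero, so the
    -- indicators converge in `L^p` because `p` is finite.
    have h1 : Tendsto (fun s : Finset ℕ => indicatorConstLp p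
        (s.measurableSet_biUnion fun i _ => hE i) (measure_ne_top μ _) (1 : ℂ)) atTop
        (𝓝 (indicatorConstLp p (MeasurableSet.iUnion hE) (measure_ne_top μ _) 1)) := by
      refine tendsto_indicatorConstLp_set hp' ?_
      have hsum : ∑' i, μ (E i) ≠ ∞ := by
        rw [← measure_iUnion hd hE]; exact measure_ne_top _ _
      refine tendsto_of_tendsto_of_tendsto_of_le_of_le tendsto_const_nhds
        (ENNReal.tendsto_tsum_compl_atTop_zero hsum) (fun _ => zero_le) fun s => ?_
      refine (measure_mono ?_).trans (measure_iUnion_le fun i : {i // i ∉ s} => E i)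
      rintro x (⟨h1, h2⟩ | ⟨h1, h2⟩)
      · obtain ⟨i, -, hi⟩ := Set.mem_iUnion₂.1 h1
        exact absurd (Set.mem_iUnion.2 ⟨i, hi⟩) h2
      · obtain ⟨i, hi⟩ := Set.mem_iUnion.1 h1
        refine Set.mem_iUnion.2 ⟨⟨i, fun his => h2 (Set.mem_iUnion₂.2 ⟨i, his, hi⟩)⟩, hi⟩
    have h2 := (Λ.continuous.tendsto _).comp h1
    simp only [HasSum, SummationFilter.unconditional_filter]
    refine h2.congr fun s => ?_
    simp only [Function.comp_apply, indicatorConstLp_biUnion_finset E hE hd, map_sum]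

lemma functionalMeasure_apply (hp' : p ≠ ∞) (Λ : Lp ℂ p μ →L[ℂ] ℂ) {E : Set X}
    (hE : MeasurableSet E) : functionalMeasure hp' Λ E =
      Λ (indicatorConstLp p hE (measure_ne_top μ _) 1) :=
  dif_pos hE

/-- The complex measure of `Λ` vanishes on null sets, so Radon–Nikodym applies to its real and
imaginary parts; at this stage the density is only known to be in `L^1`. -/
lemma exists_density (hp' : p ≠ ∞) (Λ : Lp ℂ p μ →L[ℂ] ℂ) :
    ∃ η : X → ℂ, StronglyMeasurable η ∧ Integrable η μ ∧ ∀ (E : Set X) (hE : MeasurableSet E),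
      Λ (indicatorConstLp p hE (measure_ne_top μ _) 1) = ∫ x in E, η x ∂μ := by
  have hp0 : p ≠ 0 := (zero_lt_one.trans_le hp.out).ne'
  set c := functionalMeasure hp' Λ with hc
  have hc0 : ∀ E, μ E = 0 → c E = 0 := by
    intro E hE
    by_cases hm : MeasurableSet E
    · rw [hc, functionalMeasure_apply hp' Λ hm]
      have : indicatorConstLp p hm (measure_ne_top μ _) (1 : ℂ) = 0 := by
        rw [← norm_eq_zero, norm_indicatorConstLp hp0 hp']
        simp [Measure.real, hE, ENNReal.toReal_pos hp0 hp' |>.ne']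
      rw [this, map_zero]
    · exact c.not_measurable hm
  have ac : ∀ s : SignedMeasure X, (∀ E, μ E = 0 → s E = 0) →
      μ.withDensityᵥ (s.rnDeriv μ) = s := by
    intro s hs
    refine s.withDensityᵥ_rnDeriv_eq μ (VectorMeasure.AbsolutelyContinuous.mk fun E hE h0 => ?_)
    rw [Measure.toENNRealVectorMeasure_apply_measurable hE] at h0
    exact hs E h0
  have reE : ∀ E, ComplexMeasure.re c E = (c E).re := fun E => rfl
  have imE : ∀ E, ComplexMeasure.im c E = (c E).im := fun E => rfl
  have hre := ac (ComplexMeasure.re c) fun E hE => by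
    rw [reE, hc0 E hE]; rfl
  have him := ac (ComplexMeasure.im c) fun E hE => by
    rw [imE, hc0 E hE]; rfl
  have ire := SignedMeasure.integrable_rnDeriv (ComplexMeasure.re c) μ
  have iim := SignedMeasure.integrable_rnDeriv (ComplexMeasure.im c) μ
  set u := SignedMeasure.rnDeriv (ComplexMeasure.re c) μ
  set v := SignedMeasure.rnDeriv (ComplexMeasure.im c) μ
  refine ⟨fun x => u x + v x * Complex.I, ?_, ire.ofReal.add (iim.ofReal.mul_const _),
    fun E hE => ?_⟩
  · exact ((Complex.measurable_ofReal.comp (SignedMeasure.measurable_rnDeriv _ _)).add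
      ((Complex.measurable_ofReal.comp (SignedMeasure.measurable_rnDeriv _ _)).mul_const
        _)).stronglyMeasurable
  · rw [← functionalMeasure_apply hp' Λ hE, ← hc]
    refine Eq.symm ((integral_add (ire.ofReal (𝕜 := ℂ)).integrableOn
      ((iim.ofReal (𝕜 := ℂ)).mul_const _).integrableOn).trans ?_)
    rw [integral_mul_const]
    refine Eq.trans (congrArg₂ (fun a b => a + b * Complex.I) (integral_complex_ofReal (f := u))
      (integral_complex_ofReal (f := v))) ?_
    rw [      ← withDensityᵥ_apply ire hE, ← withDensityᵥ_apply iim hE, hre, him, reE, imE]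
    exact Complex.re_add_im _

lemma functional_simpleFunc {Λ : Lp ℂ p μ →L[ℂ] ℂ} {η : X → ℂ} (hη : Integrable η μ)
    (h : ∀ (E : Set X) (hE : MeasurableSet E),
      Λ (indicatorConstLp p hE (measure_ne_top μ _) 1) = ∫ x in E, η x ∂μ)
    (s : SimpleFunc X ℂ) : Λ ((s.memLp_of_isFiniteMeasure p μ).toLp s) = ∫ x, s x * η x ∂μ := by
  induction s using SimpleFunc.induction with
  | @const c E hE =>
    have e1 : (SimpleFunc.memLp_of_isFiniteMeasure (SimpleFunc.piecewise E hE
        (SimpleFunc.const X c) (SimpleFunc.const X 0)) p μ).toLp _ =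
        c • indicatorConstLp p hE (measure_ne_top μ _) (1 : ℂ) := by
      refine Lp.ext ?_
      filter_upwards [MemLp.coeFn_toLp (SimpleFunc.memLp_of_isFiniteMeasure (SimpleFunc.piecewise E hE
        (SimpleFunc.const X c) (SimpleFunc.const X 0)) p μ), Lp.coeFn_smul c
        (indicatorConstLp p hE (measure_ne_top μ _) (1 : ℂ)),
        indicatorConstLp_coeFn (p := p) (hs := hE) (hμs := measure_ne_top μ _) (c := (1 : ℂ))]
        with x h1 h2 h3
      rw [h1, h2, Pi.smul_apply, h3]
      by_cases hx : x ∈ E <;> simp [hx]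
    rw [e1, map_smul, h, smul_eq_mul, ← integral_const_mul, ← integral_indicator hE]
    congr 1; ext x
    by_cases hx : x ∈ E <;> simp [hx]
  | @add f g _ hf hg =>
    have e1 : ((f + g).memLp_of_isFiniteMeasure p μ).toLp _ =
        (f.memLp_of_isFiniteMeasure p μ).toLp f + (g.memLp_of_isFiniteMeasure p μ).toLp g := rfl
    have hi : ∀ f : SimpleFunc X ℂ, Integrable (fun x => f x * η x) μ := fun f => by
      obtain ⟨C, hC⟩ := f.exists_forall_norm_le
      exact hη.bdd_mul (c := C) f.aestronglyMeasurable (Eventually.of_forall hC)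
    rw [e1, map_add, hf, hg, ← integral_add (hi f) (hi g)]
    simp only [SimpleFunc.coe_add, Pi.add_apply, add_mul]

/-- Extends the representation from simple to bounded functions by dominated convergence; this is
enough to test with the extremal function of a truncation of `η`. -/
lemma functional_bounded (hp' : p ≠ ∞) {Λ : Lp ℂ p μ →L[ℂ] ℂ} {η : X → ℂ}
    (hη : Integrable η μ) (h : ∀ (E : Set X) (hE : MeasurableSet E),
      Λ (indicatorConstLp p hE (measure_ne_top μ _) 1) = ∫ x in E, η x ∂μ)
    {f : X → ℂ} (hf : StronglyMeasurable f) {C : ℝ} (hC : ∀ x, ‖f x‖ ≤ C) (hfp : MemLp f p μ) :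
    Λ (hfp.toLp f) = ∫ x, f x * η x ∂μ := by
  by_cases hX : Nonempty X
  swap
  · rw [not_nonempty_iff] at hX
    have : hfp.toLp f = 0 := Lp.ext (Eventually.of_forall fun x => isEmptyElim x)
    rw [this, map_zero, integral_eq_zero_of_ae (Eventually.of_forall fun x => isEmptyElim x)]
  have hC0 : 0 ≤ C := (norm_nonneg _).trans (hC hX.some)
  have hlim : ∀ x, Tendsto (fun n => hf.approxBounded C n x) atTop (𝓝 (f x)) :=
    fun x => hf.tendsto_approxBounded_of_norm_le (hC x)
  have hb := hf.norm_approxBounded_le hC0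
  have h1 := tendsto_eLpNorm_sub_of_bounded (μ := μ) (zero_lt_one.trans_le hp.out).ne' hp'
    hf.aestronglyMeasurable (fun n => (hf.approxBounded C n).aestronglyMeasurable) hC hb
    (Eventually.of_forall hlim)
  have h2 := (Lp.tendsto_Lp_iff_tendsto_eLpNorm'' _
    (fun n => (hf.approxBounded C n).memLp_of_isFiniteMeasure p μ) f hfp).2 h1
  have h3 := (Λ.continuous.tendsto _).comp h2
  refine tendsto_nhds_unique h3 ?_
  simp only [Function.comp_def, functional_simpleFunc hη h]
  refine tendsto_integral_of_dominated_convergence (fun x => C * ‖η x‖)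
    (fun n => (hf.approxBounded C n).aestronglyMeasurable.mul hη.1) (hη.norm.const_mul C)
    (fun n => Eventually.of_forall fun x => ?_)
    (Eventually.of_forall fun x => (hlim x).mul_const _)
  rw [norm_mul]
  exact mul_le_mul_of_nonneg_right (hb n x) (norm_nonneg _)

lemma eLpNorm_truncation_le (hp1 : 1 < p) (hp' : p ≠ ∞) {q : ℝ≥0∞} [p.HolderConjugate q]
    {Λ : Lp ℂ p μ →L[ℂ] ℂ} {η : X → ℂ} (hηm : StronglyMeasurable η)
    (hη : Integrable η μ) (h : ∀ (E : Set X) (hE : MeasurableSet E),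
      Λ (indicatorConstLp p hE (measure_ne_top μ _) 1) = ∫ x in E, η x ∂μ) {N : ℝ} (hN : 0 ≤ N) :
    eLpNorm ({x | ‖η x‖ ≤ N}.indicator η) q μ ≤ ENNReal.ofReal ‖Λ‖ := by
  have hp0 : p ≠ 0 := (zero_lt_one.trans hp1).ne'
  have hq1 : q ≠ ∞ := fun h => hp1.ne' ((ENNReal.HolderConjugate.eq_top_iff_eq_one q p).1 h)
  have hq0 : q ≠ 0 := (ENNReal.HolderConjugate.pos q p).ne'
  have hr := ENNReal.HolderConjugate.toReal_of_ne_top hp' hq1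
  set a := p.toReal
  set b := q.toReal
  have ha := hr.pos
  have hb := hr.symm.pos
  have hb1 := hr.symm.sub_one_pos
  have hab : (b - 1) * a = b := by
    have := hr.symm.sub_one_mul_conj
    linarith
  have hE : MeasurableSet {x | ‖η x‖ ≤ N} := hηm.norm.measurable measurableSet_Iic
  set F := {x | ‖η x‖ ≤ N}.indicator η with hF
  have hFm : StronglyMeasurable F := hηm.indicator hE
  have hFN : ∀ x, ‖F x‖ ≤ N := fun x => by
    by_cases hx : ‖η x‖ ≤ N
    · rw [hF, Set.indicator_of_mem (by exact hx)]; exact hx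
    · rw [hF, Set.indicator_of_notMem (by exact hx)]; simpa using hN
  -- Extremal function in Hölder's inequality: `k η = |F|^b`, and `|k|^a = |F|^b` because `(b - 1) a
  -- = b`. Hence `∫ |F|^b ≤ ‖Λ‖ (∫ |F|^b)^(1/a)`, and dividing bounds the norm of `F`.
  set k : X → ℂ := fun x => conj (F x) * ((‖F x‖ ^ (b - 2) : ℝ) : ℂ) with hk
  have hkm : StronglyMeasurable k :=
    ((Complex.continuous_conj.measurable.comp hFm.measurable).mul
      (Complex.measurable_ofReal.comp (hFm.norm.measurable.pow_const _))).stronglyMeasurable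
  have hkn : ∀ x, ‖k x‖ = ‖F x‖ ^ (b - 1) := fun x => by
    rw [hk]
    simp only [norm_mul, RCLike.norm_conj, Complex.norm_real]
    rw [Real.norm_of_nonneg (Real.rpow_nonneg (norm_nonneg _) _)]
    rcases (norm_nonneg (F x)).eq_or_lt with h0 | h0
    · rw [← h0, zero_mul, Real.zero_rpow hb1.ne']
    · rw [show b - 1 = 1 + (b - 2) by ring, Real.rpow_add h0, Real.rpow_one]
  have hkN : ∀ x, ‖k x‖ ≤ N ^ (b - 1) := fun x => by
    rw [hkn]; exact Real.rpow_le_rpow (norm_nonneg _) (hFN x) hb1.le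
  have hkη : ∀ x, k x * η x = ((‖F x‖ ^ b : ℝ) : ℂ) := fun x => by
    by_cases hx : ‖η x‖ ≤ N
    · have hFx : F x = η x := Set.indicator_of_mem (by exact hx) _
      rw [hk]
      simp only [hFx]
      rcases (norm_nonneg (η x)).eq_or_lt with h0 | h0
      · have : η x = 0 := norm_eq_zero.1 h0.symm
        simp [this, Real.zero_rpow hb.ne']
      · have e : ‖η x‖ ^ b = ‖η x‖ ^ 2 * ‖η x‖ ^ (b - 2) := by
          rw [← Real.rpow_natCast, ← Real.rpow_add h0]; congr 1; push_cast; ring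
        rw [e, Complex.ofReal_mul, Complex.sq_norm, Complex.normSq_eq_conj_mul_self]
        ring
    · have hFx : F x = 0 := Set.indicator_of_notMem (by exact hx) _
      simp [hk, hFx, Real.zero_rpow hb.ne']
  have hkp : MemLp k p μ := MemLp.of_bound hkm.aestronglyMeasurable _ (Eventually.of_forall hkN)
  have hFq : MemLp F q μ := MemLp.of_bound hFm.aestronglyMeasurable _ (Eventually.of_forall hFN)
  have h1 := functional_bounded hp' hη h hkm hkN hkp
  simp only [hkη] at h1
  set I := ∫ x, ‖F x‖ ^ b ∂μ with hI
  have hI0 : 0 ≤ I := integral_nonneg fun x => Real.rpow_nonneg (norm_nonneg _) _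
  have h2 : I ≤ ‖Λ‖ * I ^ a⁻¹ := by
    have h3 : ‖Λ (hkp.toLp k)‖ = I := by
      rw [h1]
      refine (congrArg norm (integral_complex_ofReal (f := fun x => ‖F x‖ ^ b))).trans ?_
      rw [Complex.norm_real, Real.norm_of_nonneg hI0]
    rw [← h3]
    refine (Λ.le_opNorm _).trans (le_of_eq ?_)
    rw [h3, Lp.norm_toLp, hkp.eLpNorm_eq_integral_rpow_norm hp0 hp', ENNReal.toReal_ofReal
      (by positivity)]
    simp only [hkn, ← Real.rpow_mul (norm_nonneg _)]
    rw [hab]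
  rw [hFq.eLpNorm_eq_integral_rpow_norm hq0 hq1]
  refine ENNReal.ofReal_le_ofReal ?_
  change I ^ b⁻¹ ≤ ‖Λ‖
  rcases hI0.eq_or_lt with h0 | h0
  · rw [← h0, Real.zero_rpow (inv_pos.2 hb).ne']; exact norm_nonneg _
  · have h4 : I = I ^ b⁻¹ * I ^ a⁻¹ := by
      rw [← Real.rpow_add h0, add_comm, hr.inv_add_inv_eq_one, Real.rpow_one]
    have h5 : 0 < I ^ a⁻¹ := Real.rpow_pos_of_pos h0 _
    rw [← mul_le_mul_iff_left₀ h5, ← h4]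
    exact h2

/-- Bounded functionals on `L^p`, `1 < p < ∞`, are given by functions of `L^q`. -/
theorem exists_memLp_eq_integral (hp1 : 1 < p) (hp' : p ≠ ∞) {q : ℝ≥0∞} [p.HolderConjugate q]
    (Λ : Lp ℂ p μ →L[ℂ] ℂ) :
    ∃ η : X → ℂ, MemLp η q μ ∧ ∀ f : Lp ℂ p μ, Λ f = ∫ x, f x * η x ∂μ := by
  obtain ⟨η, hηm, hη, h⟩ := exists_density hp' Λ
  have hηq : MemLp η q μ := by
    refine ⟨hηm.aestronglyMeasurable, ?_⟩
    -- Fatou: the truncations of `η` converge pointwise and have norms at most `‖Λ‖`.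
    have h1 := Lp.eLpNorm_lim_le_liminf_eLpNorm (p := q) (μ := μ)
      (f := fun N : ℕ => {x | ‖η x‖ ≤ N}.indicator η)
      (fun N => (hηm.indicator (hηm.norm.measurable measurableSet_Iic)).aestronglyMeasurable) η
      (Eventually.of_forall fun x => by
        refine tendsto_const_nhds.congr' ?_
        obtain ⟨M, hM⟩ := exists_nat_ge ‖η x‖
        filter_upwards [eventually_ge_atTop M] with N hN
        rw [Set.indicator_of_mem]
        exact hM.trans (by exact_mod_cast hN))
    refine h1.trans_lt (lt_of_le_of_lt ?_ (ENNReal.ofReal_lt_top (r := ‖Λ‖)))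
    refine (liminf_le_liminf (Eventually.of_forall fun N : ℕ =>
      eLpNorm_truncation_le hp1 hp' (q := q) hηm hη h N.cast_nonneg)).trans ?_
    rw [liminf_const]
  refine ⟨η, hηq, fun f => ?_⟩
  have hq : Fact (1 ≤ q) := by
    have : q.HolderConjugate p := ENNReal.HolderConjugate.symm
    exact ⟨ENNReal.HolderConjugate.one_le q p⟩
  set Ψ : Lp ℂ p μ →L[ℂ] ℂ :=
    ((ContinuousLinearMap.mul ℂ ℂ).lpPairing μ p q).flip (hηq.toLp η) with hΨ
  have hΨe : ∀ f, Ψ f = ∫ x, f x * η x ∂μ := fun f => by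
    rw [hΨ, ContinuousLinearMap.flip_apply, ContinuousLinearMap.lpPairing_eq_integral]
    refine integral_congr_ae ?_
    filter_upwards [hηq.coeFn_toLp] with x hx
    rw [hx, ContinuousLinearMap.mul_apply']
  rw [← hΨe]
  refine (Lp.simpleFunc.denseRange (E := ℂ) (p := p) (μ := μ) hp').induction_on
    (p := fun f => Λ f = Ψ f) f
    (isClosed_eq Λ.continuous Ψ.continuous) fun s => ?_
  have h1 := functional_simpleFunc hη h (Lp.simpleFunc.toSimpleFunc s)
  have h2 : ((Lp.simpleFunc.toSimpleFunc s).memLp_of_isFiniteMeasure p μ).toLp _ =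
      (s : Lp ℂ p μ) := congrArg Subtype.val (Lp.simpleFunc.toLp_toSimpleFunc s)
  rw [hΨe, ← h2, h1]
  refine integral_congr_ae ?_
  filter_upwards [((Lp.simpleFunc.toSimpleFunc s).memLp_of_isFiniteMeasure p μ).coeFn_toLp]
    with x hx
  rw [hx]

end Duality

/-! ### Dimension counts for invertibility. -/

section LinearAlgebra

variable {K E : Type*} [Field K] [AddCommGroup E] [Module K E]

/-- A surjective map with kernel of dimension `d` is injective on a subspace of codimension `d` if
and only if it maps this subspace onto everything. -/
lemma inf_ker_eq_bot_iff_map_eq_top {T : E →ₗ[K] E} (hT : Function.Surjective T)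
    {R : Submodule K E} [FiniteDimensional K T.ker] [FiniteDimensional K (E ⧸ R)]
    (h : Module.finrank K T.ker = Module.finrank K (E ⧸ R)) :
    R ⊓ T.ker = ⊥ ↔ R.map T = ⊤ := by
  -- The map from `ker T` to `E ⧸ R` is injective when `R` meets the kernel trivially and surjective
  -- when `R + ker T = E`, which for surjective `T` means `T(R) = E`.
  have key := LinearMap.injective_iff_surjective_of_finrank_eq_finrank h
    (f := R.mkQ.comp T.ker.subtype)
  constructor
  · intro h0
    have hinj : Function.Injective (R.mkQ.comp T.ker.subtype) := by
      rw [← LinearMap.ker_eq_bot, LinearMap.ker_eq_bot']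
      intro x hx
      have hxR : (x : E) ∈ R := (Submodule.Quotient.mk_eq_zero R).1 hx
      have : (x : E) ∈ R ⊓ T.ker := ⟨hxR, x.2⟩
      rw [h0, Submodule.mem_bot] at this
      exact Subtype.ext this
    refine eq_top_iff.2 fun y _ => ?_
    obtain ⟨x, rfl⟩ := hT y
    obtain ⟨k, hk⟩ := key.1 hinj (R.mkQ x)
    refine ⟨x - k, ?_, ?_⟩
    · exact (Submodule.Quotient.eq R).1 hk.symm
    · rw [map_sub, LinearMap.mem_ker.1 k.2, sub_zero]
  · intro h0
    have hsurj : Function.Surjective (R.mkQ.comp T.ker.subtype) := by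
      intro e
      obtain ⟨x, rfl⟩ := R.mkQ_surjective e
      obtain ⟨r, hr, hrx⟩ : T x ∈ R.map T := h0 ▸ Submodule.mem_top
      refine ⟨⟨x - r, by rw [LinearMap.mem_ker, map_sub, hrx, sub_self]⟩, ?_⟩
      refine (Submodule.Quotient.eq R).2 ?_
      simpa using hr
    refine (Submodule.eq_bot_iff _).2 fun x hx => ?_
    have := key.2 hsurj (a₁ := ⟨x, hx.2⟩) (a₂ := 0) (by
      rw [map_zero]; exact (Submodule.Quotient.mk_eq_zero R).2 hx.1)
    exact congrArg Subtype.val this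

/-- A map which is injective on a subspace and preserves its codimension is injective if and only
if it is surjective. -/
lemma injective_iff_surjective_of_codim {T : E →ₗ[K] E} {R : Submodule K E}
    [FiniteDimensional K (E ⧸ R)] [FiniteDimensional K (E ⧸ R.map T)]
    (h : Module.finrank K (E ⧸ R) = Module.finrank K (E ⧸ R.map T)) (h0 : R ⊓ T.ker = ⊥) :
    Function.Injective T ↔ Function.Surjective T := by
  -- The induced map from `E ⧸ R` to `E ⧸ T(R)` acts between spaces of equal finite dimension.
  have key := LinearMap.injective_iff_surjective_of_finrank_eq_finrank h
    (f := R.mapQ (R.map T) T (Submodule.le_comap_map T R))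
  constructor
  · intro hT
    have hinj : Function.Injective (R.mapQ (R.map T) T (Submodule.le_comap_map T R)) := by
      rw [← LinearMap.ker_eq_bot, LinearMap.ker_eq_bot']
      intro e he
      obtain ⟨x, rfl⟩ := R.mkQ_surjective e
      obtain ⟨r, hr, hrx⟩ := (Submodule.Quotient.mk_eq_zero (R.map T)).1 he
      exact (Submodule.Quotient.mk_eq_zero R).2 (hT hrx ▸ hr)
    intro y
    obtain ⟨e, he⟩ := key.1 hinj ((R.map T).mkQ y)
    obtain ⟨x, rfl⟩ := R.mkQ_surjective e
    obtain ⟨r, hr, hrx⟩ := (Submodule.Quotient.eq (R.map T)).1 he.symm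
    exact ⟨x + r, by rw [map_add, hrx]; abel⟩
  · intro hT
    have hsurj : Function.Surjective (R.mapQ (R.map T) T (Submodule.le_comap_map T R)) := by
      intro e
      obtain ⟨y, rfl⟩ := (R.map T).mkQ_surjective e
      obtain ⟨x, rfl⟩ := hT y
      exact ⟨R.mkQ x, rfl⟩
    rw [← LinearMap.ker_eq_bot, LinearMap.ker_eq_bot']
    intro x hx
    have h1 := key.2 hsurj (a₁ := R.mkQ x) (a₂ := 0) (by
      rw [map_zero, Submodule.mkQ_apply, Submodule.mapQ_apply, hx, Submodule.Quotient.mk_zero])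
    have : x ∈ R ⊓ T.ker := ⟨(Submodule.Quotient.mk_eq_zero R).1 h1, hx⟩
    rwa [h0, Submodule.mem_bot] at this

end LinearAlgebra

/-! ### Toeplitz operators and multiplication by monomials. -/

section Operators

variable {p : ℝ≥0∞} [hp : Fact (1 ≤ p)]

lemma coe_mulOperator (g : Lp ℂ ∞ arc) (f : Lp ℂ p arc) :
    mulOperator p g f =ᵐ[arc] fun t => g t * f t := by
  rw [mulOperator, ContinuousLinearMap.holderL_apply_apply]
  exact ContinuousLinearMap.coeFn_holder _ _ _

lemma coeff_toeplitz (hP : HasRieszProjection p) (g : Lp ℂ ∞ arc) (φ : Hardy p) {n : ℤ}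
    (hn : 0 ≤ n) : coeff (toeplitz p g φ : Lp ℂ p arc) n =
      coeff (fun t => g t * (φ : Lp ℂ p arc) t) n := by
  rw [← coeff_congr (coe_mulOperator g (φ : Lp ℂ p arc)), 
    ← coeff_rieszProjection hP (mulOperator p g (φ : Lp ℂ p arc)) hn]
  rfl

/-- The Fourier coefficient as a functional on `L^p`. -/
def coeffL (p : ℝ≥0∞) [hp : Fact (1 ≤ p)] (n : ℤ) : Lp ℂ p arc →L[ℂ] ℂ :=
  LinearMap.mkContinuous
    { toFun := fun f => coeff f n
      map_add' := fun f g => by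
        rw [coeff_congr (Lp.coeFn_add f g), coeff_add (integrable_Lp f) (integrable_Lp g)]
      map_smul' := fun c f => by
        rw [coeff_congr (Lp.coeFn_smul c f), coeff_smul, RingHom.id_apply, smul_eq_mul] } 1
    fun f => by
      have h1 : ‖coeff f n‖ ≤ ∫ t, ‖f t‖ ∂arc := by
        refine (norm_integral_le_integral_norm _).trans (le_of_eq ?_)
        congr 1; ext t
        rw [norm_mul, norm_zpow, Circle.norm_coe, one_zpow, one_mul]
      have h2 : eLpNorm f 1 arc ≤ eLpNorm f p arc :=
        eLpNorm_le_eLpNorm_of_exponent_le hp.out (Lp.memLp f).1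
      rw [one_mul, Lp.norm_def]
      refine h1.trans ?_
      rw [integral_norm_eq_lintegral_enorm (Lp.memLp f).1, ← eLpNorm_one_eq_lintegral_enorm]
      exact ENNReal.toReal_mono (Lp.eLpNorm_ne_top f) h2

@[simp] lemma coeffL_apply (n : ℤ) (f : Lp ℂ p arc) : coeffL p n f = coeff f n := rfl

lemma isClosed_Hardy : IsClosed (Hardy p : Set (Lp ℂ p arc)) := by
  have : (Hardy p : Set (Lp ℂ p arc)) = ⋂ n : ℤ, ⋂ _ : n < 0, (coeffL p n) ⁻¹' {0} := by
    ext f; simp [Hardy]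
  rw [this]
  exact isClosed_iInter fun n => isClosed_iInter fun _ =>
    isClosed_singleton.preimage (coeffL p n).continuous

instance : CompleteSpace (Hardy p) := isClosed_Hardy.completeSpace_coe

lemma ae_ne_zero_of_shift {β : ℂ} (hβ : 1 < ‖β‖) {g : Circle → ℂ}
    (hmatch : ∀ᵐ t ∂arc, g t * g (shift β hβ t) = 1) : ∀ᵐ t ∂arc, g t ≠ 0 :=
  hmatch.mono fun t ht h0 => by simp [h0] at ht

/-- The monomial `t^k` as an element of `L^∞`. -/
def monomialLp (r : ℝ≥0∞) (k : ℤ) : Lp ℂ r arc :=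
  (memLp_continuous (continuous_monomial k) r).toLp _

lemma coe_monomialLp (r : ℝ≥0∞) (k : ℤ) : monomialLp r k =ᵐ[arc] fun t => (t : ℂ) ^ k :=
  MemLp.coeFn_toLp _

/-- The monomial `t^k`, `k ≥ 0`, as an element of `H^p`. -/
def monomialHardy (p : ℝ≥0∞) [Fact (1 ≤ p)] (k : ℕ) : Hardy p :=
  ⟨monomialLp p k, fun n hn => by
    rw [coeff_congr (coe_monomialLp p k), coeff_monomial, if_neg (by omega)]⟩

lemma coe_monomialHardy (k : ℕ) :
    (monomialHardy p k : Lp ℂ p arc) =ᵐ[arc] fun t => (t : ℂ) ^ (k : ℤ) :=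
  coe_monomialLp p k

lemma coeff_toeplitz_monomial (hP : HasRieszProjection p) (m : ℕ) (φ : Hardy p) {n : ℤ}
    (hn : 0 ≤ n) : coeff (toeplitz p (monomialLp ∞ m) φ : Lp ℂ p arc) n =
      coeff (φ : Lp ℂ p arc) (n - m) := by
  rw [coeff_toeplitz hP _ _ hn, ← coeff_monomial_mul]
  refine coeff_congr ?_ _
  filter_upwards [coe_monomialLp ∞ m] with t ht
  rw [ht]

/-- Multiplication by `t^m`, `m ≥ 0`, preserves `H^p`. -/
lemma coe_toeplitz_monomial (hP : HasRieszProjection p) (m : ℕ) (φ : Hardy p) :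
    (toeplitz p (monomialLp ∞ m) φ : Lp ℂ p arc) =ᵐ[arc]
      fun t => (t : ℂ) ^ (m : ℤ) * (φ : Lp ℂ p arc) t := by
  refine ae_eq_of_coeff_eq (integrable_Lp _) (integrable_monomial_mul (integrable_Lp _) _)
    fun n => ?_
  rw [coeff_monomial_mul]
  rcases lt_or_ge n 0 with hn | hn
  · rw [(toeplitz p (monomialLp ∞ m) φ).2 n hn, φ.2 _ (by omega)]
  · exact coeff_toeplitz_monomial hP m φ hn

lemma toeplitz_monomial_injective (hP : HasRieszProjection p) (m : ℕ) :
    Function.Injective (toeplitz p (monomialLp ∞ m)) := by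
  intro φ ψ h
  refine Hardy_eq_of_coeff_eq fun n hn => ?_
  have h1 := coeff_toeplitz_monomial hP m φ (n := n + m) (by omega)
  rw [h, coeff_toeplitz_monomial hP m ψ (by omega)] at h1
  simpa using h1.symm

lemma mem_range_toeplitz_monomial (hP : HasRieszProjection p) (m : ℕ) (φ : Hardy p) :
    φ ∈ (toeplitz p (monomialLp ∞ m)).range ↔
      ∀ k : Fin m, coeff (φ : Lp ℂ p arc) (k : ℕ) = 0 := by
  constructor
  · rintro ⟨ψ, rfl⟩ k
    refine (coeff_toeplitz_monomial hP m ψ (by omega)).trans (ψ.2 _ ?_)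
    have := k.2
    omega
  · intro h
    have hm : MemHardy (fun t : Circle => (t : ℂ) ^ (-m : ℤ) * (φ : Lp ℂ p arc) t) p := by
      refine ⟨memLp_continuous_mul (continuous_monomial _) (Lp.memLp _), fun n hn => ?_⟩
      rw [coeff_monomial_mul]
      rcases lt_or_ge (n - (-m : ℤ)) 0 with h0 | h0
      · exact φ.2 _ h0
      · obtain ⟨k, hk⟩ := Int.eq_ofNat_of_zero_le h0
        rw [hk]
        exact h ⟨k, by omega⟩
    refine ⟨hm.toHardy, Hardy_eq_of_coeff_eq fun n hn => ?_⟩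
    refine (coeff_toeplitz_monomial hP m _ hn).trans ?_
    rw [coeff_congr hm.coe_toHardy, coeff_monomial_mul]
    congr 1; omega

/-- The first `m` coefficients of a Hardy function. -/
def initialCoeffs (p : ℝ≥0∞) [Fact (1 ≤ p)] (m : ℕ) : Hardy p →L[ℂ] (Fin m → ℂ) :=
  ContinuousLinearMap.pi fun k => coeffL p (k : ℕ) ∘L (Hardy p).subtypeL

lemma initialCoeffs_surjective (m : ℕ) : Function.Surjective (initialCoeffs p m) := by
  intro v
  refine ⟨∑ k : Fin m, v k • monomialHardy p k, ?_⟩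
  ext j
  have h : ∀ k : Fin m, coeff (monomialHardy p k : Lp ℂ p arc) (j : ℕ) =
      if k = j then 1 else 0 := by
    intro k
    rw [coeff_congr (coe_monomialHardy _), coeff_monomial]
    simp [Fin.ext_iff]
  simp only [initialCoeffs, map_sum, map_smul, ContinuousLinearMap.coe_pi', Finset.sum_apply,
    ContinuousLinearMap.comp_apply, Submodule.subtypeL_apply]
  simp [h]

lemma range_toeplitz_monomial (hP : HasRieszProjection p) (m : ℕ) :
    (toeplitz p (monomialLp ∞ m)).range = (initialCoeffs p m).ker := by
  ext φ
  rw [mem_range_toeplitz_monomial hP, LinearMap.mem_ker, funext_iff]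
  rfl

lemma quotient_range_toeplitz_monomial (hP : HasRieszProjection p) (m : ℕ) :
    FiniteDimensional ℂ (Hardy p ⧸ (toeplitz p (monomialLp ∞ m)).range) ∧
      Module.finrank ℂ (Hardy p ⧸ (toeplitz p (monomialLp ∞ m)).range) = m := by
  rw [range_toeplitz_monomial hP]
  have e := (initialCoeffs p m).toLinearMap.quotKerEquivOfSurjective (initialCoeffs_surjective m)
  exact ⟨Module.Finite.equiv e.symm, by rw [e.finrank_eq]; simp⟩

lemma isClosed_range_toeplitz_monomial (hP : HasRieszProjection p) (m : ℕ) :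
    IsClosed ((toeplitz p (monomialLp ∞ m)).range : Set (Hardy p)) := by
  rw [range_toeplitz_monomial hP]
  exact (initialCoeffs p m).isClosed_ker

/-- `T(t^m h) = T(h) T(t^m)` for `m ≥ 0`. -/
lemma toeplitz_comp_monomial (hP : HasRieszProjection p) {g h : Lp ℂ ∞ arc} {m : ℕ}
    (hg : ∀ᵐ t ∂arc, g t = (t : ℂ) ^ (m : ℤ) * h t) (φ : Hardy p) :
    toeplitz p g φ = toeplitz p h (toeplitz p (monomialLp ∞ m) φ) := by
  refine Hardy_eq_of_coeff_eq fun n hn => ?_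
  rw [coeff_toeplitz hP _ _ hn, coeff_toeplitz hP _ _ hn]
  refine coeff_congr ?_ _
  filter_upwards [hg, coe_toeplitz_monomial hP m φ] with t h1 h2
  rw [h1, h2]; ring

end Operators

/-! ### Coburn's lemma, invertibility and existence of the factorization. -/

section Existence

variable {p q : ℝ≥0∞} [hp : Fact (1 ≤ p)] [p.HolderConjugate q]

lemma rieszProjection_coe (hP : HasRieszProjection p) (φ : Hardy p) :
    rieszProjection p (φ : Lp ℂ p arc) = φ :=
  Hardy_eq_of_coeff_eq fun _ hn => coeff_rieszProjection hP _ hn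

lemma coeff_eq_integral_monomialLp_mul {r : ℝ≥0∞} (f : Circle → ℂ) (n : ℤ) :
    coeff f n = ∫ t, monomialLp r (-n) t * f t ∂arc :=
  integral_congr_ae ((coe_monomialLp r (-n)).mono fun t ht => by simp only [ht])

/-- Bounded functionals on `H^p` are given by functions of the conjugate Hardy space. -/
lemma exists_memConjHardy_eq_integral (hp1 : 1 < p) (hp' : p ≠ ∞) (hP : HasRieszProjection p)
    (l : Hardy p →L[ℂ] ℂ) : ∃ η : Circle → ℂ, MemConjHardy η q ∧
      ∀ f : Lp ℂ p arc, l (rieszProjection p f) = ∫ t, f t * η t ∂arc := by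
  obtain ⟨η, hη, h⟩ := exists_memLp_eq_integral hp1 hp' (q := q) (l ∘L rieszProjection p)
  refine ⟨η, ⟨hη, fun n hn => ?_⟩, h⟩
  -- For `n > 0` this coefficient is the functional at `P t⁻ⁿ = 0`.
  rw [coeff_eq_integral_monomialLp_mul (r := p), ← h, ContinuousLinearMap.comp_apply]
  convert! map_zero l
  refine Hardy_eq_of_coeff_eq fun m hm => ?_
  rw [coeff_rieszProjection hP _ hm, coeff_congr (coe_monomialLp p (-n)), coeff_monomial,
    if_neg (by omega), Submodule.coe_zero, coeff_congr (Lp.coeFn_zero ℂ p arc)]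
  simp [coeff]

lemma integrable_bounded_mul (h : Lp ℂ ∞ arc) {f : Circle → ℂ} {r : ℝ≥0∞} (hf : MemLp f r arc) :
    MemLp (fun t => h t * f t) r arc :=
  hf.mul' (p := ∞) (q := r) (r := r) (Lp.memLp h)

lemma integral_mulOperator_mul (h : Lp ℂ ∞ arc) (f : Lp ℂ p arc) (η : Circle → ℂ) :
    ∫ t, mulOperator p h f t * η t ∂arc = ∫ t, h t * f t * η t ∂arc :=
  integral_congr_ae ((coe_mulOperator h f).mono fun t ht => by simp only [ht])

lemma eq_zero_of_coe_ae_eq_zero {φ : Hardy p} (h : (φ : Lp ℂ p arc) =ᵐ[arc] 0) : φ = 0 :=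
  Subtype.ext (Lp.ext (h.trans (Lp.coeFn_zero ℂ p arc).symm))

include q in
/-- **Coburn's lemma**: if the kernel of a Toeplitz operator with a nonvanishing symbol is
nontrivial, then its range is dense. -/
lemma functional_eq_zero_of_range (hp1 : 1 < p) (hp' : p ≠ ∞) (hP : HasRieszProjection p)
    {h : Lp ℂ ∞ arc} (h0 : ∀ᵐ t ∂arc, h t ≠ 0) {φ : Hardy p} (hφ : φ ≠ 0)
    (hφ0 : toeplitz p h φ = 0) {l : Hardy p →L[ℂ] ℂ} (hl : ∀ ψ, l (toeplitz p h ψ) = 0) :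
    l = 0 := by
  obtain ⟨η, hη, hlη⟩ := exists_memConjHardy_eq_integral (q := q) hp1 hp' hP l
  have hqp : q.HolderConjugate p := ENNReal.HolderConjugate.symm
  set σ : Circle → ℂ := fun t => h t * η t with hσ
  set r : Circle → ℂ := fun t => h t * (φ : Lp ℂ p arc) t with hr
  -- For `k = -n ≥ 0` this coefficient is `l(T(h) t^k)`, which vanishes by hypothesis.
  have hσ0 : ∀ n ≤ 0, coeff σ n = 0 := by
    intro n hn
    obtain ⟨k, hk⟩ := Int.eq_ofNat_of_zero_le (show 0 ≤ -n by omega)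
    have := hl (monomialHardy p k)
    change l (rieszProjection p (mulOperator p h (monomialHardy p k : Lp ℂ p arc))) = 0 at this
    rw [hlη, integral_mulOperator_mul] at this
    rw [coeff_eq_integral_monomialLp_mul (r := p), hk, ← this]
    congr 1; ext t
    simp only [hσ, monomialHardy]
    ring
  have hσH : MemHardy σ q := ⟨integrable_bounded_mul h hη.1, fun n hn => hσ0 n hn.le⟩
  have hr0 : ∀ n, 0 ≤ n → coeff r n = 0 := fun n hn => by
    rw [← coeff_toeplitz hP h φ hn, hφ0, Submodule.coe_zero,
      coeff_congr (Lp.coeFn_zero ℂ p arc)]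
    simp [coeff]
  have hrH : MemConjHardy r p := ⟨integrable_bounded_mul h (Lp.memLp _), fun n hn => hr0 n hn.le⟩
  have heq : (fun t => (φ : Lp ℂ p arc) t * σ t) = fun t => r t * η t := by
    ext t; simp only [hσ, hr]; ring
  -- As `φ σ` the product has only coefficients of positive order, as `r η` only of negative order.
  have hprod : ∀ᵐ t ∂arc, (φ : Lp ℂ p arc) t * σ t = 0 := by
    refine ae_eq_zero_of_coeff_eq_zero (integrable_mul (Lp.memLp _) hσH.1) fun n => ?_
    rcases le_or_gt n 0 with hn | hn
    · rw [(memHardy_coe φ).coeff_mul hp' hP hσH hn, hσ0 n hn, mul_zero]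
    · rw [heq, hrH.coeff_mul hp' hP hη hn.le, hr0 0 le_rfl, zero_mul]
  rcases (memHardy_coe φ).eq_zero_or_eq_zero_of_mul hp' hP hσH hprod with h1 | h1
  · exact absurd (eq_zero_of_coe_ae_eq_zero h1) hφ
  · ext ψ
    rw [← rieszProjection_coe hP ψ, hlη]
    refine integral_eq_zero_of_ae ?_
    filter_upwards [h1, h0] with t h2 h3
    have : η t = 0 := (mul_eq_zero.1 h2).resolve_left h3
    simp [this]

include q in
-- If the closed range were proper, Hahn–Banach would give a nonzero functional vanishing on it,
-- contrary to Coburn's lemma when the kernel is nontrivial.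
lemma toeplitz_injective_or_surjective (hp1 : 1 < p) (hp' : p ≠ ∞) (hP : HasRieszProjection p)
    {h : Lp ℂ ∞ arc} (h0 : ∀ᵐ t ∂arc, h t ≠ 0)
    (hc : IsClosed ((toeplitz p h).range : Set (Hardy p))) :
    Function.Injective (toeplitz p h) ∨ Function.Surjective (toeplitz p h) := by
  by_contra! hcon
  obtain ⟨hi, hs⟩ := hcon
  rw [injective_iff_map_eq_zero] at hi
  push Not at hi
  obtain ⟨φ, hφ0, hφ⟩ := hi
  obtain ⟨x, hx⟩ := not_forall.1 hs
  set R := (toeplitz p h).range with hR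
  have hxR : x ∉ R := fun ⟨y, hy⟩ => hx ⟨y, hy⟩
  obtain ⟨f, u, hfu, hux⟩ := RCLike.geometric_hahn_banach_closed_point (𝕜 := ℂ)
    ((R.restrictScalars ℝ).convex) hc hxR
  -- A functional bounded above on a subspace vanishes there: otherwise scaling `r` makes it attain
  -- the bound `u`.
  have hfR : ∀ r ∈ R, f r = 0 := fun r hr => by
    by_contra hr0
    have h1 := hfu _ (R.smul_mem ((u : ℂ) / f r) hr)
    rw [map_smul, smul_eq_mul, div_mul_cancel₀ _ hr0] at h1
    exact lt_irrefl _ h1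
  have hl : f = 0 :=
    functional_eq_zero_of_range (q := q) hp1 hp' hP h0 hφ hφ0 fun ψ => hfR _ ⟨ψ, rfl⟩
  have h1 := hfu 0 R.zero_mem
  rw [hl] at h1 hux
  exact lt_asymm h1 hux

include q in
/-- If `T(g)` is Fredholm of index `n`, then `T(t^n g)` is invertible. -/
theorem toeplitz_bijective (hp1 : 1 < p) (hp' : p ≠ ∞) (hP : HasRieszProjection p)
    {g h : Lp ℂ ∞ arc} (h0 : ∀ᵐ t ∂arc, g t ≠ 0) (hF : (toeplitz p g).IsFredholm) {n : ℤ}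
    (hn : fredholmIndex (toeplitz p g) = n) (hh : ∀ᵐ t ∂arc, h t = (t : ℂ) ^ n * g t) :
    Function.Bijective (toeplitz p h) := by
  have hfk := hF.finite_ker
  have hfc : FiniteDimensional ℂ (Hardy p ⧸ (toeplitz p g).range) := hF.finite_coker
  have hh0 : ∀ᵐ t ∂arc, h t ≠ 0 := by
    filter_upwards [h0, hh] with t h1 h2
    rw [h2]
    exact mul_ne_zero (zpow_ne_zero _ t.coe_ne_zero) h1
  have hgor := toeplitz_injective_or_surjective (q := q) hp1 hp' hP h0 hF.isClosed_range
  have hK : Function.Injective (toeplitz p g) → Module.finrank ℂ (toeplitz p g).ker = 0 := by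
    intro hi
    rw [LinearMap.ker_eq_bot.2 hi]; exact finrank_bot ℂ _
  have hD : Function.Surjective (toeplitz p g) →
      Module.finrank ℂ (Hardy p ⧸ (toeplitz p g).range) = 0 := by
    intro hs
    rw [LinearMap.range_eq_top.2 hs, Module.finrank_zero_iff]
    exact Submodule.Quotient.subsingleton_iff.2 rfl
  rw [fredholmIndex] at hn
  -- For `n ≥ 0`, `T(h) = T(g) T(tⁿ)` with `T(g)` surjective and kernel of dimension `n`. For `n <
  -- 0`, `T(g) = T(h) T(t⁻ⁿ)` with `T(g)` injective and range of codimension `-n`. In both cases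
  -- injectivity and surjectivity of `T(h)` are equivalent, and Coburn's lemma provides one of them.
  rcases le_or_gt 0 n with hn0 | hn0
  · obtain ⟨m, rfl⟩ := Int.eq_ofNat_of_zero_le hn0
    have hs : Function.Surjective (toeplitz p g) := by
      rcases hgor with hi | hs
      · have := hK hi
        have h1 : Module.finrank ℂ (Hardy p ⧸ (toeplitz p g).range) = 0 := by omega
        rw [Module.finrank_zero_iff, Submodule.Quotient.subsingleton_iff] at h1
        exact LinearMap.range_eq_top.1 h1
      · exact hs
    have hker : Module.finrank ℂ (toeplitz p g).ker = m := by
      have := hD hs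
      omega
    set V := toeplitz p (monomialLp ∞ m) with hV
    obtain ⟨hq1, hq2⟩ := quotient_range_toeplitz_monomial hP (p := p) m
    have hcomp := toeplitz_comp_monomial hP (p := p) hh
    have hrange : (toeplitz p h).range = V.range.map (toeplitz p g).toLinearMap := by
      ext x
      constructor
      · rintro ⟨y, rfl⟩
        exact ⟨V y, ⟨y, rfl⟩, (hcomp y).symm⟩
      · rintro ⟨_, ⟨y, rfl⟩, rfl⟩
        exact ⟨y, hcomp y⟩
    -- `T(g)` is a quotient map, and the preimage of the range contains the range of `T(tⁿ)`, which
    -- is closed of finite codimension.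
    have hclosed : IsClosed ((toeplitz p h).range : Set (Hardy p)) := by
      rw [← ((toeplitz p g).isQuotientMap hs).isClosed_preimage]
      have h1 : (toeplitz p g) ⁻¹' ((toeplitz p h).range : Set (Hardy p)) =
          (((toeplitz p h).range.comap (toeplitz p g).toLinearMap : Submodule ℂ (Hardy p)) :
            Set (Hardy p)) := rfl
      rw [h1, hrange]
      exact Submodule.isClosed_mono_of_finiteDimensional_quotient
        (isClosed_range_toeplitz_monomial hP m) (Submodule.le_comap_map _ _)
    have key := inf_ker_eq_bot_iff_map_eq_top (T := (toeplitz p g).toLinearMap) hs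
      (R := V.range) (hker.trans hq2.symm)
    have hinj : Function.Injective (toeplitz p h) ↔ V.range ⊓ (toeplitz p g).ker = ⊥ := by
      rw [Submodule.eq_bot_iff, injective_iff_map_eq_zero]
      constructor
      · rintro hi x ⟨⟨y, rfl⟩, hx⟩
        have := hi y ((hcomp y).trans hx)
        rw [this]; exact map_zero V
      · intro hi y hy
        have := hi (V y) ⟨⟨y, rfl⟩, (hcomp y).symm.trans hy⟩
        exact toeplitz_monomial_injective hP m (this.trans (map_zero V).symm)
    have hsurj : Function.Surjective (toeplitz p h) ↔
        V.range.map (toeplitz p g).toLinearMap = ⊤ := by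
      rw [← hrange]; exact LinearMap.range_eq_top.symm
    have hiff : Function.Injective (toeplitz p h) ↔ Function.Surjective (toeplitz p h) := by
      rw [hinj, hsurj]; exact key
    rcases toeplitz_injective_or_surjective (q := q) hp1 hp' hP hh0 hclosed with hi | hi
    · exact ⟨hi, hiff.1 hi⟩
    · exact ⟨hiff.2 hi, hi⟩
  · obtain ⟨m, hm⟩ := Int.eq_ofNat_of_zero_le (show 0 ≤ -n by omega)
    have hi : Function.Injective (toeplitz p g) := by
      rcases hgor with hi | hs
      · exact hi
      · have := hD hs
        omega
    have hcok : Module.finrank ℂ (Hardy p ⧸ (toeplitz p g).range) = m := by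
      have := hK hi
      omega
    set V := toeplitz p (monomialLp ∞ m) with hV
    obtain ⟨hq1, hq2⟩ := quotient_range_toeplitz_monomial hP (p := p) m
    have hcomp := toeplitz_comp_monomial hP (p := p) (g := g) (h := h) (m := m) (by
      filter_upwards [hh] with t ht
      rw [ht, ← mul_assoc, ← zpow_add₀ t.coe_ne_zero, ← hm, neg_add_cancel, zpow_zero, one_mul])
    have hrange : (toeplitz p g).range = V.range.map (toeplitz p h).toLinearMap := by
      ext x
      constructor
      · rintro ⟨y, rfl⟩
        exact ⟨V y, ⟨y, rfl⟩, (hcomp y).symm⟩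
      · rintro ⟨_, ⟨y, rfl⟩, rfl⟩
        exact ⟨y, hcomp y⟩
    have hclosed : IsClosed ((toeplitz p h).range : Set (Hardy p)) := by
      refine Submodule.isClosed_mono_of_finiteDimensional_quotient hF.isClosed_range ?_
      rintro _ ⟨y, rfl⟩
      exact ⟨V y, (hcomp y).symm⟩
    have hinj : V.range ⊓ (toeplitz p h).ker = ⊥ := by
      rw [Submodule.eq_bot_iff]
      rintro x ⟨⟨y, rfl⟩, hx⟩
      have : y = 0 := hi (((hcomp y).trans hx).trans (map_zero _).symm)
      rw [this]; exact map_zero V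
    rw [hrange] at hfc hcok
    have hiff := injective_iff_surjective_of_codim (T := (toeplitz p h).toLinearMap)
      (R := V.range) (hq2.trans hcok.symm) hinj
    rcases toeplitz_injective_or_surjective (q := q) hp1 hp' hP hh0 hclosed with hi | hi
    · exact ⟨hi, hiff.1 hi⟩
    · exact ⟨hiff.2 hi, hi⟩

/-- If `T(t^n g)` is invertible, then `g` has a Wiener–Hopf factorization of index `-n`. -/
theorem exists_isWienerHopf_of_bijective (hp1 : 1 < p) (hp' : p ≠ ∞) (hP : HasRieszProjection p)
    {g : Circle → ℂ} {h : Lp ℂ ∞ arc} {n : ℤ} (hh : ∀ᵐ t ∂arc, h t = (t : ℂ) ^ n * g t)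
    (hb : Function.Bijective (toeplitz p h)) :
    ∃ gm gp : Circle → ℂ, IsWienerHopf p q g gm (-n) gp := by
  have hqp : q.HolderConjugate p := ENNReal.HolderConjugate.symm
  set e := ContinuousLinearEquiv.ofBijective (toeplitz p h) (LinearMap.ker_eq_bot.2 hb.1)
    (LinearMap.range_eq_top.2 hb.2) with he
  set S : Hardy p →L[ℂ] Hardy p := e.symm.toContinuousLinearMap with hS
  have hTS : ∀ x, toeplitz p h (S x) = x := fun x => e.apply_symm_apply x
  have hST : ∀ x, S (toeplitz p h x) = x := fun x => e.symm_apply_apply x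
  -- `P(hφ) = 1`, so `ψ = hφ` is anti-analytic with value `1` at `∞`; it becomes `g₋`, and `φ`
  -- becomes `g₊⁻¹`.
  set φ := S (monomialHardy p 0) with hφ
  have hmono : ∀ n : ℤ, coeff (monomialHardy p 0 : Lp ℂ p arc) n = if n = 0 then 1 else 0 := by
    intro n
    rw [coeff_congr (coe_monomialHardy 0), coeff_monomial]
    simp [eq_comm]
  set ψ : Circle → ℂ := fun t => h t * (φ : Lp ℂ p arc) t with hψ
  have hψc : ∀ n, 0 ≤ n → coeff ψ n = if n = 0 then 1 else 0 := fun n hn => by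
    rw [← coeff_toeplitz hP h φ hn, hTS, hmono]
  have hψH : MemConjHardy ψ p := ⟨integrable_bounded_mul h (Lp.memLp _), fun n hn => by
    rw [hψc n hn.le, if_neg hn.ne']⟩
  have hψ0 : coeff ψ 0 = 1 := by rw [hψc 0 le_rfl, if_pos rfl]
  -- Dual counterpart of `φ`: testing this functional on `h t^k` gives the mean of `t^k`, so `ρ =
  -- hη` is analytic with mean `1`.
  obtain ⟨η, hη, hlη⟩ := exists_memConjHardy_eq_integral (q := q) hp1 hp' hP
    (coeffL p 0 ∘L (Hardy p).subtypeL ∘L S)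
  set ρ : Circle → ℂ := fun t => h t * η t with hρ
  have hρc : ∀ n ≤ 0, coeff ρ n = if n = 0 then 1 else 0 := by
    intro n hn
    obtain ⟨k, hk⟩ := Int.eq_ofNat_of_zero_le (show 0 ≤ -n by omega)
    have h1 := hlη (mulOperator p h (monomialHardy p k : Lp ℂ p arc))
    change coeff (S (toeplitz p h (monomialHardy p k)) : Lp ℂ p arc) 0 = _ at h1
    rw [hST, integral_mulOperator_mul, coeff_congr (coe_monomialHardy k), coeff_monomial] at h1
    rw [coeff_eq_integral_monomialLp_mul (r := p), hk]
    calc _ = _ := by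
          congr 1; ext t
          simp only [hρ, monomialHardy]
          rw [← mul_assoc, mul_comm _ (h t)]
      _ = _ := h1.symm
      _ = _ := by congr 1; rw [eq_iff_iff]; omega
  have hρH : MemHardy ρ q := ⟨integrable_bounded_mul h hη.1, fun n hn => by
    rw [hρc n hn.le, if_neg hn.ne]⟩
  have heq : (fun t => (φ : Lp ℂ p arc) t * ρ t) = fun t => ψ t * η t := by
    ext t; simp only [hρ, hψ]; ring
  have hφρ := (memHardy_coe φ).mul hp' hP hρH
  have hψη := hψH.mul hp' hP hη
  set c := coeff (fun t => (φ : Lp ℂ p arc) t * ρ t) 0 with hc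
  have hconst : (fun t => (φ : Lp ℂ p arc) t * ρ t) =ᵐ[arc] fun _ => c :=
    ae_eq_const (memLp_one_iff_integrable.1 hφρ.1) hφρ.2 fun n hn => by
      rw [heq]; exact hψη.2 n hn
  have hc0 : c ≠ 0 := by
    intro h0
    have hz : ∀ᵐ t ∂arc, (φ : Lp ℂ p arc) t * ρ t = 0 := by
      filter_upwards [hconst] with t ht
      rw [ht, h0]
    have hzero : ∀ n, coeff (0 : Circle → ℂ) n = 0 := fun n => by simp [coeff]
    rcases (memHardy_coe φ).eq_zero_or_eq_zero_of_mul hp' hP hρH hz with h1 | h1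
    · rw [coeff_congr (g := 0), hzero] at hψ0
      · exact zero_ne_one hψ0
      · filter_upwards [h1] with t ht
        simp [hψ, ht]
    · have := hρc 0 le_rfl
      rw [coeff_congr h1, hzero] at this
      simp at this
  have hρ0 : ∀ᵐ t ∂arc, ρ t ≠ 0 := by
    filter_upwards [hconst] with t ht h1
    rw [h1, mul_zero] at ht
    exact hc0 ht.symm
  have hψη' : ∀ᵐ t ∂arc, ψ t * η t = c := by
    filter_upwards [hconst] with t ht
    rw [← congrFun heq t]; exact ht
  have hψ0' : ∀ᵐ t ∂arc, ψ t ≠ 0 := by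
    filter_upwards [hψη'] with t ht h1
    rw [h1, zero_mul] at ht
    exact hc0 ht.symm
  have hgpH : MemHardy (c⁻¹ • ρ) q :=
    ⟨hρH.1.const_smul _, fun n hn => by rw [coeff_smul, hρH.2 n hn, mul_zero]⟩
  have hgmi : MemConjHardy ψ⁻¹ q := by
    have : MemConjHardy (c⁻¹ • η) q :=
      ⟨hη.1.const_smul _, fun n hn => by rw [coeff_smul, hη.2 n hn, mul_zero]⟩
    refine this.congr ?_
    filter_upwards [hψη', hψ0'] with t h1 h2
    rw [Pi.smul_apply, Pi.inv_apply, ← h1, smul_eq_mul, mul_inv]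
    have h3 : η t ≠ 0 := fun h3 => hc0 (by rw [← h1, h3, mul_zero])
    field_simp
  have hheq : ∀ᵐ t ∂arc, h t = ψ t * (c⁻¹ • ρ) t := by
    filter_upwards [hconst] with t h1
    have h1 : (φ : Lp ℂ p arc) t * ρ t = c := h1
    rw [Pi.smul_apply, smul_eq_mul]
    simp only [hψ]
    field_simp
    rw [← h1]; ring
  have hgp0 : ∀ᵐ t ∂arc, (c⁻¹ • ρ) t ≠ 0 := hρ0.mono fun t ht =>
    mul_ne_zero (inv_ne_zero hc0) ht
  refine ⟨ψ, c⁻¹ • ρ, ⟨?_, hψ0, hgp0, hψ0', hgpH, ?_, hψH, hgmi⟩, S, ?_⟩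
  · filter_upwards [hh, hheq] with t h1 h2
    have h3 : g t = (t : ℂ) ^ (-n) * h t := by
      rw [h1, ← mul_assoc, ← zpow_add₀ t.coe_ne_zero, neg_add_cancel, zpow_zero, one_mul]
    rw [h3, h2]; ring
  · refine (memHardy_coe φ).congr ?_
    filter_upwards [hconst, hρ0] with t h1 h2
    have h1 : (φ : Lp ℂ p arc) t * ρ t = c := h1
    rw [Pi.inv_apply, Pi.smul_apply, smul_eq_mul, mul_inv, inv_inv, ← h1]
    field_simp
  -- The function `h · S x - x` has only coefficients of negative order, and so has its product with
  -- `g₋⁻¹`, which is `g₊ · S x - g₋⁻¹ x`. Hence `g₊ · S x` is the Riesz projection of `g₋⁻¹ x`.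
  · intro k x hx
    have hr : MemConjHardy (fun t => h t * (S x : Lp ℂ p arc) t - (x : Lp ℂ p arc) t) p ∧
        coeff (fun t => h t * (S x : Lp ℂ p arc) t - (x : Lp ℂ p arc) t) 0 = 0 := by
      have hm := integrable_bounded_mul h (Lp.memLp (S x : Lp ℂ p arc))
      have hcr : ∀ n, 0 ≤ n →
          coeff (fun t => h t * (S x : Lp ℂ p arc) t - (x : Lp ℂ p arc) t) n = 0 := fun n hn => by
        refine (coeff_sub (hm.integrable hp.out) (integrable_Lp _) n).trans ?_
        rw [← coeff_toeplitz hP h (S x) hn, hTS, sub_self]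
      exact ⟨⟨hm.sub (Lp.memLp _), fun n hn => hcr n hn.le⟩, hcr 0 le_rfl⟩
    refine ⟨fun t => (S x : Lp ℂ p arc) t * (c⁻¹ • ρ) t,
      ⟨(memHardy_coe (S x)).mul hp' hP hgpH, fun n hn => ?_⟩, ?_⟩
    · have h1 := hr.1.coeff_mul hp' hP hgmi hn
      rw [hr.2, zero_mul] at h1
      have hi1 : Integrable (fun t => (S x : Lp ℂ p arc) t * (c⁻¹ • ρ) t) arc :=
        integrable_mul (Lp.memLp _) hgpH.1
      have hi2 : Integrable (fun t => (ψ t)⁻¹ * (t : ℂ) ^ k) arc := by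
        have := integrable_mul hgmi.1 (memLp_continuous (continuous_monomial k) p)
        simpa only [zpow_natCast, Pi.inv_apply] using this
      have h2 := coeff_sub hi1 hi2 n
      rw [← sub_eq_zero, ← h2, ← h1]
      refine coeff_congr ?_ n
      filter_upwards [hheq, hψ0', hx] with t h3 h4 h5
      rw [Pi.sub_apply, h5, h3, Pi.inv_apply]
      field_simp
    · filter_upwards [hgp0] with t ht
      rw [mul_comm, mul_assoc, mul_inv_cancel₀ ht, mul_one]

end Existence

/-! ### M. Riesz' inequality for polynomials, `1 < p ≤ 2`. -/

/-- The mean value property, for the normalized arc length. -/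
lemma integral_arc_of_diffContOnCl {G : ℂ → ℂ} (hG : DiffContOnCl ℂ G (Metric.ball 0 1)) :
    ∫ t : Circle, G t ∂arc = G 0 := by
  have h1 : DiffContOnCl ℂ G (Metric.ball 0 |1|) := by rwa [abs_one]
  rw [← h1.circleAverage, Real.circleAverage_def]
  have h2 := coeff_eq_fourierCoeff (fun t : Circle => G t) 0
  rw [fourierCoeff_eq_intervalIntegral _ 0 0] at h2
  simp only [coeff, neg_zero, zpow_zero, one_mul, fourier_zero, one_smul, zero_add, div_one,
    AddCircle.toCircle_apply_mk] at h2
  rw [h2]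
  have h3 := intervalIntegral.integral_comp_mul_left (a := 0) (b := 1)
    (fun θ => G (circleMap 0 1 θ)) Real.two_pi_pos.ne'
  rw [mul_zero, mul_one] at h3
  rw [← h3]
  refine intervalIntegral.integral_congr fun x _ => ?_
  simp [circleMap, Circle.coe_exp]

/-- In the right half plane, `|w|^r` is dominated by `(Re w)^r` up to a harmonic function. -/
lemma exists_norm_rpow_le {r : ℝ} (hr1 : 1 < r) (hr2 : r ≤ 2) :
    ∃ A B : ℝ, 0 ≤ A ∧ 0 ≤ B ∧ ∀ w : ℂ, 0 < w.re →
      ‖w‖ ^ r ≤ A * w.re ^ r - B * (w ^ (r : ℂ)).re := by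
  have hπ := Real.pi_pos
  have hr0 : 0 < r := by linarith
  -- With this midpoint `rθ` lies strictly between `π/2` and `π`, so `cos (rθ) = -κ < 0`. For `|arg
  -- w| ≥ θ` the term with `κ⁻¹` alone dominates; for `|arg w| < θ`, `cos |arg w|` is bounded below
  -- and the first term pays for both.
  set θ := (Real.pi / (2 * r) + Real.pi / 2) / 2 with hθ
  have hrθ : r * θ = (Real.pi / 2 + r * (Real.pi / 2)) / 2 := by
    rw [hθ]; field_simp
  have hθ0 : 0 < θ := by positivity
  have hθ2 : θ < Real.pi / 2 := by
    have : r * θ < r * (Real.pi / 2) := by rw [hrθ]; nlinarith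
    exact lt_of_mul_lt_mul_left this hr0.le
  set κ := -Real.cos (r * θ) with hκ
  have hκ0 : 0 < κ := neg_pos.2 <| Real.cos_neg_of_pi_div_two_lt_of_lt
    (by rw [hrθ]; nlinarith) (by rw [hrθ]; nlinarith)
  have hc : 0 < Real.cos θ := Real.cos_pos_of_mem_Ioo ⟨by linarith, hθ2⟩
  have hcr : 0 < Real.cos θ ^ r := Real.rpow_pos_of_pos hc r
  refine ⟨(1 + κ⁻¹) / Real.cos θ ^ r, κ⁻¹, by positivity, by positivity, fun w hw => ?_⟩
  have hw0 : w ≠ 0 := fun h => by simp [h] at hw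
  have hn : 0 < ‖w‖ ^ r := Real.rpow_pos_of_pos (norm_pos_iff.2 hw0) r
  have harg := Complex.abs_arg_lt_pi_div_two_iff.2 (Or.inl hw)
  have hcos : Real.cos (w.arg * r) = Real.cos (r * |w.arg|) := by
    rw [← Real.cos_abs, abs_mul, abs_of_pos hr0, mul_comm]
  have hre : w.re = ‖w‖ * Real.cos |w.arg| := by
    rw [Real.cos_abs, Complex.norm_mul_cos_arg]
  have hca : 0 ≤ Real.cos |w.arg| :=
    Real.cos_nonneg_of_mem_Icc ⟨by linarith [abs_nonneg w.arg], harg.le⟩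
  rw [Complex.cpow_ofReal_re, hcos, hre, Real.mul_rpow (norm_nonneg _) hca]
  suffices h : 1 ≤ (1 + κ⁻¹) / Real.cos θ ^ r * Real.cos |w.arg| ^ r -
      κ⁻¹ * Real.cos (r * |w.arg|) by
    nlinarith
  rcases le_or_gt θ |w.arg| with h | h
  · have h1 : Real.cos (r * |w.arg|) ≤ -κ := by
      rw [hκ, neg_neg]
      exact Real.cos_le_cos_of_nonneg_of_le_pi (by positivity) (by nlinarith)
        (mul_le_mul_of_nonneg_left h hr0.le)
    have h2 : κ⁻¹ * Real.cos (r * |w.arg|) ≤ κ⁻¹ * -κ :=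
      mul_le_mul_of_nonneg_left h1 (by positivity)
    have h3 : κ⁻¹ * -κ = -1 := by field_simp
    have h4 : 0 ≤ (1 + κ⁻¹) / Real.cos θ ^ r * Real.cos |w.arg| ^ r :=
      mul_nonneg (by positivity) (Real.rpow_nonneg hca r)
    linarith
  · have h1 : Real.cos θ ^ r ≤ Real.cos |w.arg| ^ r :=
      Real.rpow_le_rpow hc.le (Real.cos_le_cos_of_nonneg_of_le_pi (abs_nonneg _) (by linarith) h.le)
        hr0.le
    have h2 : 1 + κ⁻¹ ≤ (1 + κ⁻¹) / Real.cos θ ^ r * Real.cos |w.arg| ^ r := by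
      rw [div_mul_eq_mul_div, le_div_iff₀ hcr]
      exact mul_le_mul_of_nonneg_left h1 (by positivity)
    have h3 : κ⁻¹ * Real.cos (r * |w.arg|) ≤ κ⁻¹ * 1 :=
      mul_le_mul_of_nonneg_left (Real.cos_le_one _) (by positivity)
    linarith

/-- The minimum principle for the real part. -/
lemma re_pos_of_re_pos_circle {F : ℂ → ℂ} (hF : DiffContOnCl ℂ F (Metric.ball 0 1))
    (hpos : ∀ t : Circle, 0 < (F t).re) {z : ℂ} (hz : z ∈ Metric.closedBall (0 : ℂ) 1) :
    0 < (F z).re := by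
  have hcl : closure (Metric.ball (0 : ℂ) 1) = Metric.closedBall 0 1 :=
    closure_ball 0 one_ne_zero
  have hcont : Continuous fun t : Circle => (F t).re :=
    Complex.continuous_re.comp <| (hF.2.comp_continuous continuous_circle_coe fun t => by
      rw [hcl]; exact mem_closedBall_zero_iff.2 t.norm_coe.le)
  obtain ⟨t₀, -, ht₀⟩ := isCompact_univ.exists_isMinOn ⟨(1 : Circle), trivial⟩ hcont.continuousOn
  -- The maximum principle for `exp (-F)`, whose modulus is `exp (-Re F)`.
  have hexp : DiffContOnCl ℂ (fun z => Complex.exp (-F z)) (Metric.ball 0 1) :=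
    Complex.differentiable_exp.comp_diffContOnCl hF.neg
  have h := Complex.norm_le_of_forall_mem_frontier_norm_le Metric.isBounded_ball hexp
    (C := Real.exp (-(F t₀).re)) (fun w hw => by
      rw [frontier_ball 0 one_ne_zero] at hw
      rw [Complex.norm_exp, Complex.neg_re]
      exact Real.exp_le_exp.2 (neg_le_neg (ht₀ (a := ⟨w, hw⟩) trivial))) (z := z) (by rwa [hcl])
  rw [Complex.norm_exp, Complex.neg_re, Real.exp_le_exp, neg_le_neg_iff] at h
  exact (hpos t₀).trans_le h

/-- M. Riesz' inequality for polynomials with positive real part. -/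
lemma exists_eLpNorm_le_of_re_pos {p : ℝ≥0∞} (hp1 : 1 < p) (hp2 : p ≤ 2) :
    ∃ C : NNReal, ∀ F : Polynomial ℂ, (F.eval 0).im = 0 → (∀ t : Circle, 0 < (F.eval (t : ℂ)).re) →
      eLpNorm (fun t : Circle => F.eval (t : ℂ)) p arc ≤
        C * eLpNorm (fun t : Circle => (F.eval (t : ℂ)).re) p arc := by
  have hp' : p ≠ ∞ := (hp2.trans_lt ENNReal.ofNat_lt_top).ne
  have hp0 : p ≠ 0 := (zero_lt_one.trans hp1).ne'
  set r := p.toReal with hr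
  have hr1 : 1 < r := by
    rw [hr, ← ENNReal.toReal_one]
    exact (ENNReal.toReal_lt_toReal ENNReal.one_ne_top hp').2 hp1
  have hr2 : r ≤ 2 := by
    rw [hr, ← ENNReal.toReal_ofNat]
    exact (ENNReal.toReal_le_toReal hp' ENNReal.ofNat_ne_top).2 hp2
  obtain ⟨A, B, hA, hB, hAB⟩ := exists_norm_rpow_le hr1 hr2
  refine ⟨(A ^ r⁻¹).toNNReal, fun F him hpos => ?_⟩
  have hFd : Differentiable ℂ fun z => F.eval z := F.differentiable
  have hpos' : ∀ z ∈ Metric.closedBall (0 : ℂ) 1, 0 < (F.eval z).re := fun z hz =>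
    re_pos_of_re_pos_circle hFd.diffContOnCl hpos hz
  have hG : DiffContOnCl ℂ (fun z => F.eval z ^ (r : ℂ)) (Metric.ball 0 1) := by
    refine DifferentiableOn.diffContOnCl fun z hz => ?_
    rw [closure_ball 0 one_ne_zero] at hz
    exact ((hFd z).cpow_const (Or.inl (hpos' z hz))).differentiableWithinAt
  have hmean := integral_arc_of_diffContOnCl hG
  have hFc : Continuous fun t : Circle => F.eval (t : ℂ) := F.continuous.comp continuous_circle_coe
  have hrc : Continuous fun t : Circle => (F.eval (t : ℂ)).re := Complex.continuous_re.comp hFc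
  have hGc : Continuous fun t : Circle => F.eval (t : ℂ) ^ (r : ℂ) :=
    hFc.cpow continuous_const fun t => Or.inl (hpos t)
  have hint : ∀ {f : Circle → ℝ}, Continuous f → Integrable f arc := fun hf =>
    hf.integrable_of_hasCompactSupport (HasCompactSupport.of_compactSpace _)
  -- `F(0)` is real and positive, so the mean of `Re F^r` is nonnegative and its term, entering with
  -- `-B`, can be dropped.
  have hG0 : 0 ≤ (F.eval 0 ^ (r : ℂ)).re := by
    have h0 := hpos' 0 (by simp)
    have : F.eval 0 = ((F.eval 0).re : ℂ) := Complex.ext rfl (by simpa using him)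
    rw [this, ← Complex.ofReal_cpow h0.le, Complex.ofReal_re]
    exact Real.rpow_nonneg h0.le r
  have hre : ∫ t : Circle, (F.eval (t : ℂ) ^ (r : ℂ)).re ∂arc = (F.eval 0 ^ (r : ℂ)).re := by
    rw [← hmean]
    exact integral_re ((memLp_continuous hGc 1).integrable le_rfl)
  have hi1 : Integrable (fun t : Circle => (F.eval (t : ℂ)).re ^ r) arc :=
    hint (hrc.rpow_const fun t => Or.inr (by linarith))
  have key : ∫ t : Circle, ‖F.eval (t : ℂ)‖ ^ r ∂arc ≤ A * ∫ t : Circle, (F.eval (t : ℂ)).re ^ r ∂arc := by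
    have hi2 : Integrable (fun t : Circle => (F.eval (t : ℂ) ^ (r : ℂ)).re) arc :=
      hint (Complex.continuous_re.comp hGc)
    calc _ ≤ ∫ t : Circle, (A * (F.eval (t : ℂ)).re ^ r - B * (F.eval (t : ℂ) ^ (r : ℂ)).re) ∂arc :=
          integral_mono (hint (hFc.norm.rpow_const fun t => Or.inr (by linarith)))
            ((hi1.const_mul A).sub (hi2.const_mul B)) fun t => hAB _ (hpos t)
      _ = A * ∫ t : Circle, (F.eval (t : ℂ)).re ^ r ∂arc - B * (F.eval 0 ^ (r : ℂ)).re := by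
          rw [integral_sub (hi1.const_mul A) (hi2.const_mul B), integral_const_mul,
            integral_const_mul, ← hre]
      _ ≤ _ := by nlinarith
  have hm1 : MemLp (fun t : Circle => F.eval (t : ℂ)) p arc := memLp_continuous hFc p
  have hm2 : MemLp (fun t : Circle => (F.eval (t : ℂ)).re) p arc := hm1.re
  have hr0 : 0 ≤ r⁻¹ := by positivity
  have hnn : 0 ≤ ∫ t : Circle, (F.eval (t : ℂ)).re ^ r ∂arc :=
    integral_nonneg fun t => Real.rpow_nonneg (hpos t).le r
  rw [hm1.eLpNorm_eq_integral_rpow_norm hp0 hp', hm2.eLpNorm_eq_integral_rpow_norm hp0 hp',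
    ← ENNReal.ofReal.eq_1, ← ENNReal.ofReal_mul (Real.rpow_nonneg hA _),
    ← Real.mul_rpow hA (integral_nonneg fun t => by positivity)]
  refine ENNReal.ofReal_le_ofReal (Real.rpow_le_rpow (integral_nonneg fun t => by positivity) ?_ hr0)
  simpa only [Real.norm_eq_abs, abs_of_pos (hpos _)] using key

/-- An analytic monomial with the same real part on the circle as `a t^k`. -/
def analyticMonomial (k : ℤ) (a : ℂ) : Polynomial ℂ :=
  if 0 < k then Polynomial.C a * Polynomial.X ^ k.toNat
  else if k < 0 then Polynomial.C (conj a) * Polynomial.X ^ (-k).toNat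
  else Polynomial.C (a.re : ℂ)

lemma analyticMonomial_zero (k : ℤ) : analyticMonomial k 0 = 0 := by
  simp [analyticMonomial]

lemma im_eval_zero_analyticMonomial (k : ℤ) (a : ℂ) : ((analyticMonomial k a).eval 0).im = 0 := by
  unfold analyticMonomial
  split_ifs with h1 h2
  · simp [h1]
  · simp [h2]
  · simp

lemma zpow_eq_pow_toNat (t : Circle) {k : ℤ} (hk : 0 < k) : (t : ℂ) ^ k = (t : ℂ) ^ k.toNat := by
  rw [← zpow_natCast, Int.toNat_of_nonneg hk.le]

lemma zpow_eq_conj_pow_toNat (t : Circle) {k : ℤ} (hk : k < 0) :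
    (t : ℂ) ^ k = conj ((t : ℂ) ^ (-k).toNat) := by
  rw [map_pow, ← Circle.coe_inv_eq_conj, Circle.coe_inv, inv_pow, ← zpow_natCast,
    Int.toNat_of_nonneg (by omega), zpow_neg, inv_inv]

lemma re_eval_analyticMonomial (k : ℤ) (a : ℂ) (t : Circle) :
    ((analyticMonomial k a).eval (t : ℂ)).re = (a * (t : ℂ) ^ k).re := by
  unfold analyticMonomial
  split_ifs with h1 h2
  · simp [zpow_eq_pow_toNat t h1]
  · rw [zpow_eq_conj_pow_toNat t h2]
    simp only [Polynomial.eval_mul, Polynomial.eval_C, Polynomial.eval_pow, Polynomial.eval_X]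
    generalize (t : ℂ) ^ (-k).toNat = z
    simp
  · obtain rfl : k = 0 := by omega
    simp

/-- The contribution of a monomial to the Riesz projection. -/
lemma half_eval_analyticMonomial (k : ℤ) (a : ℂ) (t : Circle) :
    (2 : ℂ)⁻¹ * (((analyticMonomial k a).eval (t : ℂ) + (analyticMonomial k a).eval 0) + Complex.I *
      ((analyticMonomial k (-Complex.I * a)).eval (t : ℂ) +
        (analyticMonomial k (-Complex.I * a)).eval 0)) =
      if 0 ≤ k then a * (t : ℂ) ^ k else 0 := by
  unfold analyticMonomial
  have hI := Complex.I_mul_I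
  split_ifs with h1 h2 h2 h3 h3
  · have : k.toNat ≠ 0 := by omega
    simp only [Polynomial.eval_mul, Polynomial.eval_C, Polynomial.eval_pow, Polynomial.eval_X,
      zero_pow this, zpow_eq_pow_toNat t h1]
    linear_combination (-(2 : ℂ)⁻¹ * a * (t : ℂ) ^ k.toNat) * hI
  · omega
  · omega
  · have : (-k).toNat ≠ 0 := by omega
    have hc : conj (-Complex.I * a) = Complex.I * conj a := by simp
    simp only [Polynomial.eval_mul, Polynomial.eval_C, Polynomial.eval_pow, Polynomial.eval_X,
      zero_pow this, hc]
    linear_combination ((2 : ℂ)⁻¹ * conj a * (t : ℂ) ^ (-k).toNat) * hI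
  · obtain rfl : k = 0 := by omega
    simp only [Polynomial.eval_C]
    apply Complex.ext <;> simp <;> ring
  · omega

/-- An analytic polynomial with the same real part on the circle as a trigonometric polynomial. -/
def analyticPolynomial (c : ℤ →₀ ℂ) : Polynomial ℂ := c.sum analyticMonomial

lemma im_eval_zero_analyticPolynomial (c : ℤ →₀ ℂ) : ((analyticPolynomial c).eval 0).im = 0 := by
  rw [analyticPolynomial, Finsupp.sum, Polynomial.eval_finsetSum, Complex.im_sum]
  exact Finset.sum_eq_zero fun k _ => im_eval_zero_analyticMonomial k _

lemma re_eval_analyticPolynomial (c : ℤ →₀ ℂ) (t : Circle) :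
    ((analyticPolynomial c).eval (t : ℂ)).re = (trig c t).re := by
  rw [analyticPolynomial, trig, Finsupp.sum, Finsupp.sum, Polynomial.eval_finsetSum,
    Complex.re_sum, Complex.re_sum]
  exact Finset.sum_congr rfl fun k _ => re_eval_analyticMonomial k _ t

/-- The two polynomials have real parts `Re c` and `Im c` on the circle. In `F + iG` the negative
frequencies cancel and the positive ones double; the values at `0` are added because the constant
term does not double. -/
lemma trig_filter_eq (c : ℤ →₀ ℂ) (t : Circle) :
    trig (c.filter fun k => 0 ≤ k) t = (2 : ℂ)⁻¹ * (((analyticPolynomial c).eval (t : ℂ) +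
      (analyticPolynomial c).eval 0) + Complex.I *
      ((analyticPolynomial (-Complex.I • c)).eval (t : ℂ) +
        (analyticPolynomial (-Complex.I • c)).eval 0)) := by
  have h1 : analyticPolynomial (-Complex.I • c) =
      c.sum fun k a => analyticMonomial k (-Complex.I * a) :=
    Finsupp.sum_smul_index' fun k => analyticMonomial_zero k
  rw [h1]
  simp only [analyticPolynomial, trig, Finsupp.sum, Polynomial.eval_finsetSum,
    Finsupp.support_filter, ← Finset.sum_add_distrib, Finset.mul_sum, half_eval_analyticMonomial]
  rw [Finset.sum_filter]
  refine Finset.sum_congr rfl fun k _ => ?_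
  split_ifs with h
  · rw [Finsupp.filter_apply_pos _ _ h]
  · rfl

/-- M. Riesz' inequality: the `L^p` norm of an analytic polynomial is controlled by that of its
real part. -/
lemma exists_eLpNorm_le_re {p : ℝ≥0∞} (hp1 : 1 < p) (hp2 : p ≤ 2) :
    ∃ C : NNReal, ∀ F : Polynomial ℂ, (F.eval 0).im = 0 →
      eLpNorm (fun t : Circle => F.eval (t : ℂ)) p arc ≤
        C * eLpNorm (fun t : Circle => (F.eval (t : ℂ)).re) p arc := by
  obtain ⟨C, hC⟩ := exists_eLpNorm_le_of_re_pos hp1 hp2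
  refine ⟨2 * C, fun F him => ENNReal.le_of_forall_pos_le_add fun ε hε _ => ?_⟩
  have hcont : ∀ G : Polynomial ℂ, Continuous fun t : Circle => G.eval (t : ℂ) := fun G =>
    G.continuous.comp continuous_circle_coe
  set N := eLpNorm (fun t : Circle => (F.eval (t : ℂ)).re) p arc with hN
  -- Two applications of the positive case each cost `3 C δ`, together at most `ε`.
  set δ : NNReal := ε / (6 * C + 1) with hδ
  have hδ0 : 0 < δ := by positivity
  have hvc : Continuous fun t : Circle => (F.eval (t : ℂ)).re :=
    Complex.continuous_re.comp (hcont F)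
  have hbd : ∀ G : Polynomial ℂ, (G.eval 0).im = 0 → (∀ t : Circle, 0 < (G.eval (t : ℂ)).re) →
      (∀ t : Circle, (G.eval (t : ℂ)).re ≤ ‖(F.eval (t : ℂ)).re‖ + 3 * δ) →
      eLpNorm (fun t : Circle => G.eval (t : ℂ)) p arc ≤ C * (N + 3 * δ) := fun G h1 h2 h3 => by
    refine (hC G h1 h2).trans (mul_le_mul_right ?_ _)
    calc eLpNorm (fun t : Circle => (G.eval (t : ℂ)).re) p arc
        ≤ eLpNorm ((fun t : Circle => ‖(F.eval (t : ℂ)).re‖) + fun _ => 3 * (δ : ℝ)) p arc :=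
          eLpNorm_mono_real fun t => by
            rw [Real.norm_eq_abs, abs_of_pos (h2 t)]; exact h3 t
      _ ≤ _ := eLpNorm_add_le hvc.norm.aestronglyMeasurable
          aestronglyMeasurable_const hp1.le
      _ ≤ N + 3 * δ := by
          rw [eLpNorm_norm]
          refine add_le_add le_rfl ((eLpNorm_le_of_ae_bound (C := 3 * (δ : ℝ))
            (Filter.Eventually.of_forall fun t => ?_)).trans ?_)
          · rw [Real.norm_eq_abs, abs_of_nonneg (by positivity)]
          · rw [measure_univ, ENNReal.one_rpow, one_mul,
              ENNReal.ofReal_mul (by norm_num), ENNReal.ofReal_coe_nnreal]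
            norm_num
  -- `F = G - (G - F)`, where `Re G` is uniformly close to the positive part of `Re F` plus `2δ`. An
  -- error below `δ` leaves both real parts positive and at most `|Re F| + 3δ`.
  obtain ⟨c, hc⟩ := exists_trig_near
    ⟨fun t : Circle => ((max (F.eval (t : ℂ)).re 0 + 2 * δ : ℝ) : ℂ),
      Complex.continuous_ofReal.comp ((hvc.max continuous_const).add continuous_const)⟩
    (NNReal.coe_pos.2 hδ0)
  set G := analyticPolynomial c with hG
  have hGre : ∀ t : Circle, |max (F.eval (t : ℂ)).re 0 + 2 * δ - (G.eval (t : ℂ)).re| < δ := by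
    intro t
    rw [hG, re_eval_analyticPolynomial]
    refine lt_of_le_of_lt ?_ (hc t)
    refine le_trans (le_of_eq ?_) (Complex.abs_re_le_norm _)
    simp
  have hG1 := hbd G (im_eval_zero_analyticPolynomial c)
    (fun t => by
      have := abs_lt.1 (hGre t)
      linarith [le_max_right (F.eval (t : ℂ)).re 0, NNReal.coe_pos.2 hδ0])
    (fun t => by
      have := abs_lt.1 (hGre t)
      have h2 : max (F.eval (t : ℂ)).re 0 ≤ ‖(F.eval (t : ℂ)).re‖ :=
        max_le (le_abs_self _) (norm_nonneg _)
      linarith)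
  have hG2 := hbd (G - F) (by
      rw [Polynomial.eval_sub, Complex.sub_im, him, im_eval_zero_analyticPolynomial, sub_zero])
    (fun t => by
      have := abs_lt.1 (hGre t)
      rw [Polynomial.eval_sub, Complex.sub_re]
      linarith [le_max_left (F.eval (t : ℂ)).re 0, NNReal.coe_pos.2 hδ0])
    (fun t => by
      have := abs_lt.1 (hGre t)
      rw [Polynomial.eval_sub, Complex.sub_re]
      have h2 : max (F.eval (t : ℂ)).re 0 - (F.eval (t : ℂ)).re ≤ ‖(F.eval (t : ℂ)).re‖ := by
        rw [sub_le_iff_le_add]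
        exact max_le (by linarith [norm_nonneg (F.eval (t : ℂ)).re])
          (by linarith [neg_abs_le (F.eval (t : ℂ)).re, Real.norm_eq_abs (F.eval (t : ℂ)).re])
      linarith)
  have hsum : (fun t : Circle => F.eval (t : ℂ)) =
      (fun t : Circle => G.eval (t : ℂ)) - fun t : Circle => (G - F).eval (t : ℂ) := by
    ext t; simp
  have hδε : (C : ℝ≥0∞) * (3 * δ) + C * (3 * δ) ≤ ε := by
    norm_cast
    rw [hδ, ← NNReal.coe_le_coe]
    push_cast
    have : (0 : ℝ) < 6 * C + 1 := by positivity
    have h2 : (C : ℝ) * (3 * (ε / (6 * C + 1))) + C * (3 * (ε / (6 * C + 1))) =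
        ε * (6 * C) / (6 * C + 1) := by field_simp; ring
    rw [h2, div_le_iff₀ this]
    nlinarith [ε.coe_nonneg]
  calc _ ≤ eLpNorm (fun t : Circle => G.eval (t : ℂ)) p arc +
        eLpNorm (fun t : Circle => (G - F).eval (t : ℂ)) p arc := by
        rw [hsum]
        exact eLpNorm_sub_le (hcont G).aestronglyMeasurable (hcont _).aestronglyMeasurable hp1.le
    _ ≤ C * (N + 3 * δ) + C * (N + 3 * δ) := add_le_add hG1 hG2
    _ = 2 * C * N + (C * (3 * δ) + C * (3 * δ)) := by ring
    _ ≤ _ := by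
      push_cast
      exact add_le_add le_rfl hδε

/-- `F(0)` is the mean of `F` over the circle, and arc length has total mass one. -/
lemma eLpNorm_eval_zero_le {p : ℝ≥0∞} (hp1 : 1 ≤ p) (F : Polynomial ℂ) :
    eLpNorm (fun _ : Circle => F.eval 0) p arc ≤
      eLpNorm (fun t : Circle => F.eval (t : ℂ)) p arc := by
  have hc : Continuous fun t : Circle => F.eval (t : ℂ) :=
    F.continuous.comp continuous_circle_coe
  have h1 : eLpNorm (fun _ : Circle => F.eval 0) p arc = ‖F.eval 0‖ₑ := by
    rw [eLpNorm_const _ (zero_lt_one.trans_le hp1).ne' (NeZero.ne arc)]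
    simp
  rw [h1, ← integral_arc_of_diffContOnCl (G := fun z => F.eval z) F.differentiable.diffContOnCl]
  refine (enorm_integral_le_lintegral_enorm _).trans ?_
  rw [← eLpNorm_one_eq_lintegral_enorm]
  exact eLpNorm_le_eLpNorm_of_exponent_le hp1 hc.aestronglyMeasurable

/-- Boundedness of the Riesz projection on trigonometric polynomials, for `1 < p ≤ 2`. -/
lemma exists_eLpNorm_trig_filter_le {p : ℝ≥0∞} (hp1 : 1 < p) (hp2 : p ≤ 2) :
    ∃ C : NNReal, ∀ c : ℤ →₀ ℂ,
      eLpNorm (trig (c.filter fun k => 0 ≤ k)) p arc ≤ C * eLpNorm (trig c) p arc := by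
  obtain ⟨C, hC⟩ := exists_eLpNorm_le_re hp1 hp2
  refine ⟨4 * C, fun c => ?_⟩
  have hcont : ∀ G : Polynomial ℂ, AEStronglyMeasurable (fun t : Circle => G.eval (t : ℂ)) arc :=
    fun G => (G.continuous.comp continuous_circle_coe).aestronglyMeasurable
  have hbd : ∀ d : ℤ →₀ ℂ, (∀ t, ‖(trig d t).re‖ ≤ ‖trig c t‖) →
      eLpNorm (fun t : Circle => (analyticPolynomial d).eval (t : ℂ)) p arc ≤
        C * eLpNorm (trig c) p arc := fun d hd => by
    refine (hC _ (im_eval_zero_analyticPolynomial d)).trans (mul_le_mul_right ?_ _)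
    exact eLpNorm_mono fun t => by rw [re_eval_analyticPolynomial]; exact hd t
  have hsmul : ∀ t, trig (-Complex.I • c) t = -Complex.I * trig c t := fun t => by
    rw [trig, Finsupp.sum_smul_index' (by simp), trig, Finsupp.sum, Finsupp.sum, Finset.mul_sum]
    simp only [smul_eq_mul, mul_assoc]
  have h1 := hbd c fun t => Complex.abs_re_le_norm _
  have h2 := hbd (-Complex.I • c) fun t => (Complex.abs_re_le_norm _).trans (by
    rw [hsmul, norm_mul, norm_neg, Complex.norm_I, one_mul])
  set F := analyticPolynomial c
  set G := analyticPolynomial (-Complex.I • c)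
  have hle : ∀ t : Circle, ‖trig (c.filter fun k => 0 ≤ k) t‖ ≤
      ‖((fun t : Circle => ‖F.eval (t : ℂ)‖) + (fun _ => ‖F.eval 0‖) +
        ((fun t : Circle => ‖G.eval (t : ℂ)‖) + (fun _ => ‖G.eval 0‖)) : Circle → ℝ) t‖ := fun t => by
    rw [trig_filter_eq, norm_mul]
    simp only [Pi.add_apply]
    rw [Real.norm_of_nonneg (by positivity)]
    have h3 := norm_add_le (F.eval (t : ℂ) + F.eval 0) (Complex.I * (G.eval (t : ℂ) + G.eval 0))
    rw [norm_mul, Complex.norm_I, one_mul] at h3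
    have h4 := norm_add_le (F.eval (t : ℂ)) (F.eval 0)
    have h5 := norm_add_le (G.eval (t : ℂ)) (G.eval 0)
    have h6 : ‖(2 : ℂ)⁻¹‖ ≤ 1 := by norm_num
    exact (mul_le_of_le_one_left (norm_nonneg _) h6).trans (by linarith)
  refine (eLpNorm_mono hle).trans ?_
  refine (eLpNorm_add_le ((hcont F).norm.add aestronglyMeasurable_const)
    ((hcont G).norm.add aestronglyMeasurable_const) hp1.le).trans ?_
  refine (add_le_add (eLpNorm_add_le (hcont F).norm aestronglyMeasurable_const hp1.le)
    (eLpNorm_add_le (hcont G).norm aestronglyMeasurable_const hp1.le)).trans ?_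
  have h3 : ∀ H : Polynomial ℂ, eLpNorm (fun _ : Circle => ‖H.eval 0‖) p arc ≤
      eLpNorm (fun t : Circle => H.eval (t : ℂ)) p arc := fun H => by
    rw [eLpNorm_norm (fun _ : Circle => H.eval 0)]
    exact eLpNorm_eval_zero_le hp1.le H
  rw [eLpNorm_norm (fun t : Circle => F.eval (t : ℂ)), eLpNorm_norm (fun t : Circle => G.eval (t : ℂ))]
  refine (add_le_add (add_le_add h1 ((h3 F).trans h1)) (add_le_add h2 ((h3 G).trans h2))).trans ?_
  push_cast
  exact le_of_eq (by ring)

/-! ### Boundedness of the Riesz projection on `L^p`, `1 < p < ∞`. -/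

section Existence

variable {p : ℝ≥0∞} [hp : Fact (1 ≤ p)]

/-- Trigonometric polynomials as elements of `L^p`. -/
def trigLp (p : ℝ≥0∞) [Fact (1 ≤ p)] : (ℤ →₀ ℂ) →ₗ[ℂ] Lp ℂ p arc where
  toFun c := (memLp_continuous (continuous_trig c) p).toLp
  map_add' c d := by
    rw [← MemLp.toLp_add]
    refine MemLp.toLp_congr _ _ (Filter.Eventually.of_forall fun t => ?_)
    exact Finsupp.sum_add_index' (by simp) fun _ _ _ => add_mul _ _ _
  map_smul' a c := by
    rw [RingHom.id_apply, ← MemLp.toLp_const_smul]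
    refine MemLp.toLp_congr _ _ (Filter.Eventually.of_forall fun t => ?_)
    rw [Pi.smul_apply, trig, Finsupp.sum_smul_index' (by simp), trig, Finsupp.smul_sum]
    simp only [smul_eq_mul, mul_assoc]

lemma coe_trigLp (c : ℤ →₀ ℂ) : trigLp p c =ᵐ[arc] trig c :=
  (memLp_continuous (continuous_trig c) p).coeFn_toLp

lemma coeff_trigLp (c : ℤ →₀ ℂ) (n : ℤ) : coeff (trigLp p c) n = c n := by
  rw [coeff_congr (coe_trigLp c), coeff_trig]

lemma denseRange_trigLp (hp' : p ≠ ∞) : DenseRange (trigLp p) := by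
  intro f
  rw [Metric.mem_closure_iff]
  intro ε hε
  obtain ⟨c, hc⟩ := exists_trig_eLpNorm_sub_le hp.out hp' (Lp.memLp f)
    (ENNReal.ofReal_pos.2 (half_pos hε)).ne'
  refine ⟨trigLp p c, ⟨c, rfl⟩, lt_of_le_of_lt ?_ (half_lt_self hε)⟩
  rw [dist_eq_norm, Lp.norm_def]
  refine ENNReal.toReal_le_of_le_ofReal (half_pos hε).le (le_trans (le_of_eq ?_) hc)
  refine eLpNorm_congr_ae ?_
  filter_upwards [Lp.coeFn_sub f (trigLp p c), coe_trigLp (p := p) c] with t h1 h2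
  rw [h1, Pi.sub_apply, Pi.sub_apply, h2]

/-- Truncation is bounded on the dense trigonometric polynomials and extends by continuity; its
action on coefficients extends because `coeffL` is continuous. -/
lemma hasRieszProjection_of_le_two (hp1 : 1 < p) (hp2 : p ≤ 2) : HasRieszProjection p := by
  have hp' : p ≠ ∞ := (hp2.trans_lt ENNReal.ofNat_lt_top).ne
  obtain ⟨C, hC⟩ := exists_eLpNorm_trig_filter_le hp1 hp2
  let F : (ℤ →₀ ℂ) →ₗ[ℂ] (ℤ →₀ ℂ) :=
    { toFun := fun c => c.filter fun k => 0 ≤ k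
      map_add' := fun c d => Finsupp.filter_add
      map_smul' := fun a c => Finsupp.filter_smul }
  have hd := denseRange_trigLp (p := p) hp'
  have hbd : ∀ c, ‖(trigLp p ∘ₗ F) c‖ ≤ C * ‖trigLp p c‖ := fun c => by
    have h1 : ∀ d, ‖trigLp p d‖ = (eLpNorm (trig d) p arc).toReal := fun d =>
      Lp.norm_toLp _ (memLp_continuous (continuous_trig d) p)
    rw [LinearMap.comp_apply, h1, h1, ← ENNReal.coe_toReal, ← ENNReal.toReal_mul]
    exact ENNReal.toReal_mono (ENNReal.mul_ne_top ENNReal.coe_ne_top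
      (memLp_continuous (continuous_trig c) p).eLpNorm_ne_top) (hC c)
  set P := (trigLp p ∘ₗ F).extendOfNorm (trigLp p) with hP
  have hPt : ∀ c, P (trigLp p c) = trigLp p (F c) := fun c =>
    LinearMap.extendOfNorm_eq hd ⟨C, hbd⟩ c
  have hcoeff : ∀ (n : ℤ) (f : Lp ℂ p arc), coeff (P f) n = if 0 ≤ n then coeff f n else 0 := by
    intro n f
    have h : coeffL p n ∘L P = if 0 ≤ n then coeffL p n else 0 := by
      refine ContinuousLinearMap.coeFn_injective (hd.equalizer (by fun_prop) (by fun_prop) ?_)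
      ext c
      simp only [Function.comp_apply, ContinuousLinearMap.comp_apply, hPt, coeffL_apply,
        coeff_trigLp]
      change (c.filter fun k => 0 ≤ k) n = _
      rw [Finsupp.filter_apply]
      split_ifs
      · rw [coeffL_apply, coeff_trigLp]
      · rfl
    have h2 := DFunLike.congr_fun h f
    refine h2.trans ?_
    split_ifs <;> rfl
  refine ⟨P.codRestrict (Hardy p) fun f n hn => ?_, fun f n hn => ?_⟩
  · rw [hcoeff, if_neg (by omega)]
  · exact (hcoeff n f).trans (if_pos hn)

/-- By the closed graph theorem, the Riesz projection is bounded as soon as it is defined on all of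
`L^p`. -/
lemma hasRieszProjection_of_forall_exists
    (h : ∀ f : Lp ℂ p arc, ∃ φ : Hardy p, ∀ n : ℤ, 0 ≤ n → coeff (φ : Lp ℂ p arc) n = coeff f n) :
    HasRieszProjection p := by
  choose P hP using h
  let L : Lp ℂ p arc →ₗ[ℂ] Hardy p :=
    { toFun := P
      map_add' := fun f g => Hardy_eq_of_coeff_eq fun n hn => by
        rw [hP _ n hn]
        change coeffL p n (f + g) = coeffL p n ((P f : Lp ℂ p arc) + P g)
        rw [map_add, map_add]
        simp only [coeffL_apply, hP _ n hn]
      map_smul' := fun a f => Hardy_eq_of_coeff_eq fun n hn => by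
        rw [hP _ n hn]
        change coeffL p n (a • f) = coeffL p n (a • (P f : Lp ℂ p arc))
        rw [map_smul, map_smul]
        simp only [coeffL_apply, hP _ n hn] }
  -- The graph is closed because coefficients are continuous and determine an element of `H^p`.
  have hL : Continuous L := L.continuous_of_seq_closed_graph fun u f φ hu hφ => by
    refine Hardy_eq_of_coeff_eq fun n hn => ?_
    have h1 : Filter.Tendsto (fun j => coeffL p n (L (u j) : Lp ℂ p arc)) Filter.atTop
        (nhds (coeffL p n φ)) :=
      (((coeffL p n).continuous.comp continuous_subtype_val).tendsto φ).comp hφ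
    have h2 := ((coeffL p n).continuous.tendsto f).comp hu
    have h3 : (fun j => coeffL p n (L (u j) : Lp ℂ p arc)) = coeffL p n ∘ u := by
      ext j; exact hP (u j) n hn
    rw [h3] at h1
    exact (tendsto_nhds_unique h1 h2).trans (hP f n hn).symm
  exact ⟨⟨L, hL⟩, hP⟩

/-- The Riesz projection of `L^p` is the transpose of the one of `L^q`. -/
lemma HasRieszProjection.dual {q : ℝ≥0∞} [hq : Fact (1 ≤ q)] [hqp : q.HolderConjugate p]
    (hq1 : 1 < q) (hq' : q ≠ ∞) (hQ : HasRieszProjection q) : HasRieszProjection p := by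
  refine hasRieszProjection_of_forall_exists fun f => ?_
  have hpq : p.HolderConjugate q := hqp.symm
  have hmem : MemLp (fun t : Circle => (t : ℂ) ^ (1 : ℤ) * f t) p arc :=
    memLp_continuous_mul (continuous_monomial 1) (Lp.memLp f)
  obtain ⟨Q, hQ⟩ := hQ
  let Λ : Lp ℂ q arc →L[ℂ] ℂ := (ContinuousLinearMap.mul ℂ ℂ).lpPairing arc p q hmem.toLp ∘L
    (Hardy q).subtypeL ∘L Q
  obtain ⟨η, hη, hΛ⟩ := exists_memLp_eq_integral hq1 hq' (q := p) Λ
  -- The transpose keeps orders `n ≤ 0`. The extra factor `t` in `Λ` turns this into orders `n < 0`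
  -- of `f`, so `t⁻¹ η` is exactly the part of `f` to subtract.
  have hηc : ∀ n, coeff η n = if n ≤ 0 then coeff f (n - 1) else 0 := fun n => by
    have hQn : ∀ᵐ t ∂arc, (Q (monomialLp q (-n)) : Lp ℂ q arc) t =
        if n ≤ 0 then (t : ℂ) ^ (-n) else 0 := by
      refine ae_eq_of_coeff_eq (integrable_Lp _) ?_ fun m => ?_
      · split_ifs
        · exact (memLp_continuous (continuous_monomial _) 1).integrable le_rfl
        · exact integrable_const _
      · rcases lt_or_ge m 0 with hm | hm
        · rw [(Q _).2 m hm]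
          split_ifs with h
          · rw [coeff_monomial, if_neg (by omega)]
          · rw [coeff_const, ite_self]
        · rw [hQ _ m hm, coeff_congr (coe_monomialLp q (-n)), coeff_monomial]
          split_ifs with h1 h2 h2
          · rw [coeff_monomial, if_pos h1]
          · omega
          · rw [coeff_monomial, if_neg h1]
          · rw [coeff_const, ite_self]
    have h1 : Λ (monomialLp q (-n)) = coeff η n := by
      rw [hΛ, coeff]
      refine integral_congr_ae ?_
      filter_upwards [coe_monomialLp q (-n)] with t ht
      rw [ht]
    rw [← h1]
    have h2 : Λ (monomialLp q (-n)) =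
        ∫ t, hmem.toLp _ t * (Q (monomialLp q (-n)) : Lp ℂ q arc) t ∂arc :=
      ContinuousLinearMap.lpPairing_eq_integral _ _ _
    have h3 : Λ (monomialLp q (-n)) =
        ∫ t : Circle, ((t : ℂ) ^ (1 : ℤ) * f t) * (if n ≤ 0 then (t : ℂ) ^ (-n) else 0) ∂arc := by
      rw [h2]
      refine integral_congr_ae ?_
      filter_upwards [hQn, hmem.coeFn_toLp] with t h4 h5
      rw [h4, h5]
    rw [h3]
    split_ifs
    · rw [← coeff_monomial_mul, coeff]
      exact integral_congr_ae (Filter.Eventually.of_forall fun t => mul_comm _ _)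
    · simp
  have hm2 := memLp_continuous_mul (continuous_monomial (-1)) hη
  have hm3 := (Lp.memLp f).sub hm2
  have hc : ∀ n, coeff (f - fun t : Circle => (t : ℂ) ^ (-1 : ℤ) * η t) n =
      if 0 ≤ n then coeff f n else 0 := fun n => by
    rw [coeff_sub (integrable_Lp f) (hm2.integrable hp.out), coeff_monomial_mul, hηc]
    split_ifs with h1 h2 h2
    · omega
    · rw [sub_neg_eq_add, add_sub_cancel_right, sub_self]
    · rw [sub_zero]
    · omega
  have hH : MemHardy (f - fun t : Circle => (t : ℂ) ^ (-1 : ℤ) * η t) p :=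
    ⟨hm3, fun n hn => by rw [hc, if_neg (by omega)]⟩
  exact ⟨hH.toHardy, fun n hn => by rw [coeff_congr hH.coe_toHardy, hc, if_pos hn]⟩

/-- The theorem of M. Riesz: the Riesz projection is bounded on `L^p` for `1 < p < ∞`. -/
theorem hasRieszProjection (hp1 : 1 < p) (hp' : p ≠ ∞) : HasRieszProjection p := by
  rcases le_total p 2 with h | h
  · exact hasRieszProjection_of_le_two hp1 h
  · let q := ENNReal.conjExponent p
    have hqp : q.HolderConjugate p := (ENNReal.HolderConjugate.conjExponent hp.out).symm
    have hq1 : 1 < q := ENNReal.lt_add_right ENNReal.one_ne_top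
      (ENNReal.inv_ne_zero.2 (ENNReal.sub_ne_top hp'))
    have hp2 : 1 ≤ p - 1 :=
      ENNReal.le_sub_of_add_le_left ENNReal.one_ne_top (by rwa [one_add_one_eq_two])
    have hq2 : q ≤ 2 := by
      rw [← one_add_one_eq_two]
      exact add_le_add le_rfl (ENNReal.inv_le_one.2 hp2)
    have : Fact (1 ≤ q) := ⟨hq1.le⟩
    exact (hasRieszProjection_of_le_two hq1 hq2).dual hq1 (hq2.trans_lt ENNReal.ofNat_lt_top).ne

end Existence

end GenTH

end

/-! ### The theorem. -/

theorem theorem4p2 (β : ℂ) (hβ : 1 < ‖β‖)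
    (p q : ℝ≥0∞) [Fact (1 ≤ p)] (hp : 1 < p) (hp' : p < ∞) (hpq : p.HolderConjugate q)
    (g : Lp ℂ ∞ GenTH.arc)
    (hmatch : ∀ᵐ t ∂GenTH.arc, g t * g (GenTH.shift β hβ t) = 1)
    (hF : (GenTH.toeplitz p g).IsFredholm)
    (n : ℤ) (hn : GenTH.fredholmIndex (GenTH.toeplitz p g) = n) :
    (∃ gm gp : Circle → ℂ, GenTH.IsWienerHopf p q g gm (-n) gp) ∧
    ∀ gm gp : Circle → ℂ, GenTH.IsWienerHopf p q g gm (-n) gp →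
      (GenTH.signature β n gp = 1 ∨ GenTH.signature β n gp = -1) ∧
      ∀ᵐ t ∂GenTH.arc, g t =
        GenTH.signature β n gp * gp t * GenTH.chi β t ^ (-n) * (gp (GenTH.shift β hβ t))⁻¹ := by
  have hP := GenTH.hasRieszProjection hp hp'.ne
  refine ⟨?_, fun gm gp h => h.toIsWeakWienerHopf.signature hβ hp'.ne hP hmatch⟩
  have hmem : MemLp (fun t : Circle => (t : ℂ) ^ n * g t) ∞ GenTH.arc :=
    GenTH.memLp_continuous_mul (GenTH.continuous_monomial n) (Lp.memLp g)
  exact GenTH.exists_isWienerHopf_of_bijective hp hp'.ne hP hmem.coeFn_toLp <|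
    GenTH.toeplitz_bijective (q := q) hp hp'.ne hP (GenTH.ae_ne_zero_of_shift hβ hmatch) hF hn
      hmem.coeFn_toLp
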